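/- Let $d\ge 1$ and $\ell$ be natural numbers, let $\alpha\in(0,d)$ and $p=\frac{d}{d-\alpha}$. Call a function $\Psi$ between Euclidean spaces positively $q$-homogeneous if $\Psi(\lambda y)=\lambda^q\Psi(y)$ for all $y$ and all $\lambda>0$. Let $K\colon\mathbb{R}^d\to\mathbb{R}^\ell$ be positively $(\alpha-d)$-homogeneous and Lipschitz on the unit sphere $S^{d-1}$, and let $\Phi\colon\mathbb{R}^\ell\to\mathbb{R}$ be positively $p$-homogeneous and Lipschitz on the unit sphere of $\mathbb{R}^\ell$. Let $\sigma$ be the surface measure on $S^{d-1}$ (the $(d-1)$-dimensional Hausdorff measure; the counting measure if $d=1$). Fix $\xi\in S^{d-1}$ and let $\Omega=\{x\in\mathbb{R}^d : \langle x,\xi\rangle>0\}$. For every bounded compactly supported measurable $f\colon\mathbb{R}^d\to\mathbb{R}$ with $\int_{\mathbb{R}^d} f=0$, the convolution $K*f(x)=\int_{\mathbb{R}^d}K(x-t)f(t)\,dt$ converges absolutely at every $x\in\mathbb{R}^d$, and $\Phi(K*f)$ is integrable over $\Omega$. Moreover, there is a constant $C$ such that $$\Big|\int_\Omega\Phi\big(K*f(x)\big)\,dx\Big|\le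 C\,\|f\|_{L_1(\mathbb{R}^d)}^p$$ for all such $f$ if and only if both $$\int_{S^{d-1}}\Phi(K(\zeta))\,d\sigma(\zeta)=0\quad\text{and}\quad\int_{S^{d-1}}\Phi(-K(\zeta))\,d\sigma(\zeta)=0$$ and $$\int_{\zeta\in S^{d-1},\ \langle\zeta,\xi\rangle>0}\Phi(K(\zeta))\,d\sigma(\zeta)=0\quad\text{and}\quad\int_{\zeta\in S^{d-1},\ \langle\zeta,\xi\rangle>0}\Phi(-K(\zeta))\,d\sigma(\zeta)=0$$ hold. -/

import Mathlib

open MeasureTheory Metric Set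
open scoped Convolution RealInnerProductSpace

/-- `Ψ` is positively `q`-homogeneous: `Ψ (c y) = c ^ q Ψ y` for every `y` and every `c > 0`. -/
def PosHomogeneous {E F : Type*} [AddCommGroup E] [Module ℝ E] [AddCommGroup F] [Module ℝ F]
    (q : ℝ) (Ψ : E → F) : Prop :=
  ∀ (y : E) (c : ℝ), 0 < c → Ψ (c • y) = c ^ q • Ψ y

/-- `Ψ` is Lipschitz on the unit sphere. -/
def LipschitzOnSphere {E F : Type*} [NormedAddCommGroup E] [NormedAddCommGroup F]
    (Ψ : E → F) : Prop :=
  ∃ L : NNReal, LipschitzOnWith L Ψ (sphere 0 1)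

/-- The bounded (measurable) compactly supported real functions on `ℝ^d` with zero mean. -/
structure BoundedCompactZeroMean {d : ℕ} (f : EuclideanSpace ℝ (Fin d) → ℝ) : Prop where
  aestronglyMeasurable : AEStronglyMeasurable f volume
  bounded : ∃ M : ℝ, ∀ x, |f x| ≤ M
  hasCompactSupport : HasCompactSupport f
  integral_eq_zero : ∫ x, f x = 0

/-- The convolution `K * f (x) = ∫ f t • K (x - t) dt` of a vector valued kernel with a scalar
function. -/
noncomputable def kernelConv {d l : ℕ}
    (K : EuclideanSpace ℝ (Fin d) → EuclideanSpace ℝ (Fin l))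
    (f : EuclideanSpace ℝ (Fin d) → ℝ) : EuclideanSpace ℝ (Fin d) → EuclideanSpace ℝ (Fin l) :=
  f ⋆[ContinuousLinearMap.lsmul ℝ ℝ, volume] K

/-- The open half-space `{x | ⟨x, ξ⟩ > 0}`. -/
def halfSpace {d : ℕ} (ξ : EuclideanSpace ℝ (Fin d)) : Set (EuclideanSpace ℝ (Fin d)) :=
  {x | 0 < ⟪x, ξ⟫}

/-- The surface measure on the unit sphere of `ℝ^d`, i.e. the `(d - 1)`-dimensional Hausdorff
measure with its usual normalization (the counting measure of `{1, -1}` if `d = 1`). -/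
noncomputable def surfaceMeasure (d : ℕ) : Measure (sphere (0 : EuclideanSpace ℝ (Fin d)) 1) :=
  (volume : Measure (EuclideanSpace ℝ (Fin d))).toSphere

/-- The cancellation conditions on the full sphere. -/
def SphereCancellation {d l : ℕ} (K : EuclideanSpace ℝ (Fin d) → EuclideanSpace ℝ (Fin l))
    (Φ : EuclideanSpace ℝ (Fin l) → ℝ) : Prop :=
  ∫ ζ, Φ (K ζ) ∂(surfaceMeasure d) = 0 ∧ ∫ ζ, Φ (-K ζ) ∂(surfaceMeasure d) = 0

/-- The cancellation conditions on the half-sphere `{ζ | ⟨ζ, ξ⟩ > 0}`. -/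
def HalfSphereCancellation {d l : ℕ} (K : EuclideanSpace ℝ (Fin d) → EuclideanSpace ℝ (Fin l))
    (Φ : EuclideanSpace ℝ (Fin l) → ℝ) (ξ : EuclideanSpace ℝ (Fin d)) : Prop :=
  ∫ ζ in {ζ | 0 < ⟪(ζ : EuclideanSpace ℝ (Fin d)), ξ⟫}, Φ (K ζ) ∂(surfaceMeasure d) = 0 ∧
  ∫ ζ in {ζ | 0 < ⟪(ζ : EuclideanSpace ℝ (Fin d)), ξ⟫}, Φ (-K ζ) ∂(surfaceMeasure d) = 0

/-! Put β = d - α. Then pβ = d, so Φ ∘ K is homogeneous of the critical degree -d and the inequality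
is invariant under dilations. The convolution K * f is compared with m(|x|) K(x), where m(s) is the
mass of f in the ball of radius s (`radialMass`). The difference, `remainderConv`, is controlled in
scale-invariant weighted spaces, and Φ(m(|x|) K(x)) integrates over spheres and half-spheres to
multiples of the four integrals in the statement. For f with mean zero, m vanishes outside the
support, and the remainder lies in L^p; hence Φ(K * f) is integrable.

Necessity. For the difference of a bump of width ε at the origin and a fixed annular density, m is
constant between radius ε and radius 2. The integral of ds/s then gives log(1/ε) times a sphere
integral, up to an error bounded uniformly in ε (`lintegral_comp_smulConv_sub_le`). Boundedness as ε
→ 0 forces that integral to vanish. A bump at the origin, on the boundary of Ω, sees the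
half-sphere; a bump moved into Ω sees the full sphere; changing the sign of f exchanges K and -K.

Sufficiency. The carrying fact is that f can be cut along the sphere of a suitable ball into f₁ + f₂
so that the functional is additive up to C ‖f‖₁^p
(`exists_radius_integral_comp_smulConv_sub_sub_le`). Near the ball the radius is chosen so that |f|
has little mass near the sphere, which weakens the interaction of the two parts. Far away only the
terms Φ(m K) are not absolutely integrable uniformly, and the four cancellation conditions bound
their integrals. By `exists_closedBall_measureReal_le` the ball can be chosen so that both parts
have mass at most η ‖f‖₁ with η < 1. As p > 1, ‖f₁‖₁^p + ‖f₂‖₁^p ≤ η^(p-1) ‖f‖₁^p, so the errors of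
repeated cutting form a geometric series, while a crude bound with an exponent q in (1, p) makes the
contribution of the final pieces tend to zero. The pieces no longer have mean zero and Φ(K * f₁) may
decay only like |x|^(-d), so the argument is run on half-spaces truncated by a ball of radius R,
with constants independent of R. -/

open scoped ENNReal NNReal

set_option linter.unusedSectionVars false

/-! ### Integration in polar coordinates -/

section Polar

variable {E : Type*} [NormedAddCommGroup E] [NormedSpace ℝ E] [Nontrivial E]
  [MeasurableSpace E] [BorelSpace E] [FiniteDimensional ℝ E] (μ : Measure E) [μ.IsAddHaarMeasure]

/-- Integration in polar coordinates, for nonnegative functions. -/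
theorem lintegral_polar {f : E → ℝ≥0∞} (hf : Measurable f) :
    ∫⁻ x, f x ∂μ = ∫⁻ s in Ioi (0 : ℝ), ENNReal.ofReal (s ^ (Module.finrank ℝ E - 1)) *
      ∫⁻ ζ, f (s • (ζ : E)) ∂μ.toSphere := by
  have hmeas : Measurable fun z : sphere (0 : E) 1 × ℝ => f (z.2 • (z.1 : E)) :=
    hf.comp (measurable_snd.smul (measurable_subtype_coe.comp measurable_fst))
  have h1 : ∫⁻ x, f x ∂μ = ∫⁻ x : ({(0 : E)}ᶜ : Set E), f x ∂(μ.comap (↑)) := by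
    rw [lintegral_subtype_comap (measurableSet_singleton _).compl, restrict_compl_singleton]
  have h2 := μ.measurePreserving_homeomorphUnitSphereProd.lintegral_comp_emb
    (Homeomorph.measurableEmbedding _)
    (fun z : sphere (0 : E) 1 × Ioi (0 : ℝ) => f ((z.2 : ℝ) • (z.1 : E)))
  have h3 : ∀ x : ({(0 : E)}ᶜ : Set E), f ((((homeomorphUnitSphereProd E) x).2 : ℝ) •
      (((homeomorphUnitSphereProd E) x).1 : E)) = f x := by
    intro x
    have : (x : E) ≠ 0 := x.2
    simp [this]
  simp only [h3] at h2
  rw [h1, h2, lintegral_prod_symm _ (by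
    exact (hmeas.comp (measurable_fst.prodMk (measurable_subtype_coe.comp measurable_snd))).aemeasurable)]
  have hm2 : Measurable fun s : ℝ => ∫⁻ ζ, f (s • (ζ : E)) ∂μ.toSphere :=
    Measurable.lintegral_prod_left' (f := fun z : sphere (0 : E) 1 × ℝ => f (z.2 • (z.1 : E))) hmeas
  rw [Measure.volumeIoiPow]
  refine (lintegral_withDensity_eq_lintegral_mul _
    ((measurable_subtype_coe.pow_const _).ennreal_ofReal)
    (hm2.comp measurable_subtype_coe : Measurable fun s : Ioi (0 : ℝ) =>
      ∫⁻ ζ, f ((s : ℝ) • (ζ : E)) ∂μ.toSphere)).trans ?_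
  exact lintegral_subtype_comap measurableSet_Ioi
    (fun s : ℝ => ENNReal.ofReal (s ^ (Module.finrank ℝ E - 1)) *
      ∫⁻ ζ, f (s • (ζ : E)) ∂μ.toSphere)

/-- Integration in polar coordinates. -/
theorem integral_polar {f : E → ℝ} (hf : Integrable f μ) :
    ∫ x, f x ∂μ = ∫ s in Ioi (0 : ℝ), s ^ (Module.finrank ℝ E - 1) *
      ∫ ζ, f (s • (ζ : E)) ∂μ.toSphere := by
  have h1 : ∫ x, f x ∂μ = ∫ x : ({(0 : E)}ᶜ : Set E), f x ∂(μ.comap (↑)) := by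
    rw [integral_subtype_comap (measurableSet_singleton _).compl f, restrict_compl_singleton]
  have h3 : ∀ x : ({(0 : E)}ᶜ : Set E), f ((((homeomorphUnitSphereProd E) x).2 : ℝ) •
      (((homeomorphUnitSphereProd E) x).1 : E)) = f x := by
    intro x
    have : (x : E) ≠ 0 := x.2
    simp [this]
  have h2 := μ.measurePreserving_homeomorphUnitSphereProd.integral_comp
    (Homeomorph.measurableEmbedding _)
    (fun z : sphere (0 : E) 1 × Ioi (0 : ℝ) => f ((z.2 : ℝ) • (z.1 : E)))
  have hint := μ.measurePreserving_homeomorphUnitSphereProd.integrable_comp_emb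
    (Homeomorph.measurableEmbedding _)
    (g := fun z : sphere (0 : E) 1 × Ioi (0 : ℝ) => f ((z.2 : ℝ) • (z.1 : E)))
  simp only [Function.comp_def, h3] at h2 hint
  have hint' := hint.1 (by
    have := (integrableOn_iff_comap_subtypeVal (μ := μ) (f := f)
      (measurableSet_singleton (0 : E)).compl).1 hf.integrableOn
    simpa [Function.comp_def] using this)
  rw [h1, h2, integral_prod_symm _ hint', Measure.volumeIoiPow]
  simp only [ENNReal.ofReal]
  rw [integral_withDensity_eq_integral_smul (measurable_subtype_coe.pow_const _).real_toNNReal,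
    integral_subtype_comap measurableSet_Ioi fun s : ℝ =>
      Real.toNNReal (s ^ (Module.finrank ℝ E - 1)) • ∫ ζ, f (s • (ζ : E)) ∂μ.toSphere]
  refine setIntegral_congr_fun measurableSet_Ioi fun s hs => ?_
  have hs' : (0 : ℝ) ≤ s ^ (Module.finrank ℝ E - 1) := pow_nonneg (le_of_lt hs) _
  simp [NNReal.smul_def, Real.coe_toNNReal _ hs']

end Polar

/-! ### Averages of kernels in L^q -/

/-- Hölder's inequality against the constant 1; this is Jensen's inequality for a measure that is
not normalised. -/
theorem lintegral_rpow_le {Y : Type*} [MeasurableSpace Y] (μ : Measure Y) {q : ℝ} (hq : 1 ≤ q)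
    {g : Y → ℝ≥0∞} (hg : AEMeasurable g μ) :
    (∫⁻ y, g y ∂μ) ^ q ≤ μ univ ^ (q - 1) * ∫⁻ y, g y ^ q ∂μ := by
  rcases hq.eq_or_lt with rfl | hq
  · simp
  have hc : q.HolderConjugate (q / (q - 1)) := Real.HolderConjugate.conjExponent hq
  have h := ENNReal.lintegral_mul_le_Lp_mul_Lq μ hc hg (aemeasurable_const (b := (1 : ℝ≥0∞)))
  simp only [Pi.mul_apply, mul_one, ENNReal.one_rpow, lintegral_const, one_mul] at h
  have h0 : 0 < q := by linarith
  calc (∫⁻ y, g y ∂μ) ^ q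
      ≤ ((∫⁻ y, g y ^ q ∂μ) ^ (1 / q) * μ univ ^ (1 / (q / (q - 1)))) ^ q := by gcongr
    _ = _ := by
      rw [ENNReal.mul_rpow_of_nonneg _ _ h0.le, ← ENNReal.rpow_mul, ← ENNReal.rpow_mul,
        one_div_mul_cancel h0.ne', ENNReal.rpow_one, mul_comm]
      congr 2
      field_simp

/-- A Schur type test: the `L^q` bound of the kernels `k (·, y)` passes to their `μ`-average. -/
theorem lintegral_mul_rpow_lintegral_le {X Y : Type*} [MeasurableSpace X] [MeasurableSpace Y]
    (ν : Measure X) [SFinite ν] (μ : Measure Y) [SFinite μ] {q : ℝ} (hq : 1 ≤ q)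
    {k : X → Y → ℝ≥0∞} (hk : Measurable (Function.uncurry k)) {w : X → ℝ≥0∞} (hw : Measurable w)
    {B : ℝ≥0∞} (hB : ∀ᵐ y ∂μ, ∫⁻ x, w x * k x y ^ q ∂ν ≤ B) :
    ∫⁻ x, w x * (∫⁻ y, k x y ∂μ) ^ q ∂ν ≤ μ univ ^ q * B := by
  have hkx : ∀ x, Measurable (k x) := fun x => hk.comp measurable_prodMk_left
  calc ∫⁻ x, w x * (∫⁻ y, k x y ∂μ) ^ q ∂ν
      ≤ ∫⁻ x, μ univ ^ (q - 1) * ∫⁻ y, w x * k x y ^ q ∂μ ∂ν := by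
        refine lintegral_mono fun x => ?_
        rw [lintegral_const_mul _ ((hkx x).pow_const _), mul_left_comm]
        gcongr
        exact lintegral_rpow_le μ hq (hkx x).aemeasurable
    _ = μ univ ^ (q - 1) * ∫⁻ y, ∫⁻ x, w x * k x y ^ q ∂ν ∂μ := by
        have hm : Measurable (Function.uncurry fun x y => w x * k x y ^ q) :=
          (hw.comp measurable_fst).mul (hk.pow_const _)
        rw [← lintegral_lintegral_swap hm.aemeasurable]
        exact lintegral_const_mul _ hm.lintegral_prod_right'
    _ ≤ μ univ ^ (q - 1) * ∫⁻ y, B ∂μ := by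
        gcongr 1
        exact lintegral_mono_ae hB
    _ = μ univ ^ q * B := by
        rw [lintegral_const, mul_comm B, ← mul_assoc]
        congr 1
        nth_rw 2 [← ENNReal.rpow_one (μ univ)]
        rw [← ENNReal.rpow_add_of_nonneg _ _ (by linarith) zero_le_one]
        congr 1; ring

/-! ### Integrals of powers of the norm over balls, their complements and annuli -/

section RadialBounds

variable {E : Type*} [NormedAddCommGroup E] [NormedSpace ℝ E] [Nontrivial E]
  [MeasurableSpace E] [BorelSpace E] [FiniteDimensional ℝ E] (μ : Measure E) [μ.IsAddHaarMeasure]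

theorem lintegral_radial {g : ℝ → ℝ≥0∞} (hg : Measurable g) :
    ∫⁻ x : E, g ‖x‖ ∂μ = μ.toSphere univ *
      ∫⁻ s in Ioi (0 : ℝ), ENNReal.ofReal (s ^ (Module.finrank ℝ E - 1)) * g s := by
  rw [lintegral_polar μ (f := fun x => g ‖x‖) (hg.comp measurable_norm),
    ← lintegral_const_mul _ (by fun_prop)]
  refine setLIntegral_congr_fun measurableSet_Ioi fun s hs => ?_
  have hs0 : (0 : ℝ) ≤ s := le_of_lt hs
  simp [norm_smul, abs_of_nonneg hs0]
  ring

theorem setLIntegral_radial {t : Set ℝ} (ht : MeasurableSet t) (ht0 : t ⊆ Ioi 0) (κ : ℝ) :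
    ∫⁻ x : E in {x | ‖x‖ ∈ t}, ‖x‖ₑ ^ (-κ) ∂μ = μ.toSphere univ *
      ∫⁻ s in t, ENNReal.ofReal (s ^ ((Module.finrank ℝ E : ℝ) - 1 - κ)) := by
  rw [← lintegral_indicator (show MeasurableSet {x : E | ‖x‖ ∈ t} from measurable_norm ht)]
  have h1 : ∀ x : E, ({x : E | ‖x‖ ∈ t}.indicator (fun x => ‖x‖ₑ ^ (-κ))) x
      = t.indicator (fun s => ENNReal.ofReal s ^ (-κ)) ‖x‖ := by
    intro x
    by_cases hx : ‖x‖ ∈ t <;> simp [indicator, hx]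
  simp_rw [h1]
  rw [lintegral_radial μ ((by fun_prop : Measurable fun s : ℝ =>
    ENNReal.ofReal s ^ (-κ)).indicator ht)]
  congr 1
  rw [← lintegral_indicator ht, ← lintegral_indicator measurableSet_Ioi]
  congr 1
  ext s
  by_cases hs : s ∈ t
  · have hs0 : 0 < s := ht0 hs
    have hd : 1 ≤ Module.finrank ℝ E := Module.finrank_pos
    simp only [mem_Ioi, hs0, hs, indicator_of_mem]
    rw [ENNReal.ofReal_rpow_of_pos hs0, ← ENNReal.ofReal_mul (by positivity),
      ← Real.rpow_natCast, ← Real.rpow_add hs0, Nat.cast_sub hd]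
    push_cast
    congr 2
  · by_cases hs0 : 0 < s <;> simp [hs, hs0]

theorem setLIntegral_ball_rpow_le {κ : ℝ} (hκ : κ < Module.finrank ℝ E) :
    ∃ C : ℝ≥0, ∀ τ : ℝ, 0 < τ → ∫⁻ x : E in ball 0 τ, ‖x‖ₑ ^ (-κ) ∂μ ≤
      C * ENNReal.ofReal τ ^ (Module.finrank ℝ E - κ) := by
  set D : ℝ := (Module.finrank ℝ E : ℝ)
  refine ⟨(μ.toSphere univ).toNNReal * (Real.toNNReal (D - κ)⁻¹), fun τ hτ => ?_⟩
  have hset : (ball (0 : E) τ : Set E) =ᵐ[μ] {x | ‖x‖ ∈ Ioo 0 τ} := by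
    have : {x : E | ‖x‖ ∈ Ioo 0 τ} = ball 0 τ \ {0} := by
      ext x; simp [and_comm]
    rw [this]
    exact (sdiff_null_ae_eq_self (measure_singleton _)).symm
  rw [setLIntegral_congr hset, setLIntegral_radial μ measurableSet_Ioo (fun s hs => hs.1)]
  have hint : IntegrableOn (fun s : ℝ => s ^ (D - 1 - κ)) (Ioo 0 τ) := by
    have := (intervalIntegral.intervalIntegrable_rpow' (a := 0) (b := τ)
      (r := D - 1 - κ) (by linarith)).1
    exact this.mono_set Ioo_subset_Ioc_self
  rw [← ofReal_integral_eq_lintegral_ofReal hint (by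
    filter_upwards [ae_restrict_mem measurableSet_Ioo] with s hs
    exact Real.rpow_nonneg hs.1.le _), ← integral_Ioc_eq_integral_Ioo,
    ← intervalIntegral.integral_of_le hτ.le, integral_rpow (Or.inl (by linarith)),
    Real.zero_rpow (by linarith)]
  rw [ENNReal.coe_mul, ENNReal.coe_toNNReal (measure_ne_top _ _), mul_assoc]
  gcongr
  rw [ENNReal.ofReal_rpow_of_pos hτ, ← ENNReal.ofReal, ← ENNReal.ofReal_mul (by
    simp only [inv_nonneg]; linarith)]
  apply le_of_eq
  congr 1
  rw [show D - 1 - κ + 1 = D - κ by ring]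
  field_simp
  simp

theorem setLIntegral_compl_ball_rpow_le {κ : ℝ} (hκ : Module.finrank ℝ E < κ) :
    ∃ C : ℝ≥0, ∀ τ : ℝ, 0 < τ → ∫⁻ x : E in (ball 0 τ)ᶜ, ‖x‖ₑ ^ (-κ) ∂μ ≤
      C * ENNReal.ofReal τ ^ (Module.finrank ℝ E - κ) := by
  set D : ℝ := (Module.finrank ℝ E : ℝ)
  refine ⟨(μ.toSphere univ).toNNReal * (Real.toNNReal (κ - D)⁻¹), fun τ hτ => ?_⟩
  have hset : (ball (0 : E) τ)ᶜ = {x | ‖x‖ ∈ Ici τ} := by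
    ext x; simp
  rw [hset, setLIntegral_radial μ measurableSet_Ici (fun s hs => lt_of_lt_of_le hτ hs)]
  have hint : IntegrableOn (fun s : ℝ => s ^ (D - 1 - κ)) (Ioi τ) :=
    integrableOn_Ioi_rpow_of_lt (by linarith) hτ
  rw [setLIntegral_congr Ioi_ae_eq_Ici.symm, ← ofReal_integral_eq_lintegral_ofReal hint (by
    filter_upwards [ae_restrict_mem measurableSet_Ioi] with s hs
    exact Real.rpow_nonneg (hτ.trans hs).le _), integral_Ioi_rpow_of_lt (by linarith) hτ]
  rw [ENNReal.coe_mul, ENNReal.coe_toNNReal (measure_ne_top _ _), mul_assoc]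
  gcongr
  rw [ENNReal.ofReal_rpow_of_pos hτ, ← ENNReal.ofReal, ← ENNReal.ofReal_mul (by
    simp only [inv_nonneg]; linarith)]
  apply le_of_eq
  congr 1
  rw [show D - 1 - κ + 1 = D - κ by ring, div_eq_mul_inv, ← neg_sub κ D, inv_neg]
  ring

/-- The point is uniformity in the position t of the singularity: where x is within τ of t the
centred bound applies after a translation, and elsewhere the integrand is at most τ^(-κ). -/
theorem setLIntegral_ball_rpow_sub_le {κ : ℝ} (hκ0 : 0 ≤ κ) (hκ : κ < Module.finrank ℝ E) :
    ∃ C : ℝ≥0, ∀ τ : ℝ, 0 < τ → ∀ t : E, ∫⁻ x : E in ball 0 τ, ‖x - t‖ₑ ^ (-κ) ∂μ ≤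
      C * ENNReal.ofReal τ ^ (Module.finrank ℝ E - κ) := by
  obtain ⟨C, hC⟩ := setLIntegral_ball_rpow_le μ hκ
  refine ⟨C + (μ (ball 0 1)).toNNReal, fun τ hτ t => ?_⟩
  have hpt : ∀ x ∈ ball (0 : E) τ, ‖x - t‖ₑ ^ (-κ) ≤
      (ball (0 : E) τ).indicator (fun y => ‖y‖ₑ ^ (-κ)) (x - t) + ENNReal.ofReal τ ^ (-κ) := by
    intro x _
    by_cases h : x - t ∈ ball (0 : E) τ
    · rw [indicator_of_mem h]; exact le_self_add
    · rw [indicator_of_notMem h, zero_add, ENNReal.rpow_neg, ENNReal.rpow_neg]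
      gcongr
      rw [← ofReal_norm]
      apply ENNReal.ofReal_le_ofReal
      simpa using h
  calc ∫⁻ x : E in ball 0 τ, ‖x - t‖ₑ ^ (-κ) ∂μ
      ≤ ∫⁻ x : E in ball 0 τ, ((ball (0 : E) τ).indicator (fun y => ‖y‖ₑ ^ (-κ)) (x - t)
          + ENNReal.ofReal τ ^ (-κ)) ∂μ := setLIntegral_mono' measurableSet_ball hpt
    _ = ∫⁻ x : E in ball 0 τ, ((ball (0 : E) τ).indicator (fun y => ‖y‖ₑ ^ (-κ)) (x - t)) ∂μ
          + ENNReal.ofReal τ ^ (-κ) * μ (ball 0 τ) := by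
        rw [lintegral_add_right _ measurable_const]; simp
    _ ≤ ∫⁻ x : E, ((ball (0 : E) τ).indicator (fun y => ‖y‖ₑ ^ (-κ)) (x - t)) ∂μ
          + ENNReal.ofReal τ ^ (-κ) * (ENNReal.ofReal (τ ^ (Module.finrank ℝ E)) * μ (ball 0 1)) := by
        rw [μ.addHaar_ball_of_pos _ hτ]
        gcongr
        exact Measure.restrict_le_self
    _ ≤ C * ENNReal.ofReal τ ^ (Module.finrank ℝ E - κ) +
          μ (ball 0 1) * ENNReal.ofReal τ ^ (Module.finrank ℝ E - κ) := by
        rw [lintegral_sub_right_eq_self (μ := μ)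
          ((ball (0 : E) τ).indicator (fun y => ‖y‖ₑ ^ (-κ))) t,
          lintegral_indicator measurableSet_ball]
        have h1 : ENNReal.ofReal τ ^ (-κ) * ENNReal.ofReal (τ ^ (Module.finrank ℝ E))
            = ENNReal.ofReal τ ^ (Module.finrank ℝ E - κ) := by
          rw [ENNReal.ofReal_pow hτ.le, ← ENNReal.rpow_natCast, ← ENNReal.rpow_add _ _ (by simpa) (by simp)]
          congr 1; ring
        rw [← mul_assoc, h1, mul_comm (μ (ball 0 1))]
        gcongr
        exact hC τ hτ
    _ = _ := by
        rw [ENNReal.coe_add, ENNReal.coe_toNNReal measure_ball_lt_top.ne, add_mul]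

/-- On such an annulus the integrand is at most τ^(-κ), so no upper bound on κ is needed. For κ
equal to the dimension the bound does not depend on τ. -/
theorem setLIntegral_annulus_rpow_le (κ : ℝ) (hκ0 : 0 ≤ κ) :
    ∃ C : ℝ≥0, ∀ τ : ℝ, 0 < τ → ∫⁻ x : E in {x | τ ≤ ‖x‖ ∧ ‖x‖ < 4 * τ}, ‖x‖ₑ ^ (-κ) ∂μ ≤
      C * ENNReal.ofReal τ ^ (Module.finrank ℝ E - κ) := by
  refine ⟨(μ (ball 0 4)).toNNReal, fun τ hτ => ?_⟩
  have hsub : {x : E | τ ≤ ‖x‖ ∧ ‖x‖ < 4 * τ} ⊆ ball 0 (τ * 4) := fun x hx => by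
    simpa [mul_comm] using hx.2
  have hms : MeasurableSet {x : E | τ ≤ ‖x‖ ∧ ‖x‖ < 4 * τ} :=
    (measurableSet_le measurable_const measurable_norm).inter
      (measurableSet_lt measurable_norm measurable_const)
  calc ∫⁻ x : E in {x | τ ≤ ‖x‖ ∧ ‖x‖ < 4 * τ}, ‖x‖ₑ ^ (-κ) ∂μ
      ≤ ∫⁻ x : E in {x | τ ≤ ‖x‖ ∧ ‖x‖ < 4 * τ}, ENNReal.ofReal τ ^ (-κ) ∂μ := by
        refine setLIntegral_mono' hms fun x hx => ?_
        rw [ENNReal.rpow_neg, ENNReal.rpow_neg, ← ofReal_norm]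
        gcongr
        exact hx.1
    _ = ENNReal.ofReal τ ^ (-κ) * μ {x : E | τ ≤ ‖x‖ ∧ ‖x‖ < 4 * τ} := by simp
    _ ≤ ENNReal.ofReal τ ^ (-κ) * μ (ball 0 (τ * 4)) := by gcongr
    _ = _ := by
        rw [μ.addHaar_ball_mul_of_pos _ hτ, ENNReal.coe_toNNReal measure_ball_lt_top.ne,
          ENNReal.ofReal_pow hτ.le, ← ENNReal.rpow_natCast, ← mul_assoc,
          ← ENNReal.rpow_add _ _ (by simpa) (by simp), mul_comm]
        congr 2; ring

end RadialBounds

/-! ### The slab between a half-space and its translate through the origin -/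

section Slab

variable {E : Type*} [NormedAddCommGroup E] [InnerProductSpace ℝ E] [Nontrivial E]
  [MeasurableSpace E] [BorelSpace E] [FiniteDimensional ℝ E]

/-- In an orthonormal basis containing ξ the ball lies in the cube of side 2, and |s|^(-1/2) is
integrable on [-1, 1]. -/
theorem setLIntegral_ball_inner_rpow_lt_top {ξ : E} (hξ : ‖ξ‖ = 1) :
    ∫⁻ x : E in ball 0 1, ENNReal.ofReal (|⟪x, ξ⟫| ^ (-(1 / 2) : ℝ)) < ∞ := by
  have hv : Orthonormal ℝ ((↑) : ({ξ} : Set E) → E) := by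
    rw [orthonormal_subsingleton_iff]
    rintro ⟨x, rfl⟩
    exact hξ
  obtain ⟨u, b, hu, hb⟩ := hv.exists_orthonormalBasis_extension
  have hξu : ξ ∈ u := by simpa using hu
  let i₀ : u := ⟨ξ, hξu⟩
  have hbi : b i₀ = ξ := by rw [hb]
  -- The summand 1 makes every factor at least 1, so the product over all coordinates dominates the
  -- factor in the direction ξ alone.
  let g : ℝ → ℝ := (Icc (-1 : ℝ) 1).indicator fun s => |s| ^ (-(1 / 2) : ℝ) + 1
  have hg0 : ∀ s, 0 ≤ g s := fun s => indicator_nonneg (fun s _ => by positivity) s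
  have hgint : Integrable g := by
    rw [integrable_indicator_iff measurableSet_Icc]
    refine Integrable.add ?_ (by simp)
    have h1 : IntervalIntegrable (fun s : ℝ => |s| ^ (-(1 / 2) : ℝ)) volume 0 1 := by
      refine (intervalIntegral.intervalIntegrable_rpow' (r := -(1 / 2)) (by norm_num)).congr ?_
      intro s hs
      rw [uIoc_of_le zero_le_one] at hs
      simp [abs_of_pos hs.1]
    have h2 : IntervalIntegrable (fun s : ℝ => |s| ^ (-(1 / 2) : ℝ)) volume (-1) 0 := by
      have := (IntervalIntegrable.iff_comp_neg (by simp)).1 h1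
      simpa using this.symm
    have := (h2.trans h1).1
    exact (integrableOn_Icc_iff_integrableOn_Ioc (by simp)).2 this
  have hG : Integrable (fun y : u → ℝ => ∏ i, g (y i)) := Integrable.fintype_prod fun _ => hgint
  have hmp : MeasurePreserving (fun x : E => WithLp.ofLp (b.repr x)) volume volume :=
    (PiLp.volume_preserving_ofLp _).comp b.measurePreserving_repr
  have hG' : Integrable (fun x : E => ∏ i, g (b.repr x i)) :=
    hmp.integrable_comp_of_integrable hG
  refine lt_of_le_of_lt ?_ hG'.lintegral_lt_top
  rw [← lintegral_indicator measurableSet_ball]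
  refine lintegral_mono fun x => ?_
  by_cases hx : x ∈ ball (0 : E) 1
  · rw [indicator_of_mem hx]
    apply ENNReal.ofReal_le_ofReal
    have hcoord : ∀ i, |b.repr x i| ≤ 1 := fun i => by
      have h1 : ‖b.repr x i‖ ≤ ‖b.repr x‖ := PiLp.norm_apply_le (b.repr x) i
      rw [b.repr.norm_map] at h1
      exact h1.trans (by simpa using (mem_ball_zero_iff.1 hx).le)
    have hgi : ∀ i, g (b.repr x i) = |b.repr x i| ^ (-(1 / 2) : ℝ) + 1 := fun i =>
      indicator_of_mem (show b.repr x i ∈ Icc (-1 : ℝ) 1 from abs_le.1 (hcoord i)) _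
    have h0 : b.repr x i₀ = ⟪x, ξ⟫ := by
      rw [b.repr_apply_apply, hbi, real_inner_comm]
    classical
    rw [← Finset.mul_prod_erase Finset.univ _ (Finset.mem_univ i₀), hgi, h0]
    have h1 : 1 ≤ ∏ i ∈ Finset.univ.erase i₀, g (b.repr x i) := by
      refine Finset.prod_induction _ (fun s => (1 : ℝ) ≤ s) (fun s t => one_le_mul_of_one_le_of_one_le)
        le_rfl fun i _ => ?_
      rw [hgi]
      have : 0 ≤ |b.repr x i| ^ (-(1 / 2) : ℝ) := by positivity
      linarith
    have h2 : 0 ≤ |⟪x, ξ⟫| ^ (-(1 / 2) : ℝ) := by positivity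
    nlinarith
  · rw [indicator_of_notMem hx]; exact zero_le

/-- The shell of radii between 1/2 and 1 contributes at least a positive multiple of the sphere
integral to the integral over the ball, which is finite. -/
theorem lintegral_sphere_inner_rpow_lt_top {ξ : E} (hξ : ‖ξ‖ = 1) :
    ∫⁻ ζ : sphere (0 : E) 1, ENNReal.ofReal (|⟪(ζ : E), ξ⟫| ^ (-(1 / 2) : ℝ))
      ∂(volume : Measure E).toSphere < ∞ := by
  set I := ∫⁻ ζ : sphere (0 : E) 1, ENNReal.ofReal (|⟪(ζ : E), ξ⟫| ^ (-(1 / 2) : ℝ))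
      ∂(volume : Measure E).toSphere
  have h := setLIntegral_ball_inner_rpow_lt_top hξ
  have hm : Measurable fun x : E => ENNReal.ofReal (|⟪x, ξ⟫| ^ (-(1 / 2) : ℝ)) := by fun_prop
  rw [← lintegral_indicator measurableSet_ball,
    lintegral_polar volume (hm.indicator measurableSet_ball)] at h
  have hle : ∫⁻ s in Ioo (1 / 2 : ℝ) 1, ENNReal.ofReal ((1 / 2) ^ (Module.finrank ℝ E - 1)) * I ≤
      ∫⁻ s in Ioi (0 : ℝ), ENNReal.ofReal (s ^ (Module.finrank ℝ E - 1)) *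
      ∫⁻ ζ : sphere (0 : E) 1, ((ball (0 : E) 1).indicator fun x : E =>
        ENNReal.ofReal (|⟪x, ξ⟫| ^ (-(1 / 2) : ℝ))) (s • (ζ : E)) ∂(volume : Measure E).toSphere := by
    refine (setLIntegral_mono' measurableSet_Ioo fun s hs => ?_).trans
      (lintegral_mono_set (fun s hs => lt_trans (by norm_num) hs.1))
    have hs0 : 0 < s := lt_trans (by norm_num) hs.1
    have hs1 := hs.1.le
    gcongr ENNReal.ofReal (?_ ^ _) * ?_
    refine lintegral_mono fun ζ => ?_
    rw [indicator_of_mem (by simpa [norm_smul, abs_of_pos hs0] using hs.2)]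
    apply ENNReal.ofReal_le_ofReal
    rw [inner_smul_left, abs_mul, Real.mul_rpow (by positivity) (by positivity)]
    have : 1 ≤ |(starRingEnd ℝ) s| ^ (-(1 / 2) : ℝ) := by
      simp only [conj_trivial, abs_of_pos hs0]
      exact Real.one_le_rpow_of_pos_of_le_one_of_nonpos hs0 hs.2.le (by norm_num)
    exact le_mul_of_one_le_left (by positivity) this
  have hlt := hle.trans_lt h
  by_contra hI
  rw [not_lt, top_le_iff] at hI
  rw [hI, ENNReal.mul_top (by simp)] at hlt
  norm_num [ENNReal.top_mul] at hlt

/-- At distance s ≥ h the slab covers a small part of the sphere. Inserting the factor (h / |⟪x,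
ξ⟫|)^(1/2), which is at least 1 on the slab, quantifies this: the radial integral becomes h^(1/2) ∫
s^(-3/2) ds over s > h, which is 2 whatever h is. -/
theorem setLIntegral_slab_le {ξ : E} (hξ : ‖ξ‖ = 1) :
    ∃ C : ℝ≥0, ∀ h : ℝ, 0 ≤ h → ∫⁻ x : E in {x | h ≤ ‖x‖ ∧ |⟪x, ξ⟫| ≤ h},
      ‖x‖ₑ ^ (-(Module.finrank ℝ E : ℝ)) ≤ C := by
  set I := ∫⁻ ζ : sphere (0 : E) 1, ENNReal.ofReal (|⟪(ζ : E), ξ⟫| ^ (-(1 / 2) : ℝ))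
      ∂(volume : Measure E).toSphere with hIdef
  have hI : I < ∞ := lintegral_sphere_inner_rpow_lt_top hξ
  have hD : 1 ≤ Module.finrank ℝ E := Module.finrank_pos
  have hnull : volume {x : E | ⟪x, ξ⟫ = 0} = 0 := by
    have := Measure.addHaar_submodule (volume : Measure E) (innerSL ℝ ξ).ker (by
      intro htop
      have : ξ ∈ (innerSL ℝ ξ).ker := by rw [htop]; trivial
      have h2 : ⟪ξ, ξ⟫ = 0 := this
      rw [real_inner_self_eq_norm_sq, hξ] at h2
      norm_num at h2)
    convert this using 2
    ext x
    simp [real_inner_comm]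
  refine ⟨(2 * I).toNNReal, fun h hh => ?_⟩
  rw [ENNReal.coe_toNNReal (ENNReal.mul_lt_top (by simp) hI).ne]
  rcases hh.eq_or_lt with rfl | hh
  · refine le_trans (le_of_eq ?_) zero_le
    refine setLIntegral_measure_zero _ _ (measure_mono_null (fun x hx => ?_) hnull)
    have h2 : |⟪x, ξ⟫| ≤ 0 := hx.2
    exact abs_nonpos_iff.1 h2
  have hms : MeasurableSet {x : E | h ≤ ‖x‖ ∧ |⟪x, ξ⟫| ≤ h} :=
    (measurableSet_le measurable_const measurable_norm).inter
      (measurableSet_le (by fun_prop : Measurable fun x : E => |⟪x, ξ⟫|) measurable_const)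
  set F : E → ℝ≥0∞ := fun x => (ball (0 : E) h)ᶜ.indicator (fun x => ‖x‖ₑ ^
    (-(Module.finrank ℝ E : ℝ)) * ENNReal.ofReal (h ^ (1 / 2 : ℝ) * |⟪x, ξ⟫| ^ (-(1 / 2) : ℝ))) x
  have hF : Measurable F := by
    refine Measurable.indicator ?_ measurableSet_ball.compl
    fun_prop
  have hle : ∫⁻ x : E in {x | h ≤ ‖x‖ ∧ |⟪x, ξ⟫| ≤ h}, ‖x‖ₑ ^ (-(Module.finrank ℝ E : ℝ)) ≤
      ∫⁻ x, F x := by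
    rw [← lintegral_indicator hms]
    have hae : ∀ᵐ x : E, ⟪x, ξ⟫ ≠ 0 := by
      rw [ae_iff]; simpa using hnull
    refine lintegral_mono_ae ?_
    filter_upwards [hae] with x hx
    by_cases hxs : x ∈ {x : E | h ≤ ‖x‖ ∧ |⟪x, ξ⟫| ≤ h}
    · have hxb : x ∈ (ball (0 : E) h)ᶜ := by simpa using hxs.1
      simp only [F]
      rw [indicator_of_mem hxs, indicator_of_mem hxb]
      refine le_mul_of_one_le_right zero_le ?_
      rw [ENNReal.one_le_ofReal, Real.rpow_neg (by positivity), ← div_eq_mul_inv,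
        one_le_div (by positivity)]
      exact Real.rpow_le_rpow (by positivity) hxs.2 (by norm_num)
    · rw [indicator_of_notMem hxs]; exact zero_le
  refine hle.trans ?_
  rw [lintegral_polar volume hF]
  have hint : IntegrableOn (fun s : ℝ => h ^ (1 / 2 : ℝ) * s ^ (-(3 / 2) : ℝ)) (Ioi h) :=
    (integrableOn_Ioi_rpow_of_lt (by norm_num) hh).const_mul _
  calc ∫⁻ s in Ioi (0 : ℝ), ENNReal.ofReal (s ^ (Module.finrank ℝ E - 1)) *
        ∫⁻ ζ : sphere (0 : E) 1, F (s • (ζ : E)) ∂(volume : Measure E).toSphere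
      ≤ ∫⁻ s in Ioi (0 : ℝ), (Ici h).indicator (fun s =>
          ENNReal.ofReal (h ^ (1 / 2 : ℝ) * s ^ (-(3 / 2) : ℝ))) s * I := by
        refine setLIntegral_mono' measurableSet_Ioi fun s hs => ?_
        have hs0 : 0 < s := hs
        by_cases hsh : h ≤ s
        · rw [indicator_of_mem (show s ∈ Ici h from hsh), hIdef,
            ← lintegral_const_mul _ (by fun_prop), ← lintegral_const_mul _ (by fun_prop)]
          refine lintegral_mono fun ζ => le_of_eq ?_
          have hb : s • (ζ : E) ∈ (ball (0 : E) h)ᶜ := by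
            simpa [norm_smul, abs_of_pos hs0] using hsh
          have hn : ‖s • (ζ : E)‖ = s := by simp [norm_smul, abs_of_pos hs0]
          simp only [F]
          rw [indicator_of_mem hb, ← ofReal_norm, hn, ENNReal.ofReal_rpow_of_pos hs0,
            ← ENNReal.ofReal_mul (by positivity), ← ENNReal.ofReal_mul (by positivity),
            ← ENNReal.ofReal_mul (by positivity), inner_smul_left, abs_mul,
            Real.mul_rpow (by positivity) (by positivity)]
          simp only [conj_trivial, abs_of_pos hs0]
          congr 1
          have : s ^ (-(3 / 2) : ℝ) = s ^ (Module.finrank ℝ E - 1) *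
              s ^ (-(Module.finrank ℝ E : ℝ)) * s ^ (-(1 / 2) : ℝ) := by
            rw [← Real.rpow_natCast, ← Real.rpow_add hs0, ← Real.rpow_add hs0, Nat.cast_sub hD]
            congr 1
            push_cast
            ring
          rw [this]; ring
        · have : ∀ ζ : sphere (0 : E) 1, F (s • (ζ : E)) = 0 := fun ζ => by
            refine indicator_of_notMem ?_ _
            simpa [norm_smul, abs_of_pos hs0] using hsh
          simp [this]
    _ ≤ ∫⁻ s, (Ici h).indicator (fun s =>
          ENNReal.ofReal (h ^ (1 / 2 : ℝ) * s ^ (-(3 / 2) : ℝ))) s * I :=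
        setLIntegral_le_lintegral _ _
    _ = 2 * I := by
        rw [lintegral_mul_const _ ((by fun_prop : Measurable fun s : ℝ =>
          ENNReal.ofReal (h ^ (1 / 2 : ℝ) * s ^ (-(3 / 2) : ℝ))).indicator measurableSet_Ici),
          lintegral_indicator measurableSet_Ici, setLIntegral_congr Ioi_ae_eq_Ici.symm,
          ← ofReal_integral_eq_lintegral_ofReal hint (by
            filter_upwards [ae_restrict_mem measurableSet_Ioi] with s hs
            have : 0 < s := hh.trans hs
            positivity), integral_const_mul,
          integral_Ioi_rpow_of_lt (by norm_num) hh]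
        congr 1
        rw [show (-(3 / 2) : ℝ) + 1 = -(1 / 2) by norm_num]
        have : h ^ (1 / 2 : ℝ) * h ^ (-(1 / 2) : ℝ) = 1 := by
          rw [← Real.rpow_add hh]; norm_num
        have h2 : h ^ (1 / 2 : ℝ) * (-h ^ (-(1 / 2) : ℝ) / -(1 / 2)) = 2 := by
          field_simp
          linarith
        rw [h2]; simp

end Slab

/-! ### Positively homogeneous functions that are Lipschitz on the sphere -/

section Homogeneous

variable {E F : Type*} [NormedAddCommGroup E] [NormedSpace ℝ E] [NormedAddCommGroup F]
  [NormedSpace ℝ F] {q : ℝ} {Ψ : E → F}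

theorem PosHomogeneous.map_zero (h : PosHomogeneous q Ψ) (hq : q ≠ 0) : Ψ 0 = 0 := by
  have h1 := h 0 2 two_pos
  rw [smul_zero] at h1
  have h2 : ((2 : ℝ) ^ q - 1) • Ψ 0 = 0 := by rw [sub_smul, ← h1, one_smul, sub_self]
  refine (smul_eq_zero.1 h2).resolve_left fun h3 => hq ?_
  have h4 : (2 : ℝ) ^ q = 2 ^ (0 : ℝ) := by rw [Real.rpow_zero]; linarith
  exact (Real.rpow_right_inj two_pos (by norm_num)).1 h4

theorem PosHomogeneous.eq_norm_rpow_smul (h : PosHomogeneous q Ψ) {x : E} (hx : x ≠ 0) :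
    Ψ x = ‖x‖ ^ q • Ψ (‖x‖⁻¹ • x) := by
  rw [← h _ _ (norm_pos_iff.2 hx), smul_smul, mul_inv_cancel₀ (norm_ne_zero_iff.2 hx), one_smul]

theorem norm_inv_smul_mem_sphere {x : E} (hx : x ≠ 0) : ‖x‖⁻¹ • x ∈ sphere (0 : E) 1 := by
  simp [norm_smul, hx]

theorem LipschitzOnSphere.exists_bound (h : LipschitzOnSphere Ψ) :
    ∃ C : ℝ≥0, ∀ x ∈ sphere (0 : E) 1, ‖Ψ x‖ ≤ C := by
  obtain ⟨L, hL⟩ := h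
  by_cases hne : (sphere (0 : E) 1).Nonempty
  · obtain ⟨y, hy⟩ := hne
    refine ⟨‖Ψ y‖₊ + L * 2, fun x hx => ?_⟩
    have h1 : ‖Ψ x - Ψ y‖ ≤ L * ‖x - y‖ := by
      simpa [dist_eq_norm] using hL.dist_le_mul x hx y hy
    have h2 : ‖x - y‖ ≤ 2 := by
      have := norm_sub_le x y
      rw [mem_sphere_zero_iff_norm.1 hx, mem_sphere_zero_iff_norm.1 hy] at this
      linarith
    have h3 := norm_sub_norm_le (Ψ x) (Ψ y)
    have h4 : (L : ℝ) * ‖x - y‖ ≤ L * 2 := by gcongr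
    push_cast
    linarith
  · exact ⟨0, fun x hx => (hne ⟨x, hx⟩).elim⟩

theorem PosHomogeneous.exists_norm_le (h : PosHomogeneous q Ψ) (hL : LipschitzOnSphere Ψ)
    (hq : q ≠ 0) : ∃ C : ℝ≥0, ∀ x, ‖Ψ x‖ ≤ C * ‖x‖ ^ q := by
  obtain ⟨C, hC⟩ := hL.exists_bound
  refine ⟨C, fun x => ?_⟩
  rcases eq_or_ne x 0 with rfl | hx
  · rw [h.map_zero hq, norm_zero]; positivity
  · rw [h.eq_norm_rpow_smul hx, norm_smul, Real.norm_of_nonneg (by positivity), mul_comm]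
    gcongr
    exact hC _ (norm_inv_smul_mem_sphere hx)

theorem PosHomogeneous.exists_enorm_le (h : PosHomogeneous q Ψ) (hL : LipschitzOnSphere Ψ)
    (hq : q ≠ 0) : ∃ C : ℝ≥0, ∀ x, ‖Ψ x‖ₑ ≤ C * ‖x‖ₑ ^ q := by
  obtain ⟨C, hC⟩ := h.exists_norm_le hL hq
  refine ⟨C, fun x => ?_⟩
  rcases eq_or_ne x 0 with rfl | hx
  · rw [h.map_zero hq, enorm_zero]; exact zero_le
  · rw [← ofReal_norm, ← ofReal_norm, ENNReal.ofReal_rpow_of_pos (norm_pos_iff.2 hx),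
      ← ENNReal.ofReal_coe_nnreal, ← ENNReal.ofReal_mul C.coe_nonneg]
    exact ENNReal.ofReal_le_ofReal (hC x)

/-- The change of direction is estimated by the Lipschitz bound on the sphere, the change of radius
by the difference of the powers of the norms. The degree is arbitrary, so both K and Φ are covered.
-/
theorem PosHomogeneous.exists_norm_sub_le (h : PosHomogeneous q Ψ) (hL : LipschitzOnSphere Ψ) :
    ∃ C : ℝ≥0, ∀ x z, x ≠ 0 → z ≠ 0 →
      ‖Ψ x - Ψ z‖ ≤ C * (‖x‖ ^ (q - 1) * ‖x - z‖ + |‖x‖ ^ q - ‖z‖ ^ q|) := by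
  obtain ⟨C, hC⟩ := hL.exists_bound
  obtain ⟨L, hL⟩ := hL
  refine ⟨2 * L + C, fun x z hx hz => ?_⟩
  have hx0 : 0 < ‖x‖ := norm_pos_iff.2 hx
  have hz0 : 0 < ‖z‖ := norm_pos_iff.2 hz
  set u := ‖x‖⁻¹ • x
  set v := ‖z‖⁻¹ • z
  have hu := norm_inv_smul_mem_sphere hx
  have hv := norm_inv_smul_mem_sphere hz
  have huv : ‖x‖ * ‖u - v‖ ≤ 2 * ‖x - z‖ := by
    have h1 : ‖x‖ • (u - v) = (x - z) + (‖z‖ - ‖x‖) • v := by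
      simp only [u, v, smul_sub, smul_smul, sub_mul]
      rw [mul_inv_cancel₀ hx0.ne', mul_inv_cancel₀ hz0.ne', sub_smul]
      simp
    calc ‖x‖ * ‖u - v‖ = ‖‖x‖ • (u - v)‖ := by rw [norm_smul, norm_norm]
      _ ≤ ‖x - z‖ + ‖(‖z‖ - ‖x‖) • v‖ := by rw [h1]; exact norm_add_le _ _
      _ ≤ ‖x - z‖ + ‖x - z‖ := by
        gcongr
        rw [norm_smul, mem_sphere_zero_iff_norm.1 hv, mul_one, Real.norm_eq_abs,
          abs_sub_comm]
        exact abs_norm_sub_norm_le x z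
      _ = _ := by ring
  have hΨ : ‖Ψ u - Ψ v‖ ≤ L * ‖u - v‖ := by
    simpa [dist_eq_norm] using hL.dist_le_mul u hu v hv
  have hxq : ‖x‖ ^ q = ‖x‖ ^ (q - 1) * ‖x‖ := by
    rw [← Real.rpow_add_one hx0.ne']; congr 1; ring
  calc ‖Ψ x - Ψ z‖ = ‖‖x‖ ^ q • (Ψ u - Ψ v) + (‖x‖ ^ q - ‖z‖ ^ q) • Ψ v‖ := by
        rw [h.eq_norm_rpow_smul hx, h.eq_norm_rpow_smul hz]
        congr 1
        simp only [u, v]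
        module
    _ ≤ ‖x‖ ^ q * ‖Ψ u - Ψ v‖ + |‖x‖ ^ q - ‖z‖ ^ q| * ‖Ψ v‖ := by
        refine (norm_add_le _ _).trans (le_of_eq ?_)
        rw [norm_smul, norm_smul, Real.norm_of_nonneg (by positivity), Real.norm_eq_abs]
    _ ≤ ‖x‖ ^ q * (L * ‖u - v‖) + |‖x‖ ^ q - ‖z‖ ^ q| * C := by
        gcongr
        exact hC _ hv
    _ = L * (‖x‖ ^ (q - 1) * (‖x‖ * ‖u - v‖)) + C * |‖x‖ ^ q - ‖z‖ ^ q| := by rw [hxq]; ring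
    _ ≤ L * (‖x‖ ^ (q - 1) * (2 * ‖x - z‖)) + C * |‖x‖ ^ q - ‖z‖ ^ q| := by gcongr
    _ ≤ _ := by
        push_cast
        have h1 : 0 ≤ (C : ℝ) * (‖x‖ ^ (q - 1) * ‖x - z‖) := by positivity
        have h2 : 0 ≤ (2 * L : ℝ) * |‖x‖ ^ q - ‖z‖ ^ q| := by positivity
        linarith

/-- A positively homogeneous function of degree at least `1`, Lipschitz on the sphere, is locally
Lipschitz. -/
theorem PosHomogeneous.exists_norm_sub_le_max (h : PosHomogeneous q Ψ) (hL : LipschitzOnSphere Ψ)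
    (hq : 1 ≤ q) :
    ∃ C : ℝ≥0, ∀ x z, ‖Ψ x - Ψ z‖ ≤ C * (max ‖x‖ ‖z‖ ^ (q - 1) * ‖x - z‖) := by
  obtain ⟨C, hC⟩ := h.exists_norm_sub_le hL
  obtain ⟨C', hC'⟩ := h.exists_norm_le hL (by linarith)
  refine ⟨C * (1 + q.toNNReal) + C', fun x z => ?_⟩
  wlog hxz : ‖z‖ ≤ ‖x‖ generalizing x z
  · have := this z x (le_of_not_ge hxz)
    rwa [norm_sub_rev, norm_sub_rev x z, max_comm]
  rw [max_eq_left hxz]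
  have hq0 : (0 : ℝ) ≤ q := by linarith
  push_cast
  rw [Real.coe_toNNReal q hq0]
  rcases eq_or_ne x 0 with rfl | hx
  · have hz : z = 0 := by simpa using hxz
    simp [hz]
  have hx0 : 0 < ‖x‖ := norm_pos_iff.2 hx
  have hxq : ‖x‖ ^ q = ‖x‖ ^ (q - 1) * ‖x‖ := by
    rw [← Real.rpow_add_one hx0.ne']; congr 1; ring
  rcases eq_or_ne z 0 with rfl | hz
  · rw [h.map_zero (by linarith), sub_zero, sub_zero]
    refine (hC' x).trans ?_
    rw [hxq]
    have : 0 ≤ (C * (1 + q) : ℝ) * (‖x‖ ^ (q - 1) * ‖x‖) := by positivity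
    linarith
  have hpow : |‖x‖ ^ q - ‖z‖ ^ q| ≤ q * (‖x‖ ^ (q - 1) * ‖x - z‖) := by
    -- Bernoulli's inequality at ‖z‖ / ‖x‖ - 1 replaces the mean value theorem and allows ‖z‖ to be
    -- arbitrarily small.
    have h1 := one_add_mul_self_le_rpow_one_add (s := ‖z‖ / ‖x‖ - 1) (by
      have : 0 ≤ ‖z‖ / ‖x‖ := by positivity
      linarith) hq
    rw [add_sub_cancel, Real.div_rpow (by positivity) (by positivity)] at h1
    have h2 : ‖z‖ ^ q ≤ ‖x‖ ^ q := by gcongr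
    have h3 : ‖x‖ ^ q * (1 + q * (‖z‖ / ‖x‖ - 1)) ≤ ‖z‖ ^ q := by
      rw [le_div_iff₀ (by positivity)] at h1
      linarith
    have h4 : ‖x‖ ^ q * (1 + q * (‖z‖ / ‖x‖ - 1)) =
        ‖x‖ ^ q - q * (‖x‖ ^ (q - 1) * (‖x‖ - ‖z‖)) := by
      rw [hxq]; field_simp; ring
    have h5 : q * (‖x‖ ^ (q - 1) * (‖x‖ - ‖z‖)) ≤ q * (‖x‖ ^ (q - 1) * ‖x - z‖) := by
      gcongr
      exact norm_sub_norm_le x z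
    rw [abs_of_nonneg (by linarith)]
    linarith
  calc ‖Ψ x - Ψ z‖ ≤ C * (‖x‖ ^ (q - 1) * ‖x - z‖ + |‖x‖ ^ q - ‖z‖ ^ q|) := hC x z hx hz
    _ ≤ C * (‖x‖ ^ (q - 1) * ‖x - z‖ + q * (‖x‖ ^ (q - 1) * ‖x - z‖)) := by gcongr
    _ ≤ _ := by
      have : 0 ≤ (C' : ℝ) * (‖x‖ ^ (q - 1) * ‖x - z‖) := by positivity
      linarith

theorem PosHomogeneous.continuous (h : PosHomogeneous q Ψ) (hL : LipschitzOnSphere Ψ)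
    (hq : 1 ≤ q) : Continuous Ψ := by
  obtain ⟨C, hC⟩ := h.exists_norm_sub_le_max hL hq
  rw [continuous_iff_continuousAt]
  intro x
  rw [ContinuousAt, tendsto_iff_norm_sub_tendsto_zero]
  refine squeeze_zero (fun _ => norm_nonneg _) (fun z => hC z x) ?_
  have : Continuous fun z : E => (C : ℝ) * (max ‖z‖ ‖x‖ ^ (q - 1) * ‖z - x‖) := by
    refine continuous_const.mul (Continuous.mul ?_ (by fun_prop))
    exact Continuous.rpow_const (by fun_prop) fun _ => Or.inr (by linarith)
  simpa using this.tendsto x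

/-- Almost additivity: adding the smaller argument perturbs Ψ at the larger one by a Lipschitz
amount, and Ψ of the smaller argument alone is no bigger than that. Every interaction below is
measured by this product of a maximum and a minimum. -/
theorem PosHomogeneous.exists_enorm_add_sub_sub_le (h : PosHomogeneous q Ψ)
    (hL : LipschitzOnSphere Ψ) (hq : 1 ≤ q) :
    ∃ C : ℝ≥0, ∀ y z, ‖Ψ (y + z) - Ψ y - Ψ z‖ₑ ≤
      C * (max ‖y‖ₑ ‖z‖ₑ ^ (q - 1) * min ‖y‖ₑ ‖z‖ₑ) := by
  obtain ⟨C, hC⟩ := h.exists_norm_sub_le_max hL hq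
  obtain ⟨C', hC'⟩ := h.exists_norm_le hL (by linarith)
  have hq1 : 0 ≤ q - 1 := by linarith
  have key : ∀ y z, ‖z‖ ≤ ‖y‖ → ‖Ψ (y + z) - Ψ y - Ψ z‖ ≤
      (C * 2 ^ (q - 1) + C') * (‖y‖ ^ (q - 1) * ‖z‖) := by
    intro y z hyz
    have h1 : ‖Ψ (y + z) - Ψ y‖ ≤ C * ((2 * ‖y‖) ^ (q - 1) * ‖z‖) := by
      have := hC (y + z) y
      rw [add_sub_cancel_left] at this
      refine this.trans ?_
      gcongr
      refine max_le ((norm_add_le _ _).trans (by linarith)) (by linarith [norm_nonneg y])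
    have h2 : ‖Ψ z‖ ≤ C' * (‖y‖ ^ (q - 1) * ‖z‖) := by
      refine (hC' z).trans ?_
      gcongr
      rcases eq_or_ne z 0 with rfl | hz
      · simp [Real.zero_rpow (by linarith : q ≠ 0)]
      · have : ‖z‖ ^ q = ‖z‖ ^ (q - 1) * ‖z‖ := by
          rw [← Real.rpow_add_one (norm_ne_zero_iff.2 hz)]; congr 1; ring
        rw [this]
        gcongr
    rw [Real.mul_rpow (by norm_num) (norm_nonneg _)] at h1
    calc ‖Ψ (y + z) - Ψ y - Ψ z‖ ≤ ‖Ψ (y + z) - Ψ y‖ + ‖Ψ z‖ := norm_sub_le _ _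
      _ ≤ _ := add_le_add h1 h2
      _ = _ := by ring
  have key' : ∀ y z, ‖z‖ ≤ ‖y‖ → ‖Ψ (y + z) - Ψ y - Ψ z‖ₑ ≤
      (C * (2 : ℝ).toNNReal ^ (q - 1) + C' : ℝ≥0) * (‖y‖ₑ ^ (q - 1) * ‖z‖ₑ) := by
    intro y z hyz
    rw [← ofReal_norm, ← ofReal_norm, ← ofReal_norm,
      ENNReal.ofReal_rpow_of_nonneg (norm_nonneg _) hq1,
      ← ENNReal.ofReal_mul (by positivity), ← ENNReal.ofReal_coe_nnreal,
      ← ENNReal.ofReal_mul (NNReal.coe_nonneg _)]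
    refine ENNReal.ofReal_le_ofReal ((key y z hyz).trans (le_of_eq ?_))
    push_cast
    simp
  refine ⟨C * (2 : ℝ).toNNReal ^ (q - 1) + C', fun y z => ?_⟩
  have hen : ∀ a b : E, ‖a‖ ≤ ‖b‖ → ‖a‖ₑ ≤ ‖b‖ₑ := fun a b hab => by
    rw [← ofReal_norm, ← ofReal_norm]; exact ENNReal.ofReal_le_ofReal hab
  rcases le_total ‖z‖ ‖y‖ with hyz | hyz
  · rw [max_eq_left (hen _ _ hyz), min_eq_right (hen _ _ hyz)]
    exact key' y z hyz
  · rw [max_eq_right (hen _ _ hyz), min_eq_left (hen _ _ hyz), add_comm, sub_right_comm]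
    exact key' z y hyz

/-- A positively homogeneous function of negative degree, Lipschitz on the sphere, is locally
Lipschitz away from the origin. -/
theorem PosHomogeneous.exists_norm_sub_le_of_le_half {β : ℝ} (h : PosHomogeneous (-β) Ψ)
    (hL : LipschitzOnSphere Ψ) (hβ : 0 < β) :
    ∃ C : ℝ≥0, ∀ x z, x ≠ 0 → ‖x - z‖ ≤ ‖x‖ / 2 →
      ‖Ψ x - Ψ z‖ ≤ C * (‖x‖ ^ (-β - 1) * ‖x - z‖) := by
  obtain ⟨C, hC⟩ := h.exists_norm_sub_le hL
  refine ⟨C * (1 + (β * (1 / 2) ^ (-β - 1)).toNNReal), fun x z hx hxz => ?_⟩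
  have hx0 : 0 < ‖x‖ := norm_pos_iff.2 hx
  have hz2 : ‖x‖ / 2 ≤ ‖z‖ := by linarith [norm_sub_norm_le x z]
  have hz : z ≠ 0 := norm_pos_iff.1 (by linarith)
  have hpow : |‖x‖ ^ (-β) - ‖z‖ ^ (-β)| ≤
      β * (1 / 2) ^ (-β - 1) * (‖x‖ ^ (-β - 1) * ‖x - z‖) := by
    have h1 := Convex.norm_image_sub_le_of_norm_hasDerivWithin_le (𝕜 := ℝ)
      (f := fun s : ℝ => s ^ (-β)) (f' := fun s => -β * s ^ (-β - 1)) (s := Ici (‖x‖ / 2))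
      (C := β * (‖x‖ / 2) ^ (-β - 1)) (x := ‖z‖) (y := ‖x‖)
      (fun s hs => (Real.hasDerivAt_rpow_const (Or.inl (ne_of_gt
        (lt_of_lt_of_le (by positivity) hs)))).hasDerivWithinAt)
      (fun s hs => by
        have hs' : ‖x‖ / 2 ≤ s := hs
        have hs0 : 0 < s := by linarith
        rw [norm_mul, norm_neg, Real.norm_of_nonneg hβ.le, Real.norm_of_nonneg (by positivity)]
        gcongr ?_ * ?_
        exact Real.rpow_le_rpow_of_nonpos (by positivity) hs' (by linarith))
      (convex_Ici _) hz2 (by simp only [mem_Ici]; linarith)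
    rw [Real.norm_eq_abs, Real.norm_eq_abs] at h1
    refine h1.trans ?_
    rw [show ‖x‖ / 2 = 1 / 2 * ‖x‖ by ring, Real.mul_rpow (by norm_num) (by positivity)]
    calc _ ≤ β * ((1 / 2) ^ (-β - 1) * ‖x‖ ^ (-β - 1)) * ‖x - z‖ := by
          gcongr; exact abs_norm_sub_norm_le x z
      _ = _ := by ring
  refine (hC x z hx hz).trans ?_
  push_cast
  rw [Real.coe_toNNReal _ (by positivity)]
  calc _ ≤ (C : ℝ) * (‖x‖ ^ (-β - 1) * ‖x - z‖ +
        β * (1 / 2) ^ (-β - 1) * (‖x‖ ^ (-β - 1) * ‖x - z‖)) := by gcongr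
    _ = _ := by ring

theorem PosHomogeneous.continuousOn_compl_zero {β : ℝ} (h : PosHomogeneous (-β) Ψ)
    (hL : LipschitzOnSphere Ψ) (hβ : 0 < β) : ContinuousOn Ψ {0}ᶜ := by
  obtain ⟨C, hC⟩ := h.exists_norm_sub_le_of_le_half hL hβ
  intro x hx
  refine ContinuousAt.continuousWithinAt ?_
  have hx0 : x ≠ 0 := hx
  rw [ContinuousAt, tendsto_iff_norm_sub_tendsto_zero]
  have hev : ∀ᶠ z in nhds x, ‖Ψ z - Ψ x‖ ≤ C * (‖x‖ ^ (-β - 1) * ‖x - z‖) := by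
    filter_upwards [closedBall_mem_nhds x (half_pos (norm_pos_iff.2 hx0))] with z hz
    rw [norm_sub_rev]
    refine hC x z hx0 ?_
    rwa [mem_closedBall, dist_comm, dist_eq_norm] at hz
  refine squeeze_zero' (Filter.Eventually.of_forall fun _ => norm_nonneg _) hev ?_
  have : Continuous fun z : E => (C : ℝ) * (‖x‖ ^ (-β - 1) * ‖x - z‖) := by fun_prop
  simpa using this.tendsto x

theorem PosHomogeneous.stronglyMeasurable {β : ℝ} [MeasurableSpace E] [BorelSpace E]
    [SecondCountableTopology E]
    (h : PosHomogeneous (-β) Ψ) (hL : LipschitzOnSphere Ψ) (hβ : 0 < β) :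
    StronglyMeasurable Ψ := by
  have hc := (h.continuousOn_compl_zero hL hβ)
  exact hc.stronglyMeasurable_of_countable_compl (by simp)
end Homogeneous

/-! ### Elementary inequalities for extended nonnegative reals -/

theorem ENNReal.rpow_neg_le_rpow_neg {a b : ℝ≥0∞} (h : a ≤ b) {κ : ℝ} (hκ : 0 ≤ κ) :
    b ^ (-κ) ≤ a ^ (-κ) := by
  rw [ENNReal.rpow_neg, ENNReal.rpow_neg]
  gcongr

theorem enorm_le_enorm_of_norm_le {E F : Type*} [SeminormedAddCommGroup E]
    [SeminormedAddCommGroup F] {x : E} {y : F} (h : ‖x‖ ≤ ‖y‖) : ‖x‖ₑ ≤ ‖y‖ₑ := by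
  rw [← ofReal_norm, ← ofReal_norm]
  exact ENNReal.ofReal_le_ofReal h

/-- This separates a from b, with b raised only to the powers 1 and `max 1 (p - 1)`, both in [1, p),
as a Schur test requires. The case needing care is a ≤ b with p ≤ 2, where a is written as a^(p-1)
a^(2-p) and the second factor is raised to b^(2-p). -/
theorem ENNReal.max_rpow_mul_min_le {p : ℝ} (hp : 1 < p) (a b : ℝ≥0∞) :
    max a b ^ (p - 1) * min a b ≤
      a ^ (p - max 1 (p - 1)) * b ^ (max 1 (p - 1)) + a ^ (p - 1) * b := by
  rcases le_total b a with h | h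
  · rw [max_eq_left h, min_eq_right h]
    exact le_add_self
  · rw [max_eq_right h, min_eq_left h]
    rcases le_total p 2 with h2 | h2
    · refine le_trans ?_ le_add_self
      calc b ^ (p - 1) * a = b ^ (p - 1) * (a ^ (p - 1) * a ^ (2 - p)) := by
            rw [← ENNReal.rpow_add_of_nonneg _ _ (by linarith) (by linarith)]
            ring_nf
            rw [ENNReal.rpow_one]
        _ ≤ b ^ (p - 1) * (a ^ (p - 1) * b ^ (2 - p)) := by
            gcongr
        _ = a ^ (p - 1) * (b ^ (p - 1) * b ^ (2 - p)) := by ring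
        _ = a ^ (p - 1) * b := by
            rw [← ENNReal.rpow_add_of_nonneg _ _ (by linarith) (by linarith)]
            ring_nf
            rw [ENNReal.rpow_one]
    · refine le_trans (le_of_eq ?_) le_self_add
      rw [max_eq_right (by linarith : (1 : ℝ) ≤ p - 1), show p - (p - 1) = 1 by ring,
        ENNReal.rpow_one, mul_comm]

/-! ### Interaction of the two parts near the cutting sphere -/

section Near

variable {E : Type*} [NormedAddCommGroup E] [NormedSpace ℝ E] [Nontrivial E]
  [MeasurableSpace E] [BorelSpace E] [FiniteDimensional ℝ E] (ν : Measure E) [ν.IsAddHaarMeasure]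

/-- Every measure of mass at most one puts little mass near some sphere of radius in `[1, 2]`. -/
theorem exists_radius_lintegral_rpow_le {γ : ℝ} (hγ0 : 0 ≤ γ) (hγ : γ < 1) :
    ∃ C : ℝ≥0, ∀ μ : Measure E, [SFinite μ] → μ univ ≤ 1 →
      ∃ ρ ∈ Icc (1 : ℝ) 2, ∫⁻ t, ‖‖t‖ - ρ‖ₑ ^ (-γ) ∂μ ≤ C := by
  obtain ⟨C, hC⟩ := setLIntegral_ball_rpow_sub_le (E := ℝ) volume hγ0 (by simpa using hγ)
  refine ⟨C * (3 : ℝ≥0) ^ (1 - γ), fun μ _ hμ => ?_⟩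
  have hm : Measurable (Function.uncurry fun (t : E) (ρ : ℝ) => ‖‖t‖ - ρ‖ₑ ^ (-γ)) := by
    unfold Function.uncurry
    fun_prop
  have h1 : ∀ t : E, ∫⁻ ρ in Icc (1 : ℝ) 2, ‖‖t‖ - ρ‖ₑ ^ (-γ) ≤ (C * (3 : ℝ≥0) ^ (1 - γ) : ℝ≥0) := by
    intro t
    have h2 := hC 3 (by norm_num) ‖t‖
    calc ∫⁻ ρ in Icc (1 : ℝ) 2, ‖‖t‖ - ρ‖ₑ ^ (-γ)
        ≤ ∫⁻ ρ in ball (0 : ℝ) 3, ‖‖t‖ - ρ‖ₑ ^ (-γ) := lintegral_mono_set (fun ρ hρ => by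
          rw [mem_ball_zero_iff, Real.norm_eq_abs, abs_of_nonneg (by linarith [hρ.1])]
          linarith [hρ.2])
      _ = ∫⁻ ρ in ball (0 : ℝ) 3, ‖ρ - ‖t‖‖ₑ ^ (-γ) := by simp_rw [enorm_sub_rev]
      _ ≤ _ := h2
      _ = _ := by
        have : ENNReal.ofReal 3 = 3 := by simp
        rw [this]
        simp [ENNReal.coe_rpow_of_nonneg _ (by linarith : 0 ≤ 1 - γ)]
  have h3 : ∫⁻ ρ in Icc (1 : ℝ) 2, ∫⁻ t, ‖‖t‖ - ρ‖ₑ ^ (-γ) ∂μ ≤ (C * (3 : ℝ≥0) ^ (1 - γ) : ℝ≥0) := by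
    rw [← lintegral_lintegral_swap hm.aemeasurable]
    calc _ ≤ ∫⁻ t, ((C * (3 : ℝ≥0) ^ (1 - γ) : ℝ≥0) : ℝ≥0∞) ∂μ := lintegral_mono h1
      _ = (C * (3 : ℝ≥0) ^ (1 - γ) : ℝ≥0) * μ univ := lintegral_const _
      _ ≤ (C * (3 : ℝ≥0) ^ (1 - γ) : ℝ≥0) * 1 := by gcongr
      _ = _ := mul_one _
  have hvol : volume (Icc (1 : ℝ) 2) = 1 := by rw [Real.volume_Icc]; norm_num
  -- Averaging over ρ in [1, 2] gives a bounded integral because γ < 1; some radius does no worse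
  -- than the average.
  obtain ⟨ρ, hρ, h4⟩ := exists_le_setLAverage (μ := volume) (s := Icc (1 : ℝ) 2)
    (f := fun ρ => ∫⁻ t, ‖‖t‖ - ρ‖ₑ ^ (-γ) ∂μ) (by rw [hvol]; simp) (by rw [hvol]; simp)
    (Measurable.lintegral_prod_left' (f := fun z : E × ℝ => ‖‖z.1‖ - z.2‖ₑ ^ (-γ)) hm).aemeasurable
  rw [setLAverage_eq, hvol, div_one] at h4
  exact ⟨ρ, hρ, h4.trans h3⟩

/-- These are the exponents for a Young inequality H^(p-1) G ≤ H^s + G^s'. The power s = p - ε stays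
below the critical p, so the potential H of order β is admissible; s' may exceed p, and the gain γ
in the order of G compensates for that once ε is small compared with γ / β. -/
theorem exists_near_exponents {D β p : ℝ} (hβ : 0 < β) (hp : 1 < p) (hpβ : p * β = D) :
    ∃ γ s s' : ℝ, 0 ≤ γ ∧ γ < 1 ∧ γ ≤ β ∧ 1 ≤ s ∧ 1 ≤ s' ∧ β * s < D ∧ (β - γ) * s' < D ∧
      (s / (p - 1)).HolderConjugate s' := by
  set γ := min β 1 / 2
  have hγβ : γ ≤ β / 2 := by simp only [γ]; gcongr; exact min_le_left _ _
  have hγ1 : γ ≤ 1 / 2 := by simp only [γ]; gcongr; exact min_le_right _ _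
  have hγ0 : 0 < γ := by positivity
  set ε := min (γ / β) (p - 1) / 2
  have hκ : γ / β ≤ 1 / 2 := by rw [div_le_iff₀ hβ]; linarith
  have hε0 : 0 < ε := by
    have : 0 < γ / β := by positivity
    have : 0 < p - 1 := by linarith
    positivity
  have hε1 : ε ≤ γ / β / 2 := by simp only [ε]; gcongr; exact min_le_left _ _
  have hε2 : ε ≤ (p - 1) / 2 := by simp only [ε]; gcongr; exact min_le_right _ _
  have h1ε : 0 < 1 - ε := by linarith
  refine ⟨γ, p - ε, (p - ε) / (1 - ε), hγ0.le, by linarith, by linarith, by linarith, ?_, ?_, ?_, ?_⟩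
  · rw [le_div_iff₀ h1ε]; linarith
  · nlinarith
  · rw [← mul_div_assoc, div_lt_iff₀ h1ε, ← hpβ]
    have hεβ : ε * β ≤ γ / 2 := by
      calc ε * β ≤ γ / β / 2 * β := by gcongr
        _ = γ / 2 := by field_simp
    nlinarith
  · have hp1 : 0 < p - 1 := by linarith
    rw [Real.holderConjugate_iff]
    refine ⟨by rw [one_lt_div hp1]; linarith, ?_⟩
    have : p - ε ≠ 0 := by linarith
    field_simp
    ring

/-- A point x and the mass on the other side of the sphere of radius ρ are separated by at least |
‖t‖ - ρ |. For the smaller of A and B this allows a factor ‖x - t‖^(-γ) to be traded for a weight in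
t whose integral is bounded by the choice of ρ. The leftover potential has order β - γ, and this
gain brings the critical product into the integrable range. -/
theorem setLIntegral_interaction_near_le {β p : ℝ} (hβ : 0 < β) (hp : 1 < p)
    (hpβ : p * β = Module.finrank ℝ E) (c : ℝ≥0) :
    ∃ C : ℝ≥0, ∀ μ : Measure E, [SFinite μ] → μ univ ≤ 1 → ∃ ρ ∈ Icc (1 : ℝ) 2,
      ∀ A B : E → ℝ≥0∞, (∀ x, A x ≤ c * ∫⁻ t in closedBall 0 ρ, ‖x - t‖ₑ ^ (-β) ∂μ) →
        (∀ x, B x ≤ c * ∫⁻ t in (closedBall 0 ρ)ᶜ, ‖x - t‖ₑ ^ (-β) ∂μ) →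
        ∫⁻ x in ball (0 : E) 4, max (A x) (B x) ^ (p - 1) * min (A x) (B x) ∂ν ≤ C := by
  obtain ⟨γ, s, s', hγ0, hγ1, hγβ, hs, hs', hsD, hsD', hconj⟩ := exists_near_exponents hβ hp hpβ
  obtain ⟨C₁, hC₁⟩ := exists_radius_lintegral_rpow_le (E := E) hγ0 hγ1
  obtain ⟨C₂, hC₂⟩ := setLIntegral_ball_rpow_sub_le ν (κ := β * s) (by positivity) hsD
  obtain ⟨C₃, hC₃⟩ := setLIntegral_ball_rpow_sub_le ν (κ := (β - γ) * s')
    (mul_nonneg (by linarith) (by linarith)) hsD'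
  set b₂ : ℝ≥0∞ := C₂ * ENNReal.ofReal 4 ^ (Module.finrank ℝ E - β * s)
  set b₃ : ℝ≥0∞ := C₃ * ENNReal.ofReal 4 ^ (Module.finrank ℝ E - (β - γ) * s')
  have hb₂ : b₂ ≠ ∞ := by
    refine ENNReal.mul_ne_top (by simp) (ENNReal.rpow_ne_top_of_nonneg (by linarith) (by simp))
  have hb₃ : b₃ ≠ ∞ := by
    refine ENNReal.mul_ne_top (by simp) (ENNReal.rpow_ne_top_of_nonneg (by linarith) (by simp))
  have hfin : (c : ℝ≥0∞) ^ p * (b₂ + (C₁ : ℝ≥0∞) ^ s' * b₃) ≠ ∞ := by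
    refine ENNReal.mul_ne_top (ENNReal.rpow_ne_top_of_nonneg (by linarith) (by simp))
      (ENNReal.add_ne_top.2 ⟨hb₂, ENNReal.mul_ne_top
        (ENNReal.rpow_ne_top_of_nonneg (by linarith) (by simp)) hb₃⟩)
  refine ⟨((c : ℝ≥0∞) ^ p * (b₂ + (C₁ : ℝ≥0∞) ^ s' * b₃)).toNNReal, fun μ _ hμ => ?_⟩
  rw [ENNReal.coe_toNNReal hfin]
  obtain ⟨ρ, hρ, hρC⟩ := hC₁ μ hμ
  refine ⟨ρ, hρ, fun A B hA hB => ?_⟩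
  set H : E → ℝ≥0∞ := fun x => ∫⁻ t, ‖x - t‖ₑ ^ (-β) ∂μ
  -- The singular weight is absorbed into the measure, whose total mass stays bounded by the choice
  -- of ρ; G is its potential of the reduced order β - γ.
  set μ' : Measure E := μ.withDensity fun t => ‖‖t‖ - ρ‖ₑ ^ (-γ)
  set G : E → ℝ≥0∞ := fun x => ∫⁻ t, ‖x - t‖ₑ ^ (-(β - γ)) ∂μ'
  have hμ' : μ' univ ≤ C₁ := by
    simpa [μ', withDensity_apply _ MeasurableSet.univ] using hρC
  have hG : ∀ x, G x = ∫⁻ t, ‖‖t‖ - ρ‖ₑ ^ (-γ) * ‖x - t‖ₑ ^ (-(β - γ)) ∂μ := fun x => by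
    simp only [G, μ']
    rw [lintegral_withDensity_eq_lintegral_mul _ (by fun_prop) (by fun_prop)]
    rfl
  have hAH : ∀ x, A x ≤ c * H x := fun x => (hA x).trans (by
    gcongr; exact setLIntegral_le_lintegral _ _)
  have hBH : ∀ x, B x ≤ c * H x := fun x => (hB x).trans (by
    gcongr; exact setLIntegral_le_lintegral _ _)
  have hker : ∀ x t : E, |‖t‖ - ρ| ≤ ‖x - t‖ → x ≠ t → ‖x - t‖ₑ ^ (-β) ≤
      ‖‖t‖ - ρ‖ₑ ^ (-γ) * ‖x - t‖ₑ ^ (-(β - γ)) := by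
    intro x t hxt hne
    calc ‖x - t‖ₑ ^ (-β) = ‖x - t‖ₑ ^ (-γ) * ‖x - t‖ₑ ^ (-(β - γ)) := by
          rw [← ENNReal.rpow_add _ _ (by simpa [sub_eq_zero] using hne) (by simp)]
          congr 1; ring
      _ ≤ _ := by
          refine mul_le_mul' ?_ le_rfl
          exact ENNReal.rpow_neg_le_rpow_neg (enorm_le_enorm_of_norm_le (x := ‖t‖ - ρ) hxt) hγ0
  -- Of A and B, the estimate uses the one generated by the mass on the other side of the sphere
  -- from x.
  have hmin : ∀ x, min (A x) (B x) ≤ c * G x := by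
    intro x
    rw [hG]
    rcases le_or_gt ‖x‖ ρ with hx | hx
    · refine (min_le_right _ _).trans ((hB x).trans ?_)
      refine mul_le_mul_right ?_ _
      refine (setLIntegral_mono' measurableSet_closedBall.compl fun t ht => ?_).trans
        (setLIntegral_le_lintegral _ _)
      have ht' : ρ < ‖t‖ := by simpa using ht
      refine hker x t ?_ (fun h => by rw [h] at hx; linarith)
      rw [abs_of_pos (by linarith), norm_sub_rev]
      linarith [norm_sub_norm_le t x]
    · refine (min_le_left _ _).trans ((hA x).trans ?_)
      refine mul_le_mul_right ?_ _
      refine (setLIntegral_mono' measurableSet_closedBall fun t ht => ?_).trans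
        (setLIntegral_le_lintegral _ _)
      have ht' : ‖t‖ ≤ ρ := by simpa using ht
      refine hker x t ?_ (fun h => by rw [h] at hx; linarith)
      rw [abs_of_nonpos (by linarith)]
      linarith [norm_sub_norm_le x t]
  have hpt : ∀ x, max (A x) (B x) ^ (p - 1) * min (A x) (B x) ≤
      (c : ℝ≥0∞) ^ p * (1 * H x ^ s + 1 * G x ^ s') := by
    intro x
    have hp1 : 0 < p - 1 := by linarith
    calc max (A x) (B x) ^ (p - 1) * min (A x) (B x)
        ≤ (c * H x) ^ (p - 1) * (c * G x) := by
          gcongr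
          · exact max_le (hAH x) (hBH x)
          · exact hmin x
      _ = (c : ℝ≥0∞) ^ p * (H x ^ (p - 1) * G x) := by
          rw [ENNReal.mul_rpow_of_nonneg _ _ hp1.le]
          have : (c : ℝ≥0∞) ^ p = (c : ℝ≥0∞) ^ (p - 1) * c := by
            nth_rw 3 [← ENNReal.rpow_one (c : ℝ≥0∞)]
            rw [← ENNReal.rpow_add_of_nonneg _ _ hp1.le zero_le_one]
            congr 1; ring
          rw [this]; ring
      _ ≤ (c : ℝ≥0∞) ^ p * ((H x ^ (p - 1)) ^ (s / (p - 1)) + G x ^ s') := by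
          gcongr
          refine (ENNReal.young_inequality _ _ hconj).trans ?_
          gcongr
          · refine ENNReal.div_le_of_le_mul (le_mul_of_one_le_right zero_le ?_)
            rw [ENNReal.one_le_ofReal]; exact hconj.lt.le
          · refine ENNReal.div_le_of_le_mul (le_mul_of_one_le_right zero_le ?_)
            rw [ENNReal.one_le_ofReal]; exact hs'
      _ = _ := by
          rw [← ENNReal.rpow_mul, mul_div_cancel₀ _ hp1.ne', one_mul, one_mul]
  have hmeas : ∀ κ : ℝ, Measurable (Function.uncurry fun x t : E => ‖x - t‖ₑ ^ κ) := fun κ => by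
    unfold Function.uncurry
    fun_prop
  have hHm : Measurable H := (hmeas (-β)).lintegral_prod_right'
  calc ∫⁻ x in ball (0 : E) 4, max (A x) (B x) ^ (p - 1) * min (A x) (B x) ∂ν
      ≤ ∫⁻ x in ball (0 : E) 4, (c : ℝ≥0∞) ^ p * (1 * H x ^ s + 1 * G x ^ s') ∂ν :=
        lintegral_mono hpt
    _ = (c : ℝ≥0∞) ^ p * (∫⁻ x in ball (0 : E) 4, 1 * H x ^ s ∂ν +
          ∫⁻ x in ball (0 : E) 4, 1 * G x ^ s' ∂ν) := by
        rw [lintegral_const_mul', lintegral_add_left (by fun_prop)]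
        exact ENNReal.rpow_ne_top_of_nonneg (by linarith) (by simp)
    _ ≤ (c : ℝ≥0∞) ^ p * (μ univ ^ s * b₂ + μ' univ ^ s' * b₃) := by
        gcongr
        · refine lintegral_mul_rpow_lintegral_le _ μ hs (hmeas _) measurable_const
            (Filter.Eventually.of_forall fun t => ?_)
          refine le_trans (le_of_eq ?_) (hC₂ 4 (by norm_num) t)
          simp_rw [← ENNReal.rpow_mul, one_mul, neg_mul]
        · refine lintegral_mul_rpow_lintegral_le _ μ' hs' (hmeas _) measurable_const
            (Filter.Eventually.of_forall fun t => ?_)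
          refine le_trans (le_of_eq ?_) (hC₃ 4 (by norm_num) t)
          simp_rw [← ENNReal.rpow_mul, one_mul, neg_mul]
    _ ≤ (c : ℝ≥0∞) ^ p * (1 * b₂ + (C₁ : ℝ≥0∞) ^ s' * b₃) := by
        gcongr
        exact (ENNReal.rpow_le_rpow hμ (by linarith)).trans_eq (ENNReal.one_rpow _)
    _ = _ := by rw [one_mul]

end Near

/-! ### Remainder kernels of point masses and the interaction far from the origin -/

/-- The difference between the kernel `K (x - t)` of a point mass at `t` and the kernel `K x`
of the point mass at the origin, the latter being present only if `‖t‖ ≤ ‖x‖`. -/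
noncomputable def kernelRemainder {E F : Type*} [NormedAddCommGroup E] [NormedAddCommGroup F]
    (K : E → F) (x t : E) : F :=
  K (x - t) - (closedBall (0 : E) ‖x‖).indicator (fun _ => K x) t

section Remainder

variable {E F : Type*} [NormedAddCommGroup E] [NormedSpace ℝ E] [Nontrivial E]
  [MeasurableSpace E] [BorelSpace E] [FiniteDimensional ℝ E] (ν : Measure E) [ν.IsAddHaarMeasure]
  [NormedAddCommGroup F] [NormedSpace ℝ F] {K : E → F} {β : ℝ}

theorem kernelRemainder_of_norm_le {x t : E} (h : ‖t‖ ≤ ‖x‖) :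
    kernelRemainder K x t = K (x - t) - K x := by
  rw [kernelRemainder, indicator_of_mem (by simpa using h)]

theorem kernelRemainder_of_norm_lt {x t : E} (h : ‖x‖ < ‖t‖) :
    kernelRemainder K x t = K (x - t) := by
  rw [kernelRemainder, indicator_of_notMem (by simpa using h), sub_zero]

theorem stronglyMeasurable_kernelRemainder (hK : StronglyMeasurable K) :
    StronglyMeasurable (Function.uncurry (kernelRemainder K)) := by
  have h1 : StronglyMeasurable fun z : E × E => K (z.1 - z.2) :=
    hK.comp_measurable (measurable_fst.sub measurable_snd)
  have h2 : StronglyMeasurable ({z : E × E | ‖z.2‖ ≤ ‖z.1‖}.indicator fun z => K z.1) :=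
    (hK.comp_measurable measurable_fst).indicator
      (measurableSet_le (measurable_norm.comp measurable_snd) (measurable_norm.comp measurable_fst))
  convert h1.sub h2 using 1
  ext ⟨x, t⟩
  simp only [Function.uncurry, kernelRemainder, Pi.sub_apply]
  congr 1
  by_cases h : ‖t‖ ≤ ‖x‖
  · rw [indicator_of_mem (by simpa using h), indicator_of_mem (by simpa using h)]
  · rw [indicator_of_notMem (by simpa using h), indicator_of_notMem (by simpa using h)]

theorem enorm_kernelRemainder_le {c : ℝ≥0} (hc : ∀ x, ‖K x‖ₑ ≤ c * ‖x‖ₑ ^ (-β)) (x t : E) :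
    ‖kernelRemainder K x t‖ₑ ≤ c * (‖x - t‖ₑ ^ (-β) + ‖x‖ₑ ^ (-β)) := by
  refine enorm_sub_le.trans ?_
  rw [mul_add]
  refine add_le_add (hc _) (le_trans ?_ (hc x))
  exact enorm_indicator_le_enorm_self _ _

theorem enorm_kernelRemainder_le_of_two_mul_le (hK : PosHomogeneous (-β) K)
    (hKL : LipschitzOnSphere K) (hβ : 0 < β) :
    ∃ C : ℝ≥0, ∀ x t : E, x ≠ 0 → 2 * ‖t‖ ≤ ‖x‖ →
      ‖kernelRemainder K x t‖ₑ ≤ C * (‖x‖ₑ ^ (-β - 1) * ‖t‖ₑ) := by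
  obtain ⟨C, hC⟩ := hK.exists_norm_sub_le_of_le_half hKL hβ
  refine ⟨C, fun x t hx h => ?_⟩
  rw [kernelRemainder_of_norm_le (by linarith [norm_nonneg t]), enorm_sub_rev, ← ofReal_norm,
    ← ofReal_norm, ← ofReal_norm, ENNReal.ofReal_rpow_of_pos (norm_pos_iff.2 hx),
    ← ENNReal.ofReal_coe_nnreal, ← ENNReal.ofReal_mul (by positivity),
    ← ENNReal.ofReal_mul C.coe_nonneg]
  refine ENNReal.ofReal_le_ofReal ?_
  have := hC x (x - t) hx (by rw [sub_sub_cancel]; linarith)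
  rwa [sub_sub_cancel] at this

/-- The weight makes the integral invariant under dilations, so ‖t‖ is the only scale. Well inside
it the remainder is K(x - t), of size ‖t‖^(-β), and the weight is integrable at the origin as βq >
0; at comparable distance the singularity at t is integrable as βq < D; far outside, subtracting K x
gains a factor ‖t‖ / ‖x‖ and the integrand decays like ‖x‖^(-D-q). -/
theorem lintegral_enorm_kernelRemainder_le (hK : PosHomogeneous (-β) K)
    (hKL : LipschitzOnSphere K) (hβ : 0 < β) {q : ℝ} (hq : 1 ≤ q)
    (hqD : β * q < Module.finrank ℝ E) :
    ∃ C : ℝ≥0, ∀ t, ∫⁻ x, ‖x‖ₑ ^ (-(Module.finrank ℝ E - β * q)) *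
      ‖kernelRemainder K x t‖ₑ ^ q ∂ν ≤ C := by
  set D : ℝ := (Module.finrank ℝ E : ℝ)
  have hq0 : 0 < q := by linarith
  have hβq : 0 < β * q := by positivity
  obtain ⟨c, hc⟩ := hK.exists_enorm_le hKL (by linarith)
  obtain ⟨c', hc'⟩ := enorm_kernelRemainder_le_of_two_mul_le hK hKL hβ
  obtain ⟨C₁, hC₁⟩ := setLIntegral_ball_rpow_le ν (κ := D - β * q) (by linarith)
  obtain ⟨C₂, hC₂⟩ := setLIntegral_ball_rpow_sub_le ν (κ := β * q) hβq.le hqD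
  obtain ⟨C₃, hC₃⟩ := setLIntegral_annulus_rpow_le ν D (Nat.cast_nonneg _)
  obtain ⟨C₄, hC₄⟩ := setLIntegral_compl_ball_rpow_le ν (κ := D + q) (by linarith)
  set M : ℝ≥0∞ := c ^ q * C₁ + (c ^ q * 2 ^ (q - 1)) * (C₂ * 4 ^ (D - β * q) + C₃) +
    c' ^ q * (C₄ * 4 ^ (-q) * 2 ^ q)
  have hM : M ≠ ∞ := by
    have h1 : ∀ (a : ℝ≥0∞) (r : ℝ), a ≠ ∞ → 0 ≤ r → a ^ r ≠ ∞ := fun a r ha hr =>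
      ENNReal.rpow_ne_top_of_nonneg hr ha
    have h4 : (4 : ℝ≥0∞) ^ (-q) ≠ ∞ := by
      rw [ENNReal.rpow_neg]; simp [ENNReal.rpow_eq_zero_iff, hq0]
    simp only [M, ne_eq, ENNReal.add_eq_top, not_or]
    refine ⟨⟨?_, ?_⟩, ?_⟩
    · exact ENNReal.mul_ne_top (h1 _ _ (by simp) hq0.le) (by simp)
    · refine ENNReal.mul_ne_top (ENNReal.mul_ne_top (h1 _ _ (by simp) hq0.le)
        (h1 _ _ (by simp) (by linarith))) (ENNReal.add_ne_top.2 ⟨ENNReal.mul_ne_top (by simp)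
        (h1 _ _ (by simp) (by linarith)), by simp⟩)
    · refine ENNReal.mul_ne_top (h1 _ _ (by simp) hq0.le) (ENNReal.mul_ne_top
        (ENNReal.mul_ne_top (by simp) h4) (h1 _ _ (by simp) hq0.le))
  refine ⟨M.toNNReal, fun t => ?_⟩
  rw [ENNReal.coe_toNNReal hM]
  rcases eq_or_ne t 0 with rfl | ht
  · have : ∀ x, kernelRemainder K x 0 = 0 := fun x => by
      rw [kernelRemainder_of_norm_le (by simp)]; simp
    simp [this, hq0]
  -- Below radius τ one has ‖x - t‖ ≥ τ and the subtracted term is absent; from radius 4τ = 2 ‖t‖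
  -- on, the Lipschitz bound for K applies.
  set τ := ‖t‖ / 2
  have hτ : 0 < τ := by have := norm_pos_iff.2 ht; positivity
  have htτ : ‖t‖ = 2 * τ := by simp only [τ]; ring
  set T := ENNReal.ofReal τ
  have hT0 : T ≠ 0 := by simpa [T] using hτ
  have hTt : T ≠ ∞ := by simp [T]
  have htT : ‖t‖ₑ = 2 * T := by
    rw [← ofReal_norm, htτ, ENNReal.ofReal_mul (by norm_num)]; simp [T]
  have h4T : ENNReal.ofReal (4 * τ) = 4 * T := by
    rw [ENNReal.ofReal_mul (by norm_num)]; simp [T]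
  set f : E → ℝ≥0∞ := fun x => ‖x‖ₑ ^ (-(D - β * q)) * ‖kernelRemainder K x t‖ₑ ^ q
  set S₂ : Set E := {x : E | τ ≤ ‖x‖ ∧ ‖x‖ < 4 * τ}
  have hms₂ : MeasurableSet S₂ :=
    (measurableSet_le measurable_const measurable_norm).inter
      (measurableSet_lt measurable_norm measurable_const)
  have hcover : (univ : Set E) ⊆ (ball 0 τ ∪ S₂) ∪ (ball 0 (4 * τ))ᶜ := by
    intro x _
    simp only [S₂, mem_union, mem_ball_zero_iff, mem_ofPred_eq, mem_compl_iff, not_lt]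
    rcases lt_or_ge ‖x‖ τ with h | h
    · exact Or.inl (Or.inl h)
    · rcases lt_or_ge ‖x‖ (4 * τ) with h' | h'
      · exact Or.inl (Or.inr ⟨h, h'⟩)
      · exact Or.inr h'
  have hsplit : ∫⁻ x, f x ∂ν ≤ ∫⁻ x in ball 0 τ, f x ∂ν + ∫⁻ x in S₂, f x ∂ν +
      ∫⁻ x in (ball 0 (4 * τ))ᶜ, f x ∂ν := by
    rw [← setLIntegral_univ]
    refine (lintegral_mono_set hcover).trans ((lintegral_union_le _ _ _).trans ?_)
    gcongr
    exact lintegral_union_le _ _ _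
  have h1 : ∫⁻ x in ball 0 τ, f x ∂ν ≤ c ^ q * C₁ := by
    have hpt : ∀ x ∈ ball (0 : E) τ, f x ≤
        (c ^ q * T ^ (-(β * q))) * ‖x‖ₑ ^ (-(D - β * q)) := by
      intro x hx
      have hx' : ‖x‖ < τ := by simpa using hx
      have hxt : ‖kernelRemainder K x t‖ₑ ≤ c * T ^ (-β) := by
        rw [kernelRemainder_of_norm_lt (by linarith)]
        refine (hc _).trans ?_
        refine mul_le_mul_right ?_ _
        refine ENNReal.rpow_neg_le_rpow_neg ?_ hβ.le
        rw [← ofReal_norm]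
        refine ENNReal.ofReal_le_ofReal ?_
        rw [norm_sub_rev]
        linarith [norm_sub_norm_le t x]
      calc f x ≤ ‖x‖ₑ ^ (-(D - β * q)) * (c * T ^ (-β)) ^ q := by
            simp only [f]; gcongr
        _ = _ := by
            rw [ENNReal.mul_rpow_of_nonneg _ _ hq0.le, ← ENNReal.rpow_mul, neg_mul, mul_comm]
    calc _ ≤ ∫⁻ x in ball 0 τ, (c ^ q * T ^ (-(β * q))) * ‖x‖ₑ ^ (-(D - β * q)) ∂ν :=
          setLIntegral_mono' measurableSet_ball hpt
      _ = (c ^ q * T ^ (-(β * q))) * ∫⁻ x in ball 0 τ, ‖x‖ₑ ^ (-(D - β * q)) ∂ν :=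
          lintegral_const_mul _ (by fun_prop)
      _ ≤ (c ^ q * T ^ (-(β * q))) * (C₁ * T ^ (D - (D - β * q))) := by
          gcongr; exact hC₁ τ hτ
      _ = c ^ q * C₁ * (T ^ (-(β * q)) * T ^ (β * q)) := by
          rw [show D - (D - β * q) = β * q by ring]; ring
      _ = c ^ q * C₁ := by
          rw [← ENNReal.rpow_add _ _ hT0 hTt]; simp
  have h2 : ∫⁻ x in S₂, f x ∂ν ≤ (c ^ q * 2 ^ (q - 1)) * (C₂ * 4 ^ (D - β * q) + C₃) := by
    have hpt : ∀ x ∈ S₂, f x ≤ (c ^ q * 2 ^ (q - 1)) *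
        (T ^ (-(D - β * q)) * ‖x - t‖ₑ ^ (-(β * q)) + ‖x‖ₑ ^ (-D)) := by
      intro x hx
      have hx0 : x ≠ 0 := norm_pos_iff.1 (lt_of_lt_of_le hτ hx.1)
      have hTx : ‖x‖ₑ ^ (-(D - β * q)) ≤ T ^ (-(D - β * q)) := by
        refine ENNReal.rpow_neg_le_rpow_neg ?_ (by linarith)
        rw [← ofReal_norm]
        exact ENNReal.ofReal_le_ofReal hx.1
      calc f x ≤ ‖x‖ₑ ^ (-(D - β * q)) *
              (c ^ q * (2 ^ (q - 1) * ((‖x - t‖ₑ ^ (-β)) ^ q + (‖x‖ₑ ^ (-β)) ^ q))) := by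
            simp only [f]
            refine mul_le_mul_right ?_ _
            refine (ENNReal.rpow_le_rpow (enorm_kernelRemainder_le hc x t) hq0.le).trans ?_
            rw [ENNReal.mul_rpow_of_nonneg _ _ hq0.le]
            gcongr
            exact ENNReal.rpow_add_le_mul_rpow_add_rpow _ _ hq
        _ = (c ^ q * 2 ^ (q - 1)) * (‖x‖ₑ ^ (-(D - β * q)) * ‖x - t‖ₑ ^ (-(β * q)) +
              ‖x‖ₑ ^ (-(D - β * q)) * ‖x‖ₑ ^ (-(β * q))) := by
            rw [← ENNReal.rpow_mul, ← ENNReal.rpow_mul, neg_mul]; ring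
        _ ≤ _ := by
            rw [← ENNReal.rpow_add _ _ (by simpa using hx0) (by simp),
              show -(D - β * q) + -(β * q) = -D by ring]
            exact mul_le_mul_right (add_le_add (mul_le_mul' hTx le_rfl) le_rfl) _
    calc _ ≤ ∫⁻ x in S₂, (c ^ q * 2 ^ (q - 1)) *
            (T ^ (-(D - β * q)) * ‖x - t‖ₑ ^ (-(β * q)) + ‖x‖ₑ ^ (-D)) ∂ν :=
          setLIntegral_mono' hms₂ hpt
      _ = (c ^ q * 2 ^ (q - 1)) * (T ^ (-(D - β * q)) * ∫⁻ x in S₂, ‖x - t‖ₑ ^ (-(β * q)) ∂ν +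
            ∫⁻ x in S₂, ‖x‖ₑ ^ (-D) ∂ν) := by
          rw [lintegral_const_mul _ (by fun_prop), lintegral_add_left (by fun_prop),
            lintegral_const_mul _ (by fun_prop)]
      _ ≤ (c ^ q * 2 ^ (q - 1)) * (T ^ (-(D - β * q)) * (C₂ * (4 * T) ^ (D - β * q)) + C₃) := by
          gcongr
          · refine (lintegral_mono_set fun x hx => ?_).trans
              ((hC₂ (4 * τ) (by positivity) t).trans_eq (by rw [h4T]))
            simpa using hx.2
          · exact (hC₃ τ hτ).trans_eq (by simp [D])
      _ = (c ^ q * 2 ^ (q - 1)) *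
            (C₂ * 4 ^ (D - β * q) * (T ^ (-(D - β * q)) * T ^ (D - β * q)) + C₃) := by
          rw [ENNReal.mul_rpow_of_nonneg _ _ (by linarith)]; ring
      _ = _ := by
          rw [← ENNReal.rpow_add _ _ hT0 hTt]; simp
  have h3 : ∫⁻ x in (ball 0 (4 * τ))ᶜ, f x ∂ν ≤ c' ^ q * (C₄ * 4 ^ (-q) * 2 ^ q) := by
    have hpt : ∀ x ∈ (ball (0 : E) (4 * τ))ᶜ, f x ≤
        (c' ^ q * ‖t‖ₑ ^ q) * ‖x‖ₑ ^ (-(D + q)) := by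
      intro x hx
      have hx' : 4 * τ ≤ ‖x‖ := by simpa using hx
      have hx0 : x ≠ 0 := norm_pos_iff.1 (lt_of_lt_of_le (by positivity) hx')
      calc f x ≤ ‖x‖ₑ ^ (-(D - β * q)) * (c' * (‖x‖ₑ ^ (-β - 1) * ‖t‖ₑ)) ^ q := by
            simp only [f]; gcongr; exact hc' x t hx0 (by linarith)
        _ = (c' ^ q * ‖t‖ₑ ^ q) * (‖x‖ₑ ^ (-(D - β * q)) * ‖x‖ₑ ^ ((-β - 1) * q)) := by
            rw [ENNReal.mul_rpow_of_nonneg _ _ hq0.le, ENNReal.mul_rpow_of_nonneg _ _ hq0.le,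
              ← ENNReal.rpow_mul]; ring
        _ = _ := by
            rw [← ENNReal.rpow_add _ _ (by simpa using hx0) (by simp)]
            congr 2; ring
    calc _ ≤ ∫⁻ x in (ball 0 (4 * τ))ᶜ, (c' ^ q * ‖t‖ₑ ^ q) * ‖x‖ₑ ^ (-(D + q)) ∂ν :=
          setLIntegral_mono' measurableSet_ball.compl hpt
      _ = (c' ^ q * ‖t‖ₑ ^ q) * ∫⁻ x in (ball 0 (4 * τ))ᶜ, ‖x‖ₑ ^ (-(D + q)) ∂ν :=
          lintegral_const_mul _ (by fun_prop)
      _ ≤ (c' ^ q * ‖t‖ₑ ^ q) * (C₄ * (4 * T) ^ (D - (D + q))) := by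
          gcongr
          exact (hC₄ (4 * τ) (by positivity)).trans_eq (by rw [h4T])
      _ = c' ^ q * (C₄ * 4 ^ (-q) * 2 ^ q) * (T ^ q * T ^ (-q)) := by
          rw [htT, show D - (D + q) = -q by ring, ENNReal.mul_rpow_of_nonneg _ _ hq0.le,
            ENNReal.mul_rpow_of_ne_top (by simp) hTt]
          ring
      _ = _ := by
          rw [← ENNReal.rpow_add _ _ hT0 hTt]; simp
  exact hsplit.trans (add_le_add (add_le_add h1 h2) h3)

/-- With A bounded by ‖x‖^(-β), the power A^(p-r) is bounded by a multiple of ‖x‖^(-(D-βr)), exactly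
the weight for which remainders are bounded in L^r. Only r = 1 and r = `max 1 (p - 1)` occur, and
the Schur test passes the bound from point masses to their average B. -/
theorem lintegral_interaction_far_le (hK : PosHomogeneous (-β) K)
    (hKL : LipschitzOnSphere K) (hβ : 0 < β) {p : ℝ} (hp : 1 < p)
    (hpβ : p * β = Module.finrank ℝ E) (c : ℝ≥0) :
    ∃ C : ℝ≥0, ∀ μ : Measure E, [SFinite μ] → μ univ ≤ 1 → ∀ (S : Set E), MeasurableSet S →
      ∀ A B : E → ℝ≥0∞,
      (∀ x ∈ S, A x ≤ c * ‖x‖ₑ ^ (-β)) → (∀ x, B x ≤ ∫⁻ t, ‖kernelRemainder K x t‖ₑ ∂μ) →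
        ∫⁻ x in S, max (A x) (B x) ^ (p - 1) * min (A x) (B x) ∂ν ≤ C := by
  set D : ℝ := (Module.finrank ℝ E : ℝ)
  set q := max 1 (p - 1)
  have hq1 : 1 ≤ q := le_max_left _ _
  have hqp : q < p := max_lt hp (by linarith)
  have hp0 : 0 < p := by linarith
  obtain ⟨C₁, hC₁⟩ := lintegral_enorm_kernelRemainder_le ν hK hKL hβ le_rfl (by nlinarith)
  obtain ⟨C₂, hC₂⟩ := lintegral_enorm_kernelRemainder_le ν hK hKL hβ hq1 (by nlinarith)
  set M : ℝ≥0∞ := c ^ (p - q) * C₂ + c ^ (p - 1) * C₁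
  have hM : M ≠ ∞ := ENNReal.add_ne_top.2
    ⟨ENNReal.mul_ne_top (ENNReal.rpow_ne_top_of_nonneg (by linarith) (by simp)) (by simp),
      ENNReal.mul_ne_top (ENNReal.rpow_ne_top_of_nonneg (by linarith) (by simp)) (by simp)⟩
  refine ⟨M.toNNReal, fun μ _ hμ S hS A B hA hB => ?_⟩
  rw [ENNReal.coe_toNNReal hM]
  set B' : E → ℝ≥0∞ := fun x => ∫⁻ t, ‖kernelRemainder K x t‖ₑ ∂μ
  have hkm : Measurable (Function.uncurry fun x t => ‖kernelRemainder K x t‖ₑ) :=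
    (stronglyMeasurable_kernelRemainder (hK.stronglyMeasurable hKL hβ)).enorm
  have hB'm : Measurable B' := hkm.lintegral_prod_right'
  have hpt : ∀ x ∈ S, max (A x) (B x) ^ (p - 1) * min (A x) (B x) ≤
      c ^ (p - q) * (‖x‖ₑ ^ (-(D - β * q)) * B' x ^ q) +
      c ^ (p - 1) * (‖x‖ₑ ^ (-(D - β * 1)) * B' x ^ (1 : ℝ)) := by
    intro x hx
    have he : ∀ r : ℝ, (c * ‖x‖ₑ ^ (-β)) ^ (p - r) = c ^ (p - r) * ‖x‖ₑ ^ (-(D - β * r)) ∨ p < r := by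
      intro r
      rcases lt_or_ge p r with h | h
      · exact Or.inr h
      · left
        rw [ENNReal.mul_rpow_of_nonneg _ _ (by linarith), ← ENNReal.rpow_mul]
        congr 2
        rw [← hpβ]; ring
    calc _ ≤ A x ^ (p - q) * B x ^ q + A x ^ (p - 1) * B x := ENNReal.max_rpow_mul_min_le hp _ _
      _ ≤ (c * ‖x‖ₑ ^ (-β)) ^ (p - q) * B' x ^ q + (c * ‖x‖ₑ ^ (-β)) ^ (p - 1) * B' x := by
          gcongr
          · exact hA x hx
          · exact hB x
          · exact hA x hx
          · exact hB x
      _ = _ := by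
          rw [(he q).resolve_right (by linarith), (he 1).resolve_right (by linarith),
            ENNReal.rpow_one]
          ring
  calc _ ≤ ∫⁻ x in S, (c ^ (p - q) * (‖x‖ₑ ^ (-(D - β * q)) * B' x ^ q) +
      c ^ (p - 1) * (‖x‖ₑ ^ (-(D - β * 1)) * B' x ^ (1 : ℝ))) ∂ν := setLIntegral_mono' hS hpt
    _ ≤ ∫⁻ x, (c ^ (p - q) * (‖x‖ₑ ^ (-(D - β * q)) * B' x ^ q) +
      c ^ (p - 1) * (‖x‖ₑ ^ (-(D - β * 1)) * B' x ^ (1 : ℝ))) ∂ν := setLIntegral_le_lintegral _ _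
    _ = c ^ (p - q) * ∫⁻ x, ‖x‖ₑ ^ (-(D - β * q)) * B' x ^ q ∂ν +
      c ^ (p - 1) * ∫⁻ x, ‖x‖ₑ ^ (-(D - β * 1)) * B' x ^ (1 : ℝ) ∂ν := by
        rw [lintegral_add_left (by fun_prop), lintegral_const_mul _ (by fun_prop),
          lintegral_const_mul _ (by fun_prop)]
    _ ≤ c ^ (p - q) * (μ univ ^ q * C₂) + c ^ (p - 1) * (μ univ ^ (1 : ℝ) * C₁) := by
        gcongr
        · exact lintegral_mul_rpow_lintegral_le ν μ hq1 hkm (by fun_prop)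
            (Filter.Eventually.of_forall hC₂)
        · exact lintegral_mul_rpow_lintegral_le ν μ le_rfl hkm (by fun_prop)
            (Filter.Eventually.of_forall hC₁)
    _ ≤ c ^ (p - q) * (1 * C₂) + c ^ (p - 1) * (1 * C₁) := by
        gcongr
        · exact (ENNReal.rpow_le_rpow hμ (by linarith)).trans_eq (ENNReal.one_rpow _)
        · exact (ENNReal.rpow_le_rpow hμ (by linarith)).trans_eq (ENNReal.one_rpow _)
    _ = M := by rw [one_mul, one_mul]

end Remainder

/-! ### The main term and the cancellation conditions -/

section MainTerm

variable {E F : Type*} [NormedAddCommGroup E] [InnerProductSpace ℝ E] [Nontrivial E]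
  [MeasurableSpace E] [BorelSpace E] [FiniteDimensional ℝ E]
  [NormedAddCommGroup F] [NormedSpace ℝ F] {K : E → F} {Φ : F → ℝ} {β p : ℝ}

/-- Homogeneity is only positive, so negative a needs the second condition separately. -/
theorem integral_comp_smul_eq_zero {X : Type*} [MeasurableSpace X] {σ : Measure X} {k : X → F}
    (hΦ : PosHomogeneous p Φ) (hp : p ≠ 0) (h1 : ∫ ζ, Φ (k ζ) ∂σ = 0)
    (h2 : ∫ ζ, Φ (-k ζ) ∂σ = 0) (a : ℝ) : ∫ ζ, Φ (a • k ζ) ∂σ = 0 := by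
  rcases lt_trichotomy a 0 with ha | rfl | ha
  · have : ∀ ζ, Φ (a • k ζ) = (-a) ^ p * Φ (-k ζ) := fun ζ => by
      rw [← smul_eq_mul, ← hΦ _ _ (neg_pos.2 ha), smul_neg, neg_smul, neg_neg]
    simp_rw [this]
    rw [integral_const_mul, h2, mul_zero]
  · simp [hΦ.map_zero hp]
  · have : ∀ ζ, Φ (a • k ζ) = a ^ p * Φ (k ζ) := fun ζ => by
      rw [← smul_eq_mul, ← hΦ _ _ ha]
    simp_rw [this]
    rw [integral_const_mul, h1, mul_zero]

/-- The degree -pβ is minus the dimension, so this bound is not integrable at either end;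
cancellation has to replace absolute integrability for the main term. -/
theorem exists_enorm_comp_smul_le (hK : PosHomogeneous (-β) K) (hKL : LipschitzOnSphere K)
    (hβ : 0 < β) (hΦ : PosHomogeneous p Φ) (hΦL : LipschitzOnSphere Φ) (hp : 0 < p)
    (hpβ : p * β = Module.finrank ℝ E) :
    ∃ C : ℝ≥0, ∀ (a : ℝ) (x : E), |a| ≤ 1 →
      ‖Φ (a • K x)‖ₑ ≤ C * ‖x‖ₑ ^ (-(Module.finrank ℝ E : ℝ)) := by
  obtain ⟨c, hc⟩ := hK.exists_enorm_le hKL (by linarith)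
  obtain ⟨c', hc'⟩ := hΦ.exists_enorm_le hΦL hp.ne'
  refine ⟨c' * c ^ p, fun a x ha => ?_⟩
  have ha' : ‖a‖ₑ ≤ 1 := by
    rw [← ofReal_norm, ENNReal.ofReal_le_one]; exact ha
  calc ‖Φ (a • K x)‖ₑ ≤ c' * ‖a • K x‖ₑ ^ p := hc' _
    _ ≤ c' * (c * ‖x‖ₑ ^ (-β)) ^ p := by
        gcongr
        rw [enorm_smul]
        calc _ ≤ 1 * (c * ‖x‖ₑ ^ (-β)) := by gcongr; exact hc x
          _ = _ := one_mul _
    _ = _ := by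
        rw [ENNReal.mul_rpow_of_nonneg _ _ hp.le, ← ENNReal.rpow_mul, ← hpβ, ENNReal.coe_mul,
          ENNReal.coe_rpow_of_nonneg _ hp.le, mul_assoc]
        congr 3
        ring

theorem stronglyMeasurable_comp_radial_smul (hK : PosHomogeneous (-β) K)
    (hKL : LipschitzOnSphere K) (hβ : 0 < β) (hΦ : PosHomogeneous p Φ)
    (hΦL : LipschitzOnSphere Φ) (hp : 1 ≤ p) {M : ℝ → ℝ} (hM : Measurable M) :
    StronglyMeasurable fun x : E => Φ (M ‖x‖ • K x) :=
  (hΦ.continuous hΦL hp).comp_stronglyMeasurable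
    ((hM.comp measurable_norm).stronglyMeasurable.smul (hK.stronglyMeasurable hKL hβ))

theorem integrableOn_comp_radial_smul (hK : PosHomogeneous (-β) K)
    (hKL : LipschitzOnSphere K) (hβ : 0 < β) (hΦ : PosHomogeneous p Φ)
    (hΦL : LipschitzOnSphere Φ) (hp : 1 ≤ p) (hpβ : p * β = Module.finrank ℝ E)
    {M : ℝ → ℝ} (hM : Measurable M) (hM1 : ∀ s, |M s| ≤ 1) {r R : ℝ} (hr : 0 < r)
    {S : Set E} (hS : ∀ x ∈ S, r ≤ ‖x‖ ∧ ‖x‖ < R) :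
    IntegrableOn (fun x : E => Φ (M ‖x‖ • K x)) S := by
  obtain ⟨C, hC⟩ := exists_enorm_comp_smul_le hK hKL hβ hΦ hΦL (by linarith) hpβ
  set T : Set E := {x | r ≤ ‖x‖ ∧ ‖x‖ < R}
  have hT : MeasurableSet T := (measurableSet_le measurable_const measurable_norm).inter
      (measurableSet_lt measurable_norm measurable_const)
  refine IntegrableOn.mono_set (t := T) ?_ hS
  refine ⟨(stronglyMeasurable_comp_radial_smul hK hKL hβ hΦ hΦL hp hM).aestronglyMeasurable, ?_⟩
  rw [hasFiniteIntegral_iff_enorm]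
  calc ∫⁻ x in T, ‖Φ (M ‖x‖ • K x)‖ₑ
      ≤ ∫⁻ x in T, C * ENNReal.ofReal r ^ (-(Module.finrank ℝ E : ℝ)) := by
        refine setLIntegral_mono' hT fun x hx => (hC _ _ (hM1 _)).trans ?_
        refine mul_le_mul_right (ENNReal.rpow_neg_le_rpow_neg ?_ (Nat.cast_nonneg _)) _
        rw [← ofReal_norm]
        exact ENNReal.ofReal_le_ofReal hx.1
    _ = C * ENNReal.ofReal r ^ (-(Module.finrank ℝ E : ℝ)) * volume T := by simp
    _ < ∞ := by
        refine ENNReal.mul_lt_top (ENNReal.mul_lt_top (by simp) ?_)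
          (lt_of_le_of_lt (measure_mono fun x hx => ?_) (measure_ball_lt_top (x := (0 : E)) (r := R)))
        · rw [ENNReal.ofReal_rpow_of_pos hr]; simp
        · simpa using hx.2

/-- The half-space has its boundary at height c because the origin will be an arbitrary centre. On
spheres of radius below |c| it contains everything or nothing, which uses cancellation on the full
sphere; on larger spheres it is compared with a half-sphere. The discrepancy is a slab and an
annulus at the truncation radius, both of bounded measure for the density ‖x‖^(-D) uniformly in c
and R. -/
theorem integral_main_term_le (hK : PosHomogeneous (-β) K) (hKL : LipschitzOnSphere K)
    (hβ : 0 < β) (hΦ : PosHomogeneous p Φ) (hΦL : LipschitzOnSphere Φ) (hp : 1 ≤ p)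
    (hpβ : p * β = Module.finrank ℝ E) {ξ : E} (hξ : ‖ξ‖ = 1)
    (h1 : ∫ ζ : sphere (0 : E) 1, Φ (K ζ) ∂(volume : Measure E).toSphere = 0)
    (h2 : ∫ ζ : sphere (0 : E) 1, Φ (-K ζ) ∂(volume : Measure E).toSphere = 0)
    (h3 : ∫ ζ : sphere (0 : E) 1 in {ζ | 0 < ⟪(ζ : E), ξ⟫}, Φ (K ζ)
      ∂(volume : Measure E).toSphere = 0)
    (h4 : ∫ ζ : sphere (0 : E) 1 in {ζ | 0 < ⟪(ζ : E), ξ⟫}, Φ (-K ζ)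
      ∂(volume : Measure E).toSphere = 0) :
    ∃ C : ℝ≥0, ∀ M : ℝ → ℝ, Measurable M → (∀ s, |M s| ≤ 1) → ∀ (c : ℝ) (y : E) (R : ℝ), 0 < R →
      ‖y‖ ≤ R / 2 →
      ‖∫ x in ({x | c < ⟪x, ξ⟫} ∩ ball y R) ∩ (ball 0 4)ᶜ, Φ (M ‖x‖ • K x)‖ₑ ≤ C := by
  obtain ⟨C, hC⟩ := exists_enorm_comp_smul_le hK hKL hβ hΦ hΦL (by linarith) hpβ
  obtain ⟨C₁, hC₁⟩ := setLIntegral_annulus_rpow_le (volume : Measure E) (Module.finrank ℝ E)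
    (Nat.cast_nonneg _)
  obtain ⟨C₂, hC₂⟩ := setLIntegral_slab_le hξ
  refine ⟨C * (C₁ + C₂), fun M hM hM1 c y R hR hy => ?_⟩
  set g : E → ℝ := fun x => Φ (M ‖x‖ • K x)
  have hinner : Measurable fun x : E => ⟪x, ξ⟫ := by fun_prop
  set S : Set E := ({x | c < ⟪x, ξ⟫} ∩ ball y R) ∩ (ball 0 4)ᶜ
  have hSm : MeasurableSet S := ((measurableSet_lt measurable_const hinner).inter
    measurableSet_ball).inter measurableSet_ball.compl
  -- A model of `S` made of whole spheres and half-spheres; the integral of `g` over each of them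
  -- vanishes.
  set S' : Set E := {x | (4 ≤ ‖x‖ ∧ ‖x‖ < R / 2) ∧
    ((‖x‖ < |c| ∧ c < 0) ∨ (|c| ≤ ‖x‖ ∧ 0 < ⟪x, ξ⟫))}
  have hS'm : MeasurableSet S' := by
    refine ((measurableSet_le measurable_const measurable_norm).inter
      (measurableSet_lt measurable_norm measurable_const)).inter
      (((measurableSet_lt measurable_norm measurable_const).inter (MeasurableSet.const _)).union
      ((measurableSet_le measurable_const measurable_norm).inter
        (measurableSet_lt measurable_const hinner)))
  have hball : ∀ x ∈ ball y R, ‖x‖ < 4 * (R / 2) := fun x hx => by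
    have h5 : ‖x - y‖ < R := by simpa [dist_eq_norm] using hx
    have h6 := norm_sub_norm_le x y
    linarith
  have hgS : IntegrableOn g S := integrableOn_comp_radial_smul hK hKL hβ hΦ hΦL hp hpβ hM hM1
    (r := 4) (R := 4 * (R / 2)) (by norm_num) fun x hx => ⟨by simpa using hx.2, hball x hx.1.2⟩
  have hgS' : IntegrableOn g S' := integrableOn_comp_radial_smul hK hKL hβ hΦ hΦL hp hpβ hM hM1
    (r := 4) (R := R / 2) (by norm_num) fun x hx => hx.1
  have hzero : ∫ x in S', g x = 0 := by
    rw [← integral_indicator hS'm, integral_polar _ (hgS'.integrable_indicator hS'm)]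
    refine setIntegral_eq_zero_of_forall_eq_zero fun s hs => ?_
    have hs0 : 0 < s := hs
    rw [mul_eq_zero]
    right
    have hn : ∀ ζ : sphere (0 : E) 1, ‖s • (ζ : E)‖ = s := fun ζ => by
      simp [norm_smul, abs_of_pos hs0]
    have hgs : ∀ ζ : sphere (0 : E) 1, g (s • (ζ : E)) = Φ ((M s * s ^ (-β)) • K ζ) := fun ζ => by
      simp only [g]
      rw [hn, hK _ _ hs0, smul_smul]
    have hmem : ∀ ζ : sphere (0 : E) 1, s • (ζ : E) ∈ S' ↔ (4 ≤ s ∧ s < R / 2) ∧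
        ((s < |c| ∧ c < 0) ∨ (|c| ≤ s ∧ 0 < ⟪(ζ : E), ξ⟫)) := fun ζ => by
      simp only [S', mem_ofPred_eq, hn, inner_smul_left, conj_trivial, mul_pos_iff_of_pos_left hs0]
    have hp0 : p ≠ 0 := by linarith
    by_cases hA : 4 ≤ s ∧ s < R / 2
    · rcases lt_or_ge s |c| with hsc | hsc
      · by_cases hc : c < 0
        · rw [← integral_comp_smul_eq_zero (k := fun ζ : sphere (0 : E) 1 => K ζ) hΦ hp0 h1 h2
            (M s * s ^ (-β))]
          refine integral_congr_ae (Filter.Eventually.of_forall fun ζ => ?_)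
          simp only
          rw [indicator_of_mem ((hmem ζ).2 ⟨hA, Or.inl ⟨hsc, hc⟩⟩), hgs]
        · refine integral_eq_zero_of_ae (Filter.Eventually.of_forall fun ζ => ?_)
          refine indicator_of_notMem (fun h => ?_) _
          rcases ((hmem ζ).1 h).2 with h | h
          · exact hc h.2
          · linarith [h.1]
      · have hms : MeasurableSet {ζ : sphere (0 : E) 1 | 0 < ⟪(ζ : E), ξ⟫} :=
          measurableSet_lt measurable_const (hinner.comp measurable_subtype_coe)
        rw [← integral_comp_smul_eq_zero (k := fun ζ : sphere (0 : E) 1 => K ζ) hΦ hp0 h3 h4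
            (M s * s ^ (-β)), ← integral_indicator hms]
        refine integral_congr_ae (Filter.Eventually.of_forall fun ζ => ?_)
        simp only
        by_cases hζ : 0 < ⟪(ζ : E), ξ⟫
        · rw [indicator_of_mem ((hmem ζ).2 ⟨hA, Or.inr ⟨hsc, hζ⟩⟩), hgs,
            indicator_of_mem (show ζ ∈ {ζ : sphere (0 : E) 1 | 0 < ⟪(ζ : E), ξ⟫} from hζ)]
        · rw [indicator_of_notMem (fun h => ?_),
            indicator_of_notMem (show ζ ∉ {ζ : sphere (0 : E) 1 | 0 < ⟪(ζ : E), ξ⟫} from hζ)]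
          rcases ((hmem ζ).1 h).2 with h | h
          · linarith [h.1]
          · exact hζ h.2
    · refine integral_eq_zero_of_ae (Filter.Eventually.of_forall fun ζ => ?_)
      exact indicator_of_notMem (fun h => hA ((hmem ζ).1 h).1) _
  -- `S` and `S'` agree off `U₁ ∪ U₂`: since ‖y‖ ≤ R / 2, the ball about y contains the one of
  -- radius R / 2 about the origin and lies in the one of radius 2R.
  set U₁ : Set E := {x | R / 2 ≤ ‖x‖ ∧ ‖x‖ < 4 * (R / 2)}
  set U₂ : Set E := {x | |c| ≤ ‖x‖ ∧ |⟪x, ξ⟫| ≤ |c|}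
  have hU₁ : MeasurableSet U₁ := (measurableSet_le measurable_const measurable_norm).inter
      (measurableSet_lt measurable_norm measurable_const)
  have hU₂ : MeasurableSet U₂ := (measurableSet_le measurable_const measurable_norm).inter
      (measurableSet_le (by fun_prop : Measurable fun x : E => |⟪x, ξ⟫|) measurable_const)
  have hdiff : ∀ x, ‖S.indicator g x - S'.indicator g x‖ₑ ≤
      (U₁ ∪ U₂).indicator (fun x => C * ‖x‖ₑ ^ (-(Module.finrank ℝ E : ℝ))) x := by
    intro x
    by_cases hU : x ∈ U₁ ∪ U₂
    · rw [indicator_of_mem hU]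
      refine le_trans ?_ (hC _ x (hM1 ‖x‖))
      by_cases ha : x ∈ S <;> by_cases hb : x ∈ S' <;> simp [ha, hb, g]
    · rw [indicator_of_notMem hU]
      have hiff : x ∈ S ↔ x ∈ S' := by
        simp only [U₁, U₂, mem_union, mem_ofPred_eq, not_or, not_and, not_lt, not_le] at hU
        constructor
        · intro hx
          have hx4 : 4 ≤ ‖x‖ := by simpa using hx.2
          have hxR : ‖x‖ < R / 2 := by
            by_contra h
            exact absurd (hU.1 (not_lt.1 h)) (not_le.2 (hball x hx.1.2))
          have hxc : c < ⟪x, ξ⟫ := hx.1.1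
          refine ⟨⟨hx4, hxR⟩, ?_⟩
          rcases lt_or_ge ‖x‖ |c| with h | h
          · left
            refine ⟨h, ?_⟩
            by_contra h0
            have h5 := real_inner_le_norm x ξ
            rw [hξ, mul_one] at h5
            rw [abs_of_nonneg (not_lt.1 h0)] at h
            linarith
          · right
            refine ⟨h, ?_⟩
            by_contra h0
            have h6 := hU.2 h
            rw [abs_of_nonpos (not_lt.1 h0)] at h6
            linarith [neg_le_abs c]
        · rintro ⟨⟨hx4, hxR⟩, h⟩
          refine ⟨⟨?_, ?_⟩, by simpa using hx4⟩
          · rcases h with ⟨h, h0⟩ | ⟨h, h0⟩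
            · have h5 := abs_real_inner_le_norm x ξ
              rw [hξ, mul_one] at h5
              rw [abs_of_neg h0] at h
              show c < ⟪x, ξ⟫
              linarith [neg_abs_le ⟪x, ξ⟫]
            · have h6 := hU.2 h
              rw [abs_of_pos h0] at h6
              show c < ⟪x, ξ⟫
              linarith [le_abs_self c]
          · rw [mem_ball, dist_eq_norm]
            linarith [norm_sub_le x y]
      by_cases ha : x ∈ S
      · simp [ha, hiff.1 ha]
      · simp [ha, show x ∉ S' from fun h => ha (hiff.2 h)]
  calc ‖∫ x in S, g x‖ₑ = ‖∫ x, (S.indicator g x - S'.indicator g x)‖ₑ := by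
        rw [integral_sub (hgS.integrable_indicator hSm) (hgS'.integrable_indicator hS'm),
          integral_indicator hSm, integral_indicator hS'm, hzero, sub_zero]
    _ ≤ ∫⁻ x, ‖S.indicator g x - S'.indicator g x‖ₑ := enorm_integral_le_lintegral_enorm _
    _ ≤ ∫⁻ x in U₁ ∪ U₂, C * ‖x‖ₑ ^ (-(Module.finrank ℝ E : ℝ)) := by
        rw [← lintegral_indicator (hU₁.union hU₂)]
        exact lintegral_mono hdiff
    _ = C * ∫⁻ x in U₁ ∪ U₂, ‖x‖ₑ ^ (-(Module.finrank ℝ E : ℝ)) :=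
        lintegral_const_mul _ (by fun_prop)
    _ ≤ C * ((∫⁻ x in U₁, ‖x‖ₑ ^ (-(Module.finrank ℝ E : ℝ))) +
          ∫⁻ x in U₂, ‖x‖ₑ ^ (-(Module.finrank ℝ E : ℝ))) := by
        exact mul_le_mul_right (lintegral_union_le _ _ _) _
    _ ≤ C * (C₁ + C₂) := by
        exact mul_le_mul_right (add_le_add ((hC₁ (R / 2) (by positivity)).trans_eq (by simp))
          (hC₂ |c| (abs_nonneg c))) _
    _ = _ := by push_cast; rfl

end MainTerm

/-! ### Convolutions, the enclosed mass and the remainder -/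

section Conv

variable {E F : Type*} [NormedAddCommGroup E] [InnerProductSpace ℝ E] [Nontrivial E]
  [MeasurableSpace E] [BorelSpace E] [FiniteDimensional ℝ E]
  [NormedAddCommGroup F] [NormedSpace ℝ F] [CompleteSpace F] {K : E → F} {Φ : F → ℝ} {β p : ℝ}

/-- The convolution of a vector valued kernel with a scalar function. -/
noncomputable def smulConv (K : E → F) (f : E → ℝ) (x : E) : F := ∫ t, f t • K (x - t)

/-- The integral of `f` over the closed ball of radius `s` about the origin. -/
noncomputable def radialMass (f : E → ℝ) (s : ℝ) : ℝ := ∫ t in closedBall 0 s, f t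

/-- The difference of `smulConv K f` and the kernel `K` times the mass of `f` inside the sphere
through the given point. -/
noncomputable def remainderConv (K : E → F) (f : E → ℝ) (x : E) : F :=
  smulConv K f x - radialMass f ‖x‖ • K x

/-- The measure with density `|f|`. -/
noncomputable def absMeasure (f : E → ℝ) : Measure E := volume.withDensity fun t => ‖f t‖ₑ

theorem absMeasure_univ (f : E → ℝ) : absMeasure f univ = ∫⁻ t, ‖f t‖ₑ := by
  simp [absMeasure]

instance (f : E → ℝ) : SFinite (absMeasure f) := by
  unfold absMeasure; infer_instance

theorem lintegral_absMeasure {f : E → ℝ} (hf : AEStronglyMeasurable f) {k : E → ℝ≥0∞}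
    (hk : Measurable k) : ∫⁻ t, k t ∂(absMeasure f) = ∫⁻ t, ‖f t‖ₑ * k t := by
  rw [absMeasure, lintegral_withDensity_eq_lintegral_mul₀ hf.enorm hk.aemeasurable]
  rfl

theorem setLIntegral_absMeasure {f : E → ℝ} (hf : AEStronglyMeasurable f) {k : E → ℝ≥0∞}
    (hk : Measurable k) {s : Set E} (hs : MeasurableSet s) :
    ∫⁻ t in s, k t ∂(absMeasure f) = ∫⁻ t, ‖s.indicator f t‖ₑ * k t := by
  rw [← lintegral_indicator hs, lintegral_absMeasure hf (hk.indicator hs)]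
  congr 1
  ext t
  by_cases ht : t ∈ s <;> simp [ht]

/-- Within distance 1 of x the density is at most M and the kernel is integrable; beyond it the
kernel is at most 1. -/
theorem lintegral_absMeasure_enorm_sub_rpow_le {κ : ℝ} (hκ : 0 ≤ κ)
    (hκD : κ < Module.finrank ℝ E) :
    ∃ C : ℝ≥0, ∀ (f : E → ℝ) (M : ℝ≥0), AEStronglyMeasurable f → (∀ x, ‖f x‖ₑ ≤ M) →
      ∀ x, ∫⁻ t, ‖x - t‖ₑ ^ (-κ) ∂(absMeasure f) ≤ C * M + ∫⁻ t, ‖f t‖ₑ := by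
  obtain ⟨C, hC⟩ := setLIntegral_ball_rpow_le (volume : Measure E) hκD
  refine ⟨C, fun f M hf hM x => ?_⟩
  rw [lintegral_absMeasure hf (by fun_prop)]
  have hpt : ∀ t, ‖f t‖ₑ * ‖x - t‖ₑ ^ (-κ) ≤
      M * (ball (0 : E) 1).indicator (fun y => ‖y‖ₑ ^ (-κ)) (x - t) + ‖f t‖ₑ := by
    intro t
    by_cases h : x - t ∈ ball (0 : E) 1
    · rw [indicator_of_mem h]
      exact (mul_le_mul' (hM t) le_rfl).trans le_self_add
    · rw [indicator_of_notMem h, mul_zero, zero_add]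
      refine mul_le_of_le_one_right zero_le ?_
      have h1 : 1 ≤ ‖x - t‖ₑ := by
        rw [← ofReal_norm, ENNReal.one_le_ofReal]
        simpa using h
      rw [ENNReal.rpow_neg, ENNReal.inv_le_one]
      exact (ENNReal.one_rpow κ).symm.trans_le (ENNReal.rpow_le_rpow h1 hκ)
  calc _ ≤ ∫⁻ t, (M * (ball (0 : E) 1).indicator (fun y => ‖y‖ₑ ^ (-κ)) (x - t) + ‖f t‖ₑ) :=
        lintegral_mono hpt
    _ = M * (∫⁻ t, (ball (0 : E) 1).indicator (fun y => ‖y‖ₑ ^ (-κ)) (x - t)) + ∫⁻ t, ‖f t‖ₑ := by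
        have hm : Measurable fun t => (ball (0 : E) 1).indicator (fun y => ‖y‖ₑ ^ (-κ)) (x - t) :=
          ((by fun_prop : Measurable fun y : E => ‖y‖ₑ ^ (-κ)).indicator measurableSet_ball).comp
            (measurable_const.sub measurable_id)
        rw [lintegral_add_left (hm.const_mul _), lintegral_const_mul _ hm]
    _ ≤ _ := by
        rw [lintegral_sub_left_eq_self (μ := volume)
          ((ball (0 : E) 1).indicator (fun y => ‖y‖ₑ ^ (-κ))) x, lintegral_indicator measurableSet_ball,
          mul_comm (C : ℝ≥0∞)]
        gcongr
        simpa using hC 1 one_pos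

theorem enorm_smulConv_le {c : ℝ≥0} (hc : ∀ x, ‖K x‖ₑ ≤ c * ‖x‖ₑ ^ (-β)) {f : E → ℝ}
    (hf : AEStronglyMeasurable f) (x : E) :
    ‖smulConv K f x‖ₑ ≤ c * ∫⁻ t, ‖x - t‖ₑ ^ (-β) ∂(absMeasure f) := by
  rw [lintegral_absMeasure hf (by fun_prop), ← lintegral_const_mul' _ _ (by simp)]
  refine (enorm_integral_le_lintegral_enorm _).trans (lintegral_mono fun t => ?_)
  rw [enorm_smul, mul_left_comm]
  gcongr
  exact hc _

theorem integrable_smul_kernel (hK : PosHomogeneous (-β) K) (hKL : LipschitzOnSphere K)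
    (hβ : 0 < β) (hβD : β < Module.finrank ℝ E) {f : E → ℝ} (hf : Integrable f) {M : ℝ≥0}
    (hM : ∀ x, ‖f x‖ₑ ≤ M) (x : E) : Integrable fun t => f t • K (x - t) := by
  obtain ⟨c, hc⟩ := hK.exists_enorm_le hKL (by linarith)
  obtain ⟨C, hC⟩ := lintegral_absMeasure_enorm_sub_rpow_le (E := E) hβ.le hβD
  refine ⟨hf.1.smul ((hK.stronglyMeasurable hKL hβ).comp_measurable
    (measurable_const.sub measurable_id)).aestronglyMeasurable, ?_⟩
  rw [hasFiniteIntegral_iff_enorm]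
  calc ∫⁻ t, ‖f t • K (x - t)‖ₑ ≤ ∫⁻ t, c * (‖f t‖ₑ * ‖x - t‖ₑ ^ (-β)) := by
        refine lintegral_mono fun t => ?_
        rw [enorm_smul, mul_left_comm]
        gcongr
        exact hc _
    _ = c * ∫⁻ t, ‖x - t‖ₑ ^ (-β) ∂(absMeasure f) := by
        rw [lintegral_const_mul' _ _ (by simp), lintegral_absMeasure hf.1 (by fun_prop)]
    _ ≤ c * (C * M + ∫⁻ t, ‖f t‖ₑ) := by gcongr; exact hC f M hf.1 hM x
    _ < ∞ := ENNReal.mul_lt_top (by simp) (ENNReal.add_lt_top.2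
        ⟨ENNReal.mul_lt_top (by simp) (by simp), hf.2⟩)

theorem aestronglyMeasurable_smulConv (hK : StronglyMeasurable K) {f : E → ℝ}
    (hf : AEStronglyMeasurable f) : AEStronglyMeasurable (smulConv K f) := by
  have h1 : AEStronglyMeasurable (fun z : E × E => f z.2 • K (z.1 - z.2))
      ((volume : Measure E).prod volume) :=
    hf.comp_snd.smul (hK.comp_measurable (measurable_fst.sub measurable_snd)).aestronglyMeasurable
  exact h1.integral_prod_right'

theorem measurable_radialMass {f : E → ℝ} (hf : AEStronglyMeasurable f) :
    Measurable (radialMass f) := by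
  have h1 : radialMass f = fun s => ∫ t, (closedBall (0 : E) s).indicator (hf.mk f) t := by
    ext s
    rw [radialMass, integral_indicator measurableSet_closedBall]
    exact integral_congr_ae (ae_restrict_of_ae hf.ae_eq_mk)
  rw [h1]
  have h2 : StronglyMeasurable ({z : ℝ × E | ‖z.2‖ ≤ z.1}.indicator fun z => hf.mk f z.2) :=
    (hf.stronglyMeasurable_mk.comp_measurable measurable_snd).indicator
      (measurableSet_le (measurable_norm.comp measurable_snd) measurable_fst)
  have h3 : StronglyMeasurable fun s : ℝ => ∫ t, (closedBall (0 : E) s).indicator (hf.mk f) t := by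
    have := h2.integral_prod_right' (ν := (volume : Measure E))
    convert this using 1
    ext s
    refine integral_congr_ae (Filter.Eventually.of_forall fun t => ?_)
    simp only
    by_cases h : ‖t‖ ≤ s
    · rw [indicator_of_mem (by simpa using h), indicator_of_mem (by simpa using h)]
    · rw [indicator_of_notMem (by simpa using h), indicator_of_notMem (by simpa using h)]
  exact h3.measurable

theorem enorm_radialMass_le (f : E → ℝ) (s : ℝ) : ‖radialMass f s‖ₑ ≤ ∫⁻ t, ‖f t‖ₑ :=
  (enorm_integral_le_lintegral_enorm _).trans (setLIntegral_le_lintegral _ _)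

theorem remainderConv_eq_integral (hK : PosHomogeneous (-β) K) (hKL : LipschitzOnSphere K)
    (hβ : 0 < β) (hβD : β < Module.finrank ℝ E) {f : E → ℝ} (hf : Integrable f) {M : ℝ≥0}
    (hM : ∀ x, ‖f x‖ₑ ≤ M) (x : E) :
    remainderConv K f x = ∫ t, f t • kernelRemainder K x t := by
  have h1 : ∀ t, f t • (closedBall (0 : E) ‖x‖).indicator (fun _ => K x) t =
      (closedBall (0 : E) ‖x‖).indicator f t • K x := fun t => by
    by_cases h : t ∈ closedBall (0 : E) ‖x‖
    · rw [indicator_of_mem h, indicator_of_mem h]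
    · rw [indicator_of_notMem h, indicator_of_notMem h, smul_zero, zero_smul]
  simp_rw [kernelRemainder, smul_sub, h1]
  rw [integral_sub (integrable_smul_kernel hK hKL hβ hβD hf hM x)
    ((hf.indicator measurableSet_closedBall).smul_const _), integral_smul_const,
    integral_indicator measurableSet_closedBall]
  rfl

theorem enorm_remainderConv_le (hK : PosHomogeneous (-β) K) (hKL : LipschitzOnSphere K)
    (hβ : 0 < β) (hβD : β < Module.finrank ℝ E) {f : E → ℝ} (hf : Integrable f) {M : ℝ≥0}
    (hM : ∀ x, ‖f x‖ₑ ≤ M) (x : E) :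
    ‖remainderConv K f x‖ₑ ≤ ∫⁻ t, ‖kernelRemainder K x t‖ₑ ∂(absMeasure f) := by
  have hm : Measurable fun t => ‖kernelRemainder K x t‖ₑ :=
    (stronglyMeasurable_kernelRemainder (hK.stronglyMeasurable hKL hβ)).enorm.comp
      measurable_prodMk_left
  rw [remainderConv_eq_integral hK hKL hβ hβD hf hM, lintegral_absMeasure hf.1 hm]
  refine (enorm_integral_le_lintegral_enorm _).trans (lintegral_mono fun t => ?_)
  rw [enorm_smul]

/-- The far interaction estimate on the whole space: the enclosed mass is at most 1, so the main
term is bounded by ‖x‖^(-β), and the other summand is an average of point remainders. -/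
theorem lintegral_comp_smulConv_sub_sub_le (hK : PosHomogeneous (-β) K)
    (hKL : LipschitzOnSphere K) (hβ : 0 < β) (hΦ : PosHomogeneous p Φ)
    (hΦL : LipschitzOnSphere Φ) (hp : 1 < p) (hpβ : p * β = Module.finrank ℝ E) :
    ∃ C : ℝ≥0, ∀ (f : E → ℝ) (M : ℝ≥0), Integrable f → (∀ x, ‖f x‖ₑ ≤ M) → ∫⁻ x, ‖f x‖ₑ ≤ 1 →
      ∫⁻ x, ‖Φ (smulConv K f x) - Φ (radialMass f ‖x‖ • K x) - Φ (remainderConv K f x)‖ₑ ≤ C := by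
  have hβD : β < Module.finrank ℝ E := by rw [← hpβ]; nlinarith
  obtain ⟨c, hc⟩ := hK.exists_enorm_le hKL (by linarith)
  obtain ⟨C₁, hC₁⟩ := hΦ.exists_enorm_add_sub_sub_le hΦL hp.le
  obtain ⟨C₂, hC₂⟩ := lintegral_interaction_far_le (volume : Measure E) hK hKL hβ hp hpβ c
  refine ⟨C₁ * C₂, fun f M hf hM hf1 => ?_⟩
  have hu : ∀ x, smulConv K f x = radialMass f ‖x‖ • K x + remainderConv K f x := fun x => by
    rw [remainderConv]; abel
  have hA : ∀ x, ‖radialMass f ‖x‖ • K x‖ₑ ≤ c * ‖x‖ₑ ^ (-β) := fun x => by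
    rw [enorm_smul]
    calc _ ≤ 1 * (c * ‖x‖ₑ ^ (-β)) := by
          gcongr
          · exact (enorm_radialMass_le f _).trans hf1
          · exact hc x
      _ = _ := one_mul _
  have h := hC₂ (absMeasure f) (by rw [absMeasure_univ]; exact hf1) univ MeasurableSet.univ
    (fun x => ‖radialMass f ‖x‖ • K x‖ₑ) (fun x => ‖remainderConv K f x‖ₑ)
    (fun x _ => hA x) (fun x => enorm_remainderConv_le hK hKL hβ hβD hf hM x)
  rw [setLIntegral_univ] at h
  calc _ ≤ ∫⁻ x, C₁ * (max ‖radialMass f ‖x‖ • K x‖ₑ ‖remainderConv K f x‖ₑ ^ (p - 1) *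
          min ‖radialMass f ‖x‖ • K x‖ₑ ‖remainderConv K f x‖ₑ) := by
        refine lintegral_mono fun x => ?_
        rw [hu]
        exact hC₁ _ _
    _ = C₁ * ∫⁻ x, max ‖radialMass f ‖x‖ • K x‖ₑ ‖remainderConv K f x‖ₑ ^ (p - 1) *
          min ‖radialMass f ‖x‖ • K x‖ₑ ‖remainderConv K f x‖ₑ :=
        lintegral_const_mul' _ _ (by simp)
    _ ≤ C₁ * C₂ := by gcongr
    _ = _ := by push_cast; rfl

end Conv

theorem integral_sub_sub {X : Type*} [MeasurableSpace X] {μ : Measure X} {a b c : X → ℝ}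
    (ha : Integrable a μ) (hb : Integrable b μ) (hc : Integrable c μ) :
    ∫ x, (a x - b x - c x) ∂μ = (∫ x, a x ∂μ) - (∫ x, b x ∂μ) - ∫ x, c x ∂μ :=
  (integral_sub (ha.sub hb) hc).trans (congrArg₂ _ (integral_sub ha hb) rfl)

/-! ### Cutting a function along a sphere about the origin -/

section Split

variable {E F : Type*} [NormedAddCommGroup E] [InnerProductSpace ℝ E] [Nontrivial E]
  [MeasurableSpace E] [BorelSpace E] [FiniteDimensional ℝ E]
  [NormedAddCommGroup F] [NormedSpace ℝ F] [CompleteSpace F] {K : E → F} {Φ : F → ℝ} {β p : ℝ}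

/-- The part of the half-space `{x | c < ⟪x, ξ⟫}` in the ball of radius `R` about `y`. -/
def truncatedHalfSpace (ξ : E) (c : ℝ) (y : E) (R : ℝ) : Set E := {x | c < ⟪x, ξ⟫} ∩ ball y R

theorem measurableSet_truncatedHalfSpace (ξ : E) (c : ℝ) (y : E) (R : ℝ) :
    MeasurableSet (truncatedHalfSpace ξ c y R) :=
  (measurableSet_lt measurable_const (by fun_prop : Measurable fun x : E => ⟪x, ξ⟫)).inter
    measurableSet_ball

theorem volume_truncatedHalfSpace_lt_top (ξ : E) (c : ℝ) (y : E) (R : ℝ) :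
    volume (truncatedHalfSpace ξ c y R) < ∞ :=
  (measure_mono inter_subset_right).trans_lt measure_ball_lt_top

theorem aestronglyMeasurable_comp_smulConv (hK : PosHomogeneous (-β) K)
    (hKL : LipschitzOnSphere K) (hβ : 0 < β) (hΦ : PosHomogeneous p Φ)
    (hΦL : LipschitzOnSphere Φ) (hp : 1 ≤ p) {f : E → ℝ} (hf : AEStronglyMeasurable f) :
    AEStronglyMeasurable fun x => Φ (smulConv K f x) :=
  (hΦ.continuous hΦL hp).comp_aestronglyMeasurable
    (aestronglyMeasurable_smulConv (hK.stronglyMeasurable hKL hβ) hf)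

/-- `Φ (K * f)` is bounded, with a bound depending only on the `L^∞` and `L^1` norms of `f`. -/
theorem exists_enorm_comp_smulConv_le (hK : PosHomogeneous (-β) K)
    (hKL : LipschitzOnSphere K) (hβ : 0 < β) (hβD : β < Module.finrank ℝ E)
    (hΦ : PosHomogeneous p Φ) (hΦL : LipschitzOnSphere Φ) (hp : 1 ≤ p) {f : E → ℝ}
    (hf : Integrable f) {M : ℝ≥0} (hM : ∀ x, ‖f x‖ₑ ≤ M) :
    ∃ C : ℝ≥0, ∀ x, ‖Φ (smulConv K f x)‖ₑ ≤ C := by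
  obtain ⟨c, hc⟩ := hK.exists_enorm_le hKL (by linarith)
  obtain ⟨c', hc'⟩ := hΦ.exists_enorm_le hΦL (by linarith)
  obtain ⟨C, hC⟩ := lintegral_absMeasure_enorm_sub_rpow_le (E := E) hβ.le hβD
  have hfin : (c' : ℝ≥0∞) * (c * (C * M + ∫⁻ t, ‖f t‖ₑ)) ^ p ≠ ∞ := by
    refine ENNReal.mul_ne_top (by simp) (ENNReal.rpow_ne_top_of_nonneg (by linarith)
      (ENNReal.mul_ne_top (by simp) (ENNReal.add_ne_top.2 ⟨ENNReal.mul_ne_top (by simp) (by simp),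
        hf.2.ne⟩)))
  refine ⟨((c' : ℝ≥0∞) * (c * (C * M + ∫⁻ t, ‖f t‖ₑ)) ^ p).toNNReal, fun x => ?_⟩
  rw [ENNReal.coe_toNNReal hfin]
  refine (hc' _).trans ?_
  gcongr
  refine (enorm_smulConv_le hc hf.1 x).trans ?_
  gcongr
  exact hC f M hf.1 hM x

theorem integrableOn_comp_smulConv (hK : PosHomogeneous (-β) K)
    (hKL : LipschitzOnSphere K) (hβ : 0 < β) (hβD : β < Module.finrank ℝ E)
    (hΦ : PosHomogeneous p Φ) (hΦL : LipschitzOnSphere Φ) (hp : 1 ≤ p) {f : E → ℝ}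
    (hf : Integrable f) {M : ℝ≥0} (hM : ∀ x, ‖f x‖ₑ ≤ M) {S : Set E} (hS : volume S < ∞) :
    IntegrableOn (fun x => Φ (smulConv K f x)) S := by
  obtain ⟨C, hC⟩ := exists_enorm_comp_smulConv_le hK hKL hβ hβD hΦ hΦL hp hf hM
  refine ⟨(aestronglyMeasurable_comp_smulConv hK hKL hβ hΦ hΦL hp hf.1).restrict, ?_⟩
  rw [hasFiniteIntegral_iff_enorm]
  calc _ ≤ ∫⁻ x in S, C := lintegral_mono hC
    _ = C * volume S := by simp
    _ < ∞ := ENNReal.mul_lt_top (by simp) hS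

theorem aestronglyMeasurable_radialMass_smul (hK : StronglyMeasurable K) {f : E → ℝ}
    (hf : AEStronglyMeasurable f) : AEStronglyMeasurable fun x => radialMass f ‖x‖ • K x :=
  (((measurable_radialMass hf).comp measurable_norm).stronglyMeasurable.smul
    hK).aestronglyMeasurable

theorem aestronglyMeasurable_remainderConv (hK : StronglyMeasurable K) {f : E → ℝ}
    (hf : AEStronglyMeasurable f) : AEStronglyMeasurable (remainderConv K f) :=
  (aestronglyMeasurable_smulConv hK hf).sub (aestronglyMeasurable_radialMass_smul hK hf)

/-- Inside the ball of radius 4 the choice of ρ bounds the interaction. Outside it, each of Φ(K *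
f), Φ(K * f₁), Φ(K * f₂) is replaced by main term plus Φ of the remainder with a bounded L^1 error.
The remainders of f₁ and f₂ interact boundedly, as f₁ is supported well inside and its remainder is
bounded by ‖x‖^(-β). The three main terms are handled by cancellation. -/
theorem exists_radius_integral_comp_smulConv_sub_sub_le
    (hK : PosHomogeneous (-β) K) (hKL : LipschitzOnSphere K)
    (hβ : 0 < β) (hΦ : PosHomogeneous p Φ) (hΦL : LipschitzOnSphere Φ) (hp : 1 < p)
    (hpβ : p * β = Module.finrank ℝ E) {ξ : E} (hξ : ‖ξ‖ = 1)
    (h1 : ∫ ζ : sphere (0 : E) 1, Φ (K ζ) ∂(volume : Measure E).toSphere = 0)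
    (h2 : ∫ ζ : sphere (0 : E) 1, Φ (-K ζ) ∂(volume : Measure E).toSphere = 0)
    (h3 : ∫ ζ : sphere (0 : E) 1 in {ζ | 0 < ⟪(ζ : E), ξ⟫}, Φ (K ζ)
      ∂(volume : Measure E).toSphere = 0)
    (h4 : ∫ ζ : sphere (0 : E) 1 in {ζ | 0 < ⟪(ζ : E), ξ⟫}, Φ (-K ζ)
      ∂(volume : Measure E).toSphere = 0) :
    ∃ C : ℝ≥0, ∀ (f : E → ℝ) (M : ℝ≥0), Integrable f → (∀ x, ‖f x‖ₑ ≤ M) → ∫⁻ x, ‖f x‖ₑ ≤ 1 →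
      ∃ ρ ∈ Icc (1 : ℝ) 2, ∀ (c : ℝ) (y : E) (R : ℝ), 0 < R → ‖y‖ ≤ R / 2 →
        ‖(∫ x in truncatedHalfSpace ξ c y R, Φ (smulConv K f x)) -
          (∫ x in truncatedHalfSpace ξ c y R, Φ (smulConv K ((closedBall 0 ρ).indicator f) x)) -
          ∫ x in truncatedHalfSpace ξ c y R, Φ (smulConv K ((closedBall 0 ρ)ᶜ.indicator f) x)‖ₑ
          ≤ C := by
  have hβD : β < Module.finrank ℝ E := by rw [← hpβ]; nlinarith
  obtain ⟨c, hc⟩ := hK.exists_enorm_le hKL (by linarith)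
  obtain ⟨C₁, hC₁⟩ := hΦ.exists_enorm_add_sub_sub_le hΦL hp.le
  obtain ⟨C₂, hC₂⟩ := setLIntegral_interaction_near_le (volume : Measure E) hβ hp hpβ c
  obtain ⟨C₃, hC₃⟩ := lintegral_interaction_far_le (volume : Measure E) hK hKL hβ hp hpβ
    (c * ((2 : ℝ≥0) ^ β + 1))
  obtain ⟨C₄, hC₄⟩ := integral_main_term_le hK hKL hβ hΦ hΦL hp.le hpβ hξ h1 h2 h3 h4
  obtain ⟨C₅, hC₅⟩ := lintegral_comp_smulConv_sub_sub_le hK hKL hβ hΦ hΦL hp hpβ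
  refine ⟨C₁ * C₂ + (C₅ + C₅ + C₅ + C₁ * C₃) + (C₄ + C₄ + C₄), fun f M hf hM hf1 => ?_⟩
  obtain ⟨ρ, hρ, hnear⟩ := hC₂ (absMeasure f) (by rw [absMeasure_univ]; exact hf1)
  refine ⟨ρ, hρ, fun b y R hR hy => ?_⟩
  set f₁ : E → ℝ := (closedBall 0 ρ).indicator f
  set f₂ : E → ℝ := (closedBall 0 ρ)ᶜ.indicator f
  have hf₁ : Integrable f₁ := hf.indicator measurableSet_closedBall
  have hf₂ : Integrable f₂ := hf.indicator measurableSet_closedBall.compl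
  have hle₁ : ∀ x, ‖f₁ x‖ₑ ≤ ‖f x‖ₑ := fun x => enorm_indicator_le_enorm_self _ _
  have hle₂ : ∀ x, ‖f₂ x‖ₑ ≤ ‖f x‖ₑ := fun x => enorm_indicator_le_enorm_self _ _
  have hM₁ : ∀ x, ‖f₁ x‖ₑ ≤ M := fun x => (hle₁ x).trans (hM x)
  have hM₂ : ∀ x, ‖f₂ x‖ₑ ≤ M := fun x => (hle₂ x).trans (hM x)
  have hm₁ : ∫⁻ x, ‖f₁ x‖ₑ ≤ 1 := (lintegral_mono hle₁).trans hf1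
  have hm₂ : ∫⁻ x, ‖f₂ x‖ₑ ≤ 1 := (lintegral_mono hle₂).trans hf1
  have hadd : f = f₁ + f₂ := (indicator_self_add_compl _ _).symm
  have hu : ∀ x, smulConv K f x = smulConv K f₁ x + smulConv K f₂ x := fun x => by
    simp only [smulConv]
    rw [← integral_add (integrable_smul_kernel hK hKL hβ hβD hf₁ hM₁ x)
      (integrable_smul_kernel hK hKL hβ hβD hf₂ hM₂ x)]
    simp_rw [← add_smul]
    rw [hadd]
    rfl
  have hmass : ∀ s, radialMass f s = radialMass f₁ s + radialMass f₂ s := fun s => by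
    simp only [radialMass]
    rw [← integral_add hf₁.integrableOn hf₂.integrableOn, hadd]
    rfl
  have hrem : ∀ x, remainderConv K f x = remainderConv K f₁ x + remainderConv K f₂ x := fun x => by
    simp only [remainderConv]
    rw [hu, hmass, add_smul]
    abel
  set D := truncatedHalfSpace ξ b y R
  have hD := measurableSet_truncatedHalfSpace ξ b y R
  set S := (ball (0 : E) 4)ᶜ
  have hS : MeasurableSet S := measurableSet_ball.compl
  set G : (E → ℝ) → E → ℝ := fun h x =>
    Φ (smulConv K h x) - Φ (radialMass h ‖x‖ • K x) - Φ (remainderConv K h x)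
  set Q : E → ℝ := fun x =>
    Φ (smulConv K f x) - Φ (smulConv K f₁ x) - Φ (smulConv K f₂ x)
  set P : (E → ℝ) → E → ℝ := fun h x => Φ (radialMass h ‖x‖ • K x)
  have hnear' : ∫⁻ x in ball (0 : E) 4, ‖Q x‖ₑ ≤ C₁ * C₂ := by
    have h := hnear (fun x => ‖smulConv K f₁ x‖ₑ) (fun x => ‖smulConv K f₂ x‖ₑ)
      (fun x => by
        rw [setLIntegral_absMeasure hf.1 (by fun_prop) measurableSet_closedBall,
          ← lintegral_absMeasure hf₁.1 (by fun_prop)]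
        exact enorm_smulConv_le hc hf₁.1 x)
      (fun x => by
        rw [setLIntegral_absMeasure hf.1 (by fun_prop) measurableSet_closedBall.compl,
          ← lintegral_absMeasure hf₂.1 (by fun_prop)]
        exact enorm_smulConv_le hc hf₂.1 x)
    calc _ ≤ ∫⁻ x in ball (0 : E) 4, C₁ * (max ‖smulConv K f₁ x‖ₑ ‖smulConv K f₂ x‖ₑ ^ (p - 1) *
          min ‖smulConv K f₁ x‖ₑ ‖smulConv K f₂ x‖ₑ) := by
          refine lintegral_mono fun x => ?_
          simp only [Q]
          rw [hu]
          exact hC₁ _ _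
      _ = _ := lintegral_const_mul' _ _ (by simp)
      _ ≤ _ := mul_le_mul_right h _
  -- For t in the support of f₁ one has ‖t‖ ≤ 2 ≤ ‖x‖ / 2, hence ‖x - t‖ ≥ ‖x‖ / 2. This produces
  -- 2^β; the summand 1 comes from the subtracted kernel at x.
  have hrem₁ : ∀ x ∈ S, ‖remainderConv K f₁ x‖ₑ ≤ (c * ((2 : ℝ≥0) ^ β + 1) : ℝ≥0) * ‖x‖ₑ ^ (-β) := by
    intro x hx
    have hx4 : 4 ≤ ‖x‖ := by simpa [S] using hx
    have hx0 : x ≠ 0 := norm_pos_iff.1 (by linarith)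
    rw [remainderConv_eq_integral hK hKL hβ hβD hf₁ hM₁]
    calc _ ≤ ∫⁻ t, ‖f₁ t • kernelRemainder K x t‖ₑ := enorm_integral_le_lintegral_enorm _
      _ ≤ ∫⁻ t, ‖f₁ t‖ₑ * ((c * ((2 : ℝ≥0) ^ β + 1) : ℝ≥0) * ‖x‖ₑ ^ (-β)) := by
          refine lintegral_mono fun t => ?_
          rw [enorm_smul]
          by_cases ht : t ∈ closedBall (0 : E) ρ
          · gcongr
            have ht' : ‖t‖ ≤ 2 := (by simpa using ht : ‖t‖ ≤ ρ).trans hρ.2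
            have hxt : ‖x - t‖ₑ ^ (-β) ≤ ((2 : ℝ≥0) ^ β : ℝ≥0) * ‖x‖ₑ ^ (-β) := by
              calc ‖x - t‖ₑ ^ (-β) ≤ ‖(1 / 2 : ℝ) • x‖ₑ ^ (-β) := by
                    refine ENNReal.rpow_neg_le_rpow_neg (enorm_le_enorm_of_norm_le ?_) hβ.le
                    rw [norm_smul, Real.norm_of_nonneg (by norm_num)]
                    linarith [norm_sub_norm_le x t]
                _ = _ := by
                    rw [enorm_smul, ENNReal.mul_rpow_of_ne_top (by simp) (by simp)]
                    congr 1
                    rw [← ofReal_norm, Real.norm_of_nonneg (by norm_num),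
                      ENNReal.ofReal_div_of_pos (by norm_num)]
                    simp [ENNReal.rpow_neg, ENNReal.inv_rpow, ENNReal.coe_rpow_of_nonneg _ hβ.le]
            refine (enorm_kernelRemainder_le hc x t).trans ?_
            push_cast
            rw [mul_assoc, add_mul, one_mul]
            refine mul_le_mul_right (add_le_add ?_ le_rfl) _
            exact hxt
          · simp [f₁, ht]
      _ = (∫⁻ t, ‖f₁ t‖ₑ) * ((c * ((2 : ℝ≥0) ^ β + 1) : ℝ≥0) * ‖x‖ₑ ^ (-β)) :=
          lintegral_mul_const' _ _ (ENNReal.mul_ne_top ENNReal.coe_ne_top (by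
            rw [← ofReal_norm, ENNReal.ofReal_rpow_of_pos (by linarith)]; simp))
      _ ≤ _ := mul_le_of_le_one_left zero_le hm₁
  have hfar : ∫⁻ x in S, ‖Φ (remainderConv K f x) - Φ (remainderConv K f₁ x) -
      Φ (remainderConv K f₂ x)‖ₑ ≤ C₁ * C₃ := by
    have h := hC₃ (absMeasure f₂) (by rw [absMeasure_univ]; exact hm₂) S hS
      (fun x => ‖remainderConv K f₁ x‖ₑ) (fun x => ‖remainderConv K f₂ x‖ₑ) hrem₁
      (fun x => enorm_remainderConv_le hK hKL hβ hβD hf₂ hM₂ x)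
    calc _ ≤ ∫⁻ x in S, C₁ * (max ‖remainderConv K f₁ x‖ₑ ‖remainderConv K f₂ x‖ₑ ^ (p - 1) *
          min ‖remainderConv K f₁ x‖ₑ ‖remainderConv K f₂ x‖ₑ) := by
          refine lintegral_mono fun x => ?_
          rw [hrem]
          exact hC₁ _ _
      _ = _ := lintegral_const_mul' _ _ (by simp)
      _ ≤ _ := mul_le_mul_right h _
  have hKm := hK.stronglyMeasurable hKL hβ
  have hΦc := hΦ.continuous hΦL hp.le
  have hGm : ∀ h : E → ℝ, AEStronglyMeasurable h → AEMeasurable (fun x => ‖G h x‖ₑ) := fun h hh =>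
    (((hΦc.comp_aestronglyMeasurable (aestronglyMeasurable_smulConv hKm hh)).sub
      (hΦc.comp_aestronglyMeasurable (aestronglyMeasurable_radialMass_smul hKm hh))).sub
      (hΦc.comp_aestronglyMeasurable (aestronglyMeasurable_remainderConv hKm hh))).enorm
  -- What is left of `Q` after removing the main terms outside the ball is bounded in L^1. The main
  -- terms are bounded only as integrals, over truncated half-spaces.
  set W : E → ℝ := fun x => Q x - S.indicator (fun x => P f x - P f₁ x - P f₂ x) x
  have hW : ∫⁻ x in D, ‖W x‖ₑ ≤ C₁ * C₂ + (C₅ + C₅ + C₅ + C₁ * C₃) := by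
    refine (setLIntegral_le_lintegral _ _).trans ?_
    rw [← lintegral_add_compl _ measurableSet_ball (A := ball (0 : E) 4)]
    refine add_le_add ?_ ?_
    · refine (setLIntegral_congr_fun measurableSet_ball fun x hx => ?_).trans_le hnear'
      simp only [W]
      rw [indicator_of_notMem (by simpa [S] using hx), sub_zero]
    · calc ∫⁻ x in S, ‖W x‖ₑ ≤ ∫⁻ x in S, (‖G f x‖ₑ + ‖G f₁ x‖ₑ + ‖G f₂ x‖ₑ +
            ‖Φ (remainderConv K f x) - Φ (remainderConv K f₁ x) - Φ (remainderConv K f₂ x)‖ₑ) := by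
            refine setLIntegral_mono' hS fun x hx => ?_
            have : W x = G f x - G f₁ x - G f₂ x + (Φ (remainderConv K f x) -
                Φ (remainderConv K f₁ x) - Φ (remainderConv K f₂ x)) := by
              simp only [W, Q, G, P]
              rw [indicator_of_mem hx]
              ring
            rw [this]
            refine (enorm_add_le _ _).trans (add_le_add (enorm_sub_le.trans ?_) le_rfl)
            exact add_le_add enorm_sub_le le_rfl
        _ = (∫⁻ x in S, ‖G f x‖ₑ) + (∫⁻ x in S, ‖G f₁ x‖ₑ) + (∫⁻ x in S, ‖G f₂ x‖ₑ) +
            ∫⁻ x in S, ‖Φ (remainderConv K f x) - Φ (remainderConv K f₁ x) -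
              Φ (remainderConv K f₂ x)‖ₑ := by
            have m0 := (hGm f hf.1).restrict (s := S)
            have m1 := (hGm f₁ hf₁.1).restrict (s := S)
            have m2 := (hGm f₂ hf₂.1).restrict (s := S)
            refine (lintegral_add_left' ((m0.add m1).add m2) _).trans ?_
            refine congrArg₂ _ ?_ rfl
            refine (lintegral_add_left' (m0.add m1) _).trans ?_
            exact congrArg₂ _ (lintegral_add_left' m0 _) rfl
        _ ≤ _ := by
            refine add_le_add (add_le_add (add_le_add ?_ ?_) ?_) hfar
            · exact (setLIntegral_le_lintegral _ _).trans (hC₅ f M hf hM hf1)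
            · exact (setLIntegral_le_lintegral _ _).trans (hC₅ f₁ M hf₁ hM₁ hm₁)
            · exact (setLIntegral_le_lintegral _ _).trans (hC₅ f₂ M hf₂ hM₂ hm₂)
  have hmain : ∀ h : E → ℝ, AEStronglyMeasurable h → ∫⁻ x, ‖h x‖ₑ ≤ 1 →
      ‖∫ x in D ∩ S, P h x‖ₑ ≤ C₄ ∧ IntegrableOn (P h) (D ∩ S) := by
    intro h hh hh1
    have hr : ∀ s, |radialMass h s| ≤ 1 := fun s => by
      have := (enorm_radialMass_le h s).trans hh1
      rwa [← ofReal_norm, ENNReal.ofReal_le_one] at this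
    refine ⟨hC₄ _ (measurable_radialMass hh) hr b y R hR hy, ?_⟩
    refine integrableOn_comp_radial_smul hK hKL hβ hΦ hΦL hp.le hpβ (measurable_radialMass hh) hr
      (r := 4) (R := R + ‖y‖) (by norm_num) fun x hx => ⟨by simpa [S] using hx.2, ?_⟩
    have h5 : ‖x - y‖ < R := by simpa [dist_eq_norm] using hx.1.2
    linarith [norm_sub_norm_le x y]
  obtain ⟨p0, i0⟩ := hmain f hf.1 hf1
  obtain ⟨p1, i1⟩ := hmain f₁ hf₁.1 hm₁
  obtain ⟨p2, i2⟩ := hmain f₂ hf₂.1 hm₂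
  have hDfin := volume_truncatedHalfSpace_lt_top ξ b y R
  have j0 := integrableOn_comp_smulConv hK hKL hβ hβD hΦ hΦL hp.le hf hM hDfin
  have j1 := integrableOn_comp_smulConv hK hKL hβ hβD hΦ hΦL hp.le hf₁ hM₁ hDfin
  have j2 := integrableOn_comp_smulConv hK hKL hβ hβD hΦ hΦL hp.le hf₂ hM₂ hDfin
  have hQint : IntegrableOn Q D := (j0.sub j1).sub j2
  have hPint : IntegrableOn (S.indicator fun x => P f x - P f₁ x - P f₂ x) D := by
    rw [IntegrableOn, integrable_indicator_iff hS, IntegrableOn, Measure.restrict_restrict hS,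
      inter_comm]
    exact (i0.sub i1).sub i2
  have hQ : ∫ x in D, Q x = (∫ x in D, W x) +
      ((∫ x in D ∩ S, P f x) - (∫ x in D ∩ S, P f₁ x) - ∫ x in D ∩ S, P f₂ x) := by
    have e1 : ∫ x in D, W x = (∫ x in D, Q x) -
        ∫ x in D, S.indicator (fun x => P f x - P f₁ x - P f₂ x) x := integral_sub hQint hPint
    have e2 : ∫ x in D, S.indicator (fun x => P f x - P f₁ x - P f₂ x) x =
        (∫ x in D ∩ S, P f x) - (∫ x in D ∩ S, P f₁ x) - ∫ x in D ∩ S, P f₂ x := by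
      rw [setIntegral_indicator hS]
      exact integral_sub_sub i0 i1 i2
    rw [e1, e2]
    ring
  have hQ' : (∫ x in D, Φ (smulConv K f x)) - (∫ x in D, Φ (smulConv K f₁ x)) -
      ∫ x in D, Φ (smulConv K f₂ x) = ∫ x in D, Q x :=
    (integral_sub_sub j0 j1 j2).symm
  rw [hQ', hQ]
  push_cast
  refine (enorm_add_le _ _).trans (add_le_add ?_ ?_)
  · exact (enorm_integral_le_lintegral_enorm _).trans hW
  · exact enorm_sub_le.trans (add_le_add (enorm_sub_le.trans (add_le_add p0 p1)) p2)

end Split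

/-! ### Transfer to arbitrary balls by translation and dilation -/

section Scaling

variable {E F : Type*} [NormedAddCommGroup E] [InnerProductSpace ℝ E] [Nontrivial E]
  [MeasurableSpace E] [BorelSpace E] [FiniteDimensional ℝ E]
  [NormedAddCommGroup F] [NormedSpace ℝ F] [CompleteSpace F] {K : E → F} {Φ : F → ℝ} {β p : ℝ}

theorem integral_comp_add_smul {G : Type*} [NormedAddCommGroup G] [NormedSpace ℝ G] (φ : E → G)
    (x₀ : E) {r : ℝ} (hr : 0 < r) :
    ∫ x, φ (x₀ + r • x) = (r ^ Module.finrank ℝ E)⁻¹ • ∫ x, φ x := by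
  rw [Measure.integral_comp_smul volume (fun x => φ (x₀ + x)) r, integral_add_left_eq_self φ x₀,
    abs_of_pos (by positivity)]

theorem smulConv_comp_add_smul (hK : PosHomogeneous (-β) K) (f : E → ℝ) (a : ℝ) (x₀ : E) {r : ℝ}
    (hr : 0 < r) (x : E) :
    smulConv K (fun t => a * f (x₀ + r • t)) x =
      (a * (r ^ Module.finrank ℝ E)⁻¹ * r ^ β) • smulConv K f (x₀ + r • x) := by
  have h1 : ∀ t, (a * f (x₀ + r • t)) • K (x - t) =
      (a * r ^ β) • (fun u => f u • K ((x₀ + r • x) - u)) (x₀ + r • t) := fun t => by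
    have h2 : K (r • (x - t)) = r ^ (-β) • K (x - t) := hK _ _ hr
    have h3 : x₀ + r • x - (x₀ + r • t) = r • (x - t) := by module
    simp only
    rw [h3, h2, smul_smul, smul_smul, Real.rpow_neg hr.le]
    congr 1
    field_simp
  calc smulConv K (fun t => a * f (x₀ + r • t)) x
      = ∫ t, (a * r ^ β) • (fun u => f u • K ((x₀ + r • x) - u)) (x₀ + r • t) :=
        integral_congr_ae (.of_forall h1)
    _ = (a * r ^ β) • ((r ^ Module.finrank ℝ E)⁻¹ • smulConv K f (x₀ + r • x)) :=
        (integral_smul _ _).trans (congrArg _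
          (integral_comp_add_smul (fun u => f u • K ((x₀ + r • x) - u)) x₀ hr))
    _ = _ := by
        rw [smul_smul]
        congr 1
        ring

theorem preimage_truncatedHalfSpace (ξ x₀ y : E) (c R : ℝ) {r : ℝ} (hr : 0 < r) :
    {x | x₀ + r • x ∈ truncatedHalfSpace ξ c y R} =
      truncatedHalfSpace ξ ((c - ⟪x₀, ξ⟫) / r) (r⁻¹ • (y - x₀)) (R / r) := by
  ext x
  simp only [truncatedHalfSpace, mem_ofPred_eq, mem_inter_iff, mem_ball, dist_eq_norm,
    inner_add_left, inner_smul_left, conj_trivial]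
  have h : x₀ + r • x - y = r • (x - r⁻¹ • (y - x₀)) := by
    rw [smul_sub, smul_smul, mul_inv_cancel₀ hr.ne', one_smul]; abel
  rw [h, norm_smul, Real.norm_of_nonneg hr.le, div_lt_iff₀ hr, lt_div_iff₀ hr]
  constructor <;> rintro ⟨h1, h2⟩ <;> constructor <;> linarith

/-- Since pβ is the dimension, the powers of r cancel and only the normalisation by m leaves a
trace. The half-space stays a half-space, but its height and the centre of truncation move. -/
theorem setIntegral_comp_smulConv_comp_add_smul (hK : PosHomogeneous (-β) K)
    (hΦ : PosHomogeneous p Φ) (hpβ : p * β = Module.finrank ℝ E) (f : E → ℝ) {m : ℝ} (hm : 0 < m)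
    (x₀ : E) {r : ℝ} (hr : 0 < r) (ξ y : E) (c R : ℝ) :
    ∫ x in truncatedHalfSpace ξ ((c - ⟪x₀, ξ⟫) / r) (r⁻¹ • (y - x₀)) (R / r),
      Φ (smulConv K (fun t => (r ^ Module.finrank ℝ E / m) * f (x₀ + r • t)) x) =
    (m ^ p)⁻¹ * ∫ x in truncatedHalfSpace ξ c y R, Φ (smulConv K f x) := by
  set D := truncatedHalfSpace ξ c y R
  have hrd : 0 < r ^ Module.finrank ℝ E := by positivity
  have h1 : ∀ x, Φ (smulConv K (fun t => (r ^ Module.finrank ℝ E / m) * f (x₀ + r • t)) x) =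
      ((m ^ p)⁻¹ * r ^ Module.finrank ℝ E) * Φ (smulConv K f (x₀ + r • x)) := fun x => by
    rw [smulConv_comp_add_smul hK _ _ _ hr]
    have h2 : r ^ Module.finrank ℝ E / m * (r ^ Module.finrank ℝ E)⁻¹ * r ^ β = m⁻¹ * r ^ β := by
      field_simp
    rw [h2, hΦ _ _ (by positivity), smul_eq_mul, Real.mul_rpow (by positivity) (by positivity),
      Real.inv_rpow hm.le, ← Real.rpow_mul hr.le, mul_comm β, hpβ, Real.rpow_natCast]
  simp_rw [h1]
  rw [integral_const_mul, ← preimage_truncatedHalfSpace ξ x₀ y c R hr]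
  have hD : MeasurableSet D := measurableSet_truncatedHalfSpace _ _ _ _
  have hD' : MeasurableSet {x | x₀ + r • x ∈ D} :=
    (by fun_prop : Measurable fun x : E => x₀ + r • x) hD
  rw [← integral_indicator hD', ← integral_indicator hD]
  have h3 : ∀ x, ({x | x₀ + r • x ∈ D}.indicator fun x => Φ (smulConv K f (x₀ + r • x))) x =
      (D.indicator fun x => Φ (smulConv K f x)) (x₀ + r • x) := fun x => by
    by_cases h : x₀ + r • x ∈ D <;> simp [indicator, h]
  simp_rw [h3]
  rw [integral_comp_add_smul _ _ hr, smul_eq_mul, mul_assoc, mul_inv_cancel_left₀ hrd.ne']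

/-- Splitting a function into its parts inside and outside a suitable ball about a given point
changes the functional `∫ Φ (K * f)` over a truncated half-space by a bounded amount. -/
theorem exists_radius_abs_integral_comp_smulConv_sub_sub_le
    (hK : PosHomogeneous (-β) K) (hKL : LipschitzOnSphere K)
    (hβ : 0 < β) (hΦ : PosHomogeneous p Φ) (hΦL : LipschitzOnSphere Φ) (hp : 1 < p)
    (hpβ : p * β = Module.finrank ℝ E) {ξ : E} (hξ : ‖ξ‖ = 1)
    (h1 : ∫ ζ : sphere (0 : E) 1, Φ (K ζ) ∂(volume : Measure E).toSphere = 0)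
    (h2 : ∫ ζ : sphere (0 : E) 1, Φ (-K ζ) ∂(volume : Measure E).toSphere = 0)
    (h3 : ∫ ζ : sphere (0 : E) 1 in {ζ | 0 < ⟪(ζ : E), ξ⟫}, Φ (K ζ)
      ∂(volume : Measure E).toSphere = 0)
    (h4 : ∫ ζ : sphere (0 : E) 1 in {ζ | 0 < ⟪(ζ : E), ξ⟫}, Φ (-K ζ)
      ∂(volume : Measure E).toSphere = 0) :
    ∃ C : ℝ≥0, ∀ (f : E → ℝ) (M : ℝ≥0), Integrable f → (∀ x, ‖f x‖ₑ ≤ M) → 0 < ∫ x, |f x| →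
      ∀ (x₀ : E) (r R : ℝ), 0 < r → 0 < R → ‖x₀‖ ≤ R / 2 → ∃ ρ ∈ Icc r (2 * r),
        |(∫ x in truncatedHalfSpace ξ 0 0 R, Φ (smulConv K f x)) -
          (∫ x in truncatedHalfSpace ξ 0 0 R, Φ (smulConv K ((closedBall x₀ ρ).indicator f) x)) -
          ∫ x in truncatedHalfSpace ξ 0 0 R, Φ (smulConv K ((closedBall x₀ ρ)ᶜ.indicator f) x)|
          ≤ C * (∫ x, |f x|) ^ p := by
  obtain ⟨C, hC⟩ := exists_radius_integral_comp_smulConv_sub_sub_le hK hKL hβ hΦ hΦL hp hpβ hξ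
    h1 h2 h3 h4
  refine ⟨C, fun f M hf hM hm x₀ r R hr hR hx₀ => ?_⟩
  set m := ∫ x, |f x|
  set a : ℝ := r ^ Module.finrank ℝ E / m
  have ha : 0 < a := by positivity
  -- Recentred at x₀, rescaled by r and normalised to L^1 norm 1. The truncating ball is now centred
  -- at -x₀ / r with radius R / r, which satisfies the condition on the centre because ‖x₀‖ ≤ R / 2.
  set g : E → ℝ := fun t => a * f (x₀ + r • t)
  have hgM : ∀ t, ‖g t‖ₑ ≤ (‖a‖₊ * M : ℝ≥0) := fun t => by
    simp only [g]
    rw [enorm_mul, ENNReal.coe_mul]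
    gcongr
    · exact le_rfl
    · exact hM _
  have hgint : Integrable g := by
    refine Integrable.const_mul ?_ _
    exact (hf.comp_add_left x₀).comp_smul hr.ne'
  have hg1 : ∫⁻ t, ‖g t‖ₑ ≤ 1 := by
    rw [← ofReal_integral_norm_eq_lintegral_enorm hgint, ENNReal.ofReal_le_one]
    have h5 : ∀ t, ‖g t‖ = a * (fun u => |f u|) (x₀ + r • t) := fun t => by
      simp only [g]
      rw [norm_mul, Real.norm_of_nonneg ha.le, Real.norm_eq_abs]
    rw [integral_congr_ae (.of_forall h5), integral_const_mul,
      integral_comp_add_smul (fun u => |f u|) x₀ hr, smul_eq_mul]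
    apply le_of_eq
    simp only [a]
    have : r ^ Module.finrank ℝ E ≠ 0 := by positivity
    change r ^ Module.finrank ℝ E / m * ((r ^ Module.finrank ℝ E)⁻¹ * m) = 1
    field_simp
  obtain ⟨ρ, hρ, h⟩ := hC g _ hgint hgM hg1
  refine ⟨r * ρ, ⟨by nlinarith [hρ.1], by nlinarith [hρ.2]⟩, ?_⟩
  have h := h ((0 - ⟪x₀, ξ⟫) / r) (r⁻¹ • (0 - x₀)) (R / r) (by positivity) (by
    rw [zero_sub, norm_smul, norm_neg, Real.norm_of_nonneg (by positivity), inv_mul_eq_div,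
      div_right_comm]
    gcongr)
  have hmem : ∀ t, x₀ + r • t ∈ closedBall x₀ (r * ρ) ↔ t ∈ closedBall (0 : E) ρ := fun t => by
    rw [mem_closedBall, dist_eq_norm, add_sub_cancel_left, norm_smul, Real.norm_of_nonneg hr.le,
      mem_closedBall_zero_iff, mul_le_mul_iff_right₀ hr]
  have e1 : (closedBall 0 ρ).indicator g =
      fun t => a * (closedBall x₀ (r * ρ)).indicator f (x₀ + r • t) := by
    ext t
    by_cases ht : t ∈ closedBall (0 : E) ρ
    · rw [indicator_of_mem ht, indicator_of_mem ((hmem t).2 ht)]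
    · rw [indicator_of_notMem ht, indicator_of_notMem (fun h => ht ((hmem t).1 h)), mul_zero]
  have e2 : (closedBall 0 ρ)ᶜ.indicator g =
      fun t => a * (closedBall x₀ (r * ρ))ᶜ.indicator f (x₀ + r • t) := by
    ext t
    by_cases ht : t ∈ closedBall (0 : E) ρ
    · rw [indicator_of_notMem (notMem_compl_iff.2 ht),
        indicator_of_notMem (notMem_compl_iff.2 ((hmem t).2 ht)), mul_zero]
    · rw [indicator_of_mem (mem_compl ht),
        indicator_of_mem (show x₀ + r • t ∈ (closedBall x₀ (r * ρ))ᶜ from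
          fun h => ht ((hmem t).1 h))]
  rw [e1, e2, setIntegral_comp_smulConv_comp_add_smul hK hΦ hpβ f hm x₀ hr,
    setIntegral_comp_smulConv_comp_add_smul hK hΦ hpβ _ hm x₀ hr,
    setIntegral_comp_smulConv_comp_add_smul hK hΦ hpβ _ hm x₀ hr, ← mul_sub, ← mul_sub,
    ← ofReal_norm, ← ENNReal.ofReal_coe_nnreal, ENNReal.ofReal_le_ofReal_iff C.coe_nonneg,
    norm_mul, norm_inv, Real.norm_of_nonneg (by positivity), inv_mul_le_iff₀ (by positivity),
    Real.norm_eq_abs] at h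
  linarith

end Scaling

/-! ### A ball that divides the mass in a definite proportion -/

section BallSelection

variable {E : Type*} [NormedAddCommGroup E] [NormedSpace ℝ E] [MeasurableSpace E] [BorelSpace E]
  [FiniteDimensional ℝ E]

/-- The closed ball of radius `2` can be covered by finitely many closed balls of radius `1 / 4`. -/
theorem exists_finset_closedBall_cover (E : Type*) [NormedAddCommGroup E] [NormedSpace ℝ E]
    [FiniteDimensional ℝ E] :
    ∃ s : Finset E, closedBall (0 : E) 2 ⊆ ⋃ y ∈ s, closedBall y (1 / 4) := by
  obtain ⟨t, -, ht, h⟩ := (isCompact_closedBall (0 : E) 2).finite_cover_balls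
    (e := 1 / 4) (by norm_num)
  refine ⟨ht.toFinset, h.trans ?_⟩
  simp only [Set.Finite.mem_toFinset]
  exact iUnion₂_mono fun y _ => ball_subset_closedBall

theorem exists_closedBall_subset_iUnion (s : Finset E)
    (hs : closedBall (0 : E) 2 ⊆ ⋃ y ∈ s, closedBall y (1 / 4)) (x₀ : E) {r : ℝ} (hr : 0 < r) :
    closedBall x₀ (2 * r) ⊆ ⋃ y ∈ s, closedBall (x₀ + r • y) (r / 4) := by
  intro x hx
  have h1 : r⁻¹ • (x - x₀) ∈ closedBall (0 : E) 2 := by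
    rw [mem_closedBall_zero_iff, norm_smul, norm_inv, Real.norm_of_nonneg hr.le,
      inv_mul_le_iff₀ hr]
    rw [mem_closedBall, dist_eq_norm] at hx
    linarith
  obtain ⟨y, hy, hxy⟩ := mem_iUnion₂.1 (hs h1)
  refine mem_iUnion₂.2 ⟨y, hy, ?_⟩
  rw [mem_closedBall, dist_eq_norm] at hxy ⊢
  have h2 : x - (x₀ + r • y) = r • (r⁻¹ • (x - x₀) - y) := by
    rw [smul_sub, smul_smul, mul_inv_cancel₀ hr.ne', one_smul]; abel
  rw [h2, norm_smul, Real.norm_of_nonneg hr.le]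
  nlinarith

/-- A finite measure on a ball which is small on small balls admits a ball carrying a definite
proportion of the mass, such that the doubled ball misses a definite proportion of the mass. -/
theorem exists_closedBall_measureReal_le (E : Type*) [NormedAddCommGroup E] [NormedSpace ℝ E]
    [MeasurableSpace E] [BorelSpace E] [FiniteDimensional ℝ E] :
    ∃ δ : ℝ, 0 < δ ∧ δ < 1 ∧ ∀ (μ : Measure E) [IsFiniteMeasure μ], 0 < μ.real univ →
      (∀ ε > 0, ∃ r₀ > 0, ∀ x r, r ≤ r₀ → μ.real (closedBall x r) < ε) →
      ∀ R : ℝ, 0 < R → μ (closedBall 0 (R / 2))ᶜ = 0 → ∃ (x₀ : E) (r : ℝ), ‖x₀‖ ≤ R / 2 ∧ 0 < r ∧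
        δ * μ.real univ ≤ μ.real (closedBall x₀ r) ∧
        μ.real (closedBall x₀ (2 * r)) ≤ (1 - δ) * μ.real univ := by
  obtain ⟨s, hs⟩ := exists_finset_closedBall_cover E
  set N : ℝ := (s.card : ℝ)
  have hN : (1 : ℝ) ≤ N := by
    have : s.Nonempty := by
      by_contra h
      rw [Finset.not_nonempty_iff_eq_empty] at h
      have := hs (mem_closedBall_self (by norm_num))
      simp [h] at this
    simp only [N]
    exact_mod_cast this.card_pos
  -- The choice that makes N δ = 1 - δ, where N is the number of covering balls.
  refine ⟨1 / (N + 1), by positivity, by rw [div_lt_one (by positivity)]; linarith, ?_⟩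
  intro μ _ hm hsmall R hR hsupp
  set m := μ.real univ
  set δ := 1 / (N + 1) with hδ
  have hδ0 : 0 < δ := by positivity
  let P : ℕ → Prop := fun k => ∃ x : E, ‖x‖ ≤ R / 2 ∧
    δ * m ≤ μ.real (closedBall x (R * (1 / 2) ^ k))
  have hP0 : P 0 := by
    refine ⟨0, by simp; positivity, ?_⟩
    have h1 : μ (closedBall (0 : E) (R * (1 / 2) ^ 0)) = μ univ := by
      refine measure_of_measure_compl_eq_zero (measure_mono_null (compl_subset_compl.2 ?_) hsupp)
      exact closedBall_subset_closedBall (by norm_num; linarith)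
    have h2 : μ.real (closedBall (0 : E) (R * (1 / 2) ^ 0)) = m := by
      rw [measureReal_def, h1]; rfl
    rw [h2]
    have : δ ≤ 1 := by rw [hδ, div_le_one (by positivity)]; linarith
    nlinarith
  have hPn : ∃ k, ¬ P k := by
    obtain ⟨r₀, hr₀, h⟩ := hsmall (δ * m) (by positivity)
    obtain ⟨k, hk⟩ := exists_pow_lt_of_lt_one (div_pos hr₀ hR) (by norm_num : (1 / 2 : ℝ) < 1)
    refine ⟨k, ?_⟩
    rintro ⟨x, -, hx⟩
    have := h x (R * (1 / 2) ^ k) (by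
      rw [lt_div_iff₀ hR] at hk; linarith)
    linarith
  -- The stopping scale: some ball of radius R / 2^k carries the proportion δ, but none of half that
  -- radius centred in the ball of radius R / 2 does.
  obtain ⟨k, hk, hk'⟩ : ∃ k, P k ∧ ¬ P (k + 1) := by
    by_contra! h
    obtain ⟨n, hn⟩ := hPn
    exact hn (Nat.rec hP0 (fun k hk => h k hk) n)
  obtain ⟨x₀, hx₀, hx₀m⟩ := hk
  set r := R * (1 / 2) ^ k with hr
  have hr0 : 0 < r := by positivity
  refine ⟨x₀, r, hx₀, hr0, hx₀m, ?_⟩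
  -- Moving the centre from z to a point w of the ball of radius R / 2 at most doubles the radius to
  -- r / 2, the scale at which `P` fails.
  have hball : ∀ z : E, μ.real (closedBall z (r / 4)) ≤ δ * m := by
    intro z
    by_cases hz : (closedBall z (r / 4) ∩ closedBall 0 (R / 2)).Nonempty
    · obtain ⟨w, hw, hw'⟩ := hz
      have h1 : ¬ δ * m ≤ μ.real (closedBall w (R * (1 / 2) ^ (k + 1))) := fun h =>
        hk' ⟨w, by simpa using hw', h⟩
      refine (measureReal_mono ?_).trans (not_le.1 h1).le
      refine closedBall_subset_closedBall' ?_
      rw [mem_closedBall, dist_comm] at hw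
      have : R * (1 / 2) ^ (k + 1) = r / 2 := by rw [hr, pow_succ]; ring
      linarith
    · have : μ (closedBall z (r / 4)) = 0 := by
        refine measure_mono_null (fun x hx => ?_) hsupp
        exact fun hx' => hz ⟨x, hx, hx'⟩
      rw [measureReal_def, this, ENNReal.toReal_zero]
      positivity
  calc μ.real (closedBall x₀ (2 * r)) ≤ μ.real (⋃ y ∈ s, closedBall (x₀ + r • y) (r / 4)) :=
        measureReal_mono (exists_closedBall_subset_iUnion s hs x₀ hr0) (measure_ne_top _ _)
    _ ≤ ∑ y ∈ s, μ.real (closedBall (x₀ + r • y) (r / 4)) := measureReal_biUnion_finset_le _ _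
    _ ≤ ∑ y ∈ s, δ * m := Finset.sum_le_sum fun y _ => hball _
    _ = N * (δ * m) := by simp [N]
    _ = (1 - δ) * m := by
        rw [hδ]
        field_simp
        ring

end BallSelection

/-! ### Sufficiency: iterated cutting -/

section Sufficiency

variable {E F : Type*} [NormedAddCommGroup E] [InnerProductSpace ℝ E] [Nontrivial E]
  [MeasurableSpace E] [BorelSpace E] [FiniteDimensional ℝ E]
  [NormedAddCommGroup F] [NormedSpace ℝ F] [CompleteSpace F] {K : E → F} {Φ : F → ℝ} {β p : ℝ}

theorem absMeasure_real {f : E → ℝ} (hf : Integrable f) {S : Set E} (hS : MeasurableSet S) :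
    (absMeasure f).real S = ∫ x, |S.indicator f x| := by
  have h1 : ∫ x, |S.indicator f x| = ∫ x, ‖S.indicator f x‖ := rfl
  rw [h1, integral_norm_eq_lintegral_enorm (hf.indicator hS).1, measureReal_def]
  congr 1
  have := setLIntegral_absMeasure hf.1 (k := fun _ => 1) measurable_const hS
  simpa using this

theorem absMeasure_real_univ {f : E → ℝ} (hf : Integrable f) :
    (absMeasure f).real univ = ∫ x, |f x| := by
  rw [absMeasure_real hf .univ, indicator_univ]

theorem exists_pos_forall_absMeasure_closedBall_lt {f : E → ℝ} (hf : Integrable f) {M : ℝ≥0}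
    (hM : ∀ x, ‖f x‖ₑ ≤ M) {ε : ℝ} (hε : 0 < ε) :
    ∃ r₀ > 0, ∀ (x : E) (r : ℝ), r ≤ r₀ → (absMeasure f).real (closedBall x r) < ε := by
  have hD : Module.finrank ℝ E ≠ 0 := Module.finrank_pos.ne'
  set v := (volume : Measure E).real (ball 0 1)
  have hv : 0 ≤ v := measureReal_nonneg
  obtain ⟨r₀, hr₀, hr₀1, h⟩ : ∃ r₀ : ℝ, 0 < r₀ ∧ r₀ ≤ 1 ∧ M * v * r₀ < ε := by
    refine ⟨min 1 (ε / (M * v + 1)), by positivity, min_le_left _ _, ?_⟩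
    calc M * v * min 1 (ε / (M * v + 1)) ≤ M * v * (ε / (M * v + 1)) := by
          gcongr; exact min_le_right _ _
      _ < ε := by
          rw [mul_div_assoc', div_lt_iff₀ (by positivity)]; nlinarith
  refine ⟨r₀, hr₀, fun x r hr => lt_of_le_of_lt ?_ h⟩
  have hfin : (absMeasure f) univ ≠ ∞ := by rw [absMeasure_univ]; exact hf.2.ne
  have h1 : absMeasure f (closedBall x r) ≤ M * volume (closedBall x r₀) := by
    have := setLIntegral_absMeasure hf.1 (k := fun _ => 1) measurable_const
      (measurableSet_closedBall (x := x) (ε := r))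
    simp only [lintegral_const, Measure.restrict_apply, MeasurableSet.univ, univ_inter, one_mul,
      mul_one] at this
    rw [this]
    calc _ ≤ ∫⁻ t, (closedBall x r₀).indicator (fun _ => (M : ℝ≥0∞)) t := by
          refine lintegral_mono fun t => ?_
          by_cases ht : t ∈ closedBall x r
          · rw [indicator_of_mem ht, indicator_of_mem (closedBall_subset_closedBall hr ht)]
            exact hM t
          · rw [indicator_of_notMem ht]; simp
      _ = _ := by rw [lintegral_indicator measurableSet_closedBall]; simp
  rw [Measure.addHaar_closedBall _ _ hr₀.le] at h1
  have h2 := ENNReal.toReal_mono (by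
    refine ENNReal.mul_ne_top (by simp) (ENNReal.mul_ne_top (by simp) measure_ball_lt_top.ne)) h1
  rw [ENNReal.toReal_mul, ENNReal.toReal_mul, ENNReal.toReal_ofReal (by positivity),
    ENNReal.coe_toReal] at h2
  calc _ ≤ _ := h2
    _ = M * v * r₀ ^ Module.finrank ℝ E := by simp only [v, measureReal_def]; ring
    _ ≤ M * v * r₀ := by
        gcongr
        exact pow_le_of_le_one hr₀.le hr₀1 hD

/-- A crude bound, depending on the support and the supremum of `f`. -/
theorem exists_abs_integral_comp_smulConv_le_rpow (hK : PosHomogeneous (-β) K)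
    (hKL : LipschitzOnSphere K) (hβ : 0 < β) (hΦ : PosHomogeneous p Φ) (hΦL : LipschitzOnSphere Φ)
    {q : ℝ} (hq : 1 ≤ q) (hqp : q ≤ p) (hqβ : β * q < Module.finrank ℝ E)
    (ξ : E) (M : ℝ≥0) {R : ℝ} (hR : 0 < R) :
    ∃ B : ℝ≥0, ∀ f : E → ℝ, Integrable f → (∀ x, ‖f x‖ₑ ≤ M) →
      (∀ x, x ∉ closedBall (0 : E) (R / 2) → f x = 0) →
      |∫ x in truncatedHalfSpace ξ 0 0 R, Φ (smulConv K f x)| ≤ B * (∫ x, |f x|) ^ q := by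
  have hβD : β < Module.finrank ℝ E := lt_of_le_of_lt (le_mul_of_one_le_right hβ.le hq) hqβ
  obtain ⟨c, hc⟩ := hK.exists_enorm_le hKL (by linarith)
  obtain ⟨c', hc'⟩ := hΦ.exists_enorm_le hΦL (by linarith)
  obtain ⟨C, hC⟩ := lintegral_absMeasure_enorm_sub_rpow_le (E := E) hβ.le hβD
  obtain ⟨C', hC'⟩ := setLIntegral_ball_rpow_sub_le (volume : Measure E) (κ := β * q)
    (by positivity) hqβ
  set L : ℝ≥0∞ := c * (C * M + M * volume (closedBall (0 : E) (R / 2)))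
  have hL : L ≠ ∞ := ENNReal.mul_ne_top ENNReal.coe_ne_top (ENNReal.add_ne_top.2
    ⟨ENNReal.mul_ne_top ENNReal.coe_ne_top ENNReal.coe_ne_top,
      ENNReal.mul_ne_top ENNReal.coe_ne_top measure_closedBall_lt_top.ne⟩)
  set B : ℝ≥0∞ := c' * L ^ (p - q) *
    (c ^ q * (C' * ENNReal.ofReal R ^ (Module.finrank ℝ E - β * q)))
  have hB : B ≠ ∞ := by
    refine ENNReal.mul_ne_top (ENNReal.mul_ne_top ENNReal.coe_ne_top
      (ENNReal.rpow_ne_top_of_nonneg (by linarith) hL))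
      (ENNReal.mul_ne_top (ENNReal.rpow_ne_top_of_nonneg (by linarith) ENNReal.coe_ne_top)
        (ENNReal.mul_ne_top ENNReal.coe_ne_top
          (ENNReal.rpow_ne_top_of_nonneg (by linarith) ENNReal.ofReal_ne_top)))
  refine ⟨B.toNNReal, fun f hf hM hsupp => ?_⟩
  have hu : ∀ x, ‖smulConv K f x‖ₑ ≤ L := fun x => by
    refine (enorm_smulConv_le hc hf.1 x).trans (mul_le_mul_right ((hC f M hf.1 hM x).trans ?_) _)
    refine add_le_add le_rfl ?_
    calc ∫⁻ t, ‖f t‖ₑ ≤ ∫⁻ t, (closedBall (0 : E) (R / 2)).indicator (fun _ => (M : ℝ≥0∞)) t := by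
          refine lintegral_mono fun t => ?_
          by_cases ht : t ∈ closedBall (0 : E) (R / 2)
          · rw [indicator_of_mem ht]; exact hM t
          · rw [hsupp t ht]; simp
      _ = _ := by rw [lintegral_indicator measurableSet_closedBall]; simp
  have hmain : ∫⁻ x in truncatedHalfSpace ξ 0 0 R, ‖Φ (smulConv K f x)‖ₑ ≤
      B * (∫⁻ x, ‖f x‖ₑ) ^ q := by
    have : SFinite (absMeasure f) := by unfold absMeasure; infer_instance
    have hJ := lintegral_mul_rpow_lintegral_le ((volume : Measure E).restrict (ball 0 R))
      (absMeasure f) hq (k := fun x t => ‖x - t‖ₑ ^ (-β)) (by fun_prop) (w := fun _ => 1)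
      measurable_const (B := C' * ENNReal.ofReal R ^ (Module.finrank ℝ E - β * q))
      (.of_forall fun t => by
        simp_rw [one_mul, ← ENNReal.rpow_mul, neg_mul]
        exact hC' R hR t)
    simp_rw [one_mul] at hJ
    rw [absMeasure_univ] at hJ
    calc _ ≤ ∫⁻ x in ball (0 : E) R, ‖Φ (smulConv K f x)‖ₑ :=
          lintegral_mono_set inter_subset_right
      _ ≤ ∫⁻ x in ball (0 : E) R, (c' * L ^ (p - q) * c ^ q) *
            (∫⁻ t, ‖x - t‖ₑ ^ (-β) ∂(absMeasure f)) ^ q := by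
          refine lintegral_mono fun x => (hc' _).trans ?_
          -- The power p - q is bounded uniformly through M and R. The power q goes to the Schur
          -- test, which applies because βq is below the dimension.
          have h1 : ‖smulConv K f x‖ₑ ^ p =
              ‖smulConv K f x‖ₑ ^ (p - q) * ‖smulConv K f x‖ₑ ^ q := by
            rw [← ENNReal.rpow_add_of_nonneg _ _ (by linarith) (by linarith), sub_add_cancel]
          rw [h1, mul_assoc, mul_assoc]
          refine mul_le_mul_right (mul_le_mul' (ENNReal.rpow_le_rpow (hu x) (by linarith)) ?_) _
          rw [← ENNReal.mul_rpow_of_nonneg _ _ (by linarith)]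
          exact ENNReal.rpow_le_rpow (enorm_smulConv_le hc hf.1 x) (by linarith)
      _ = (c' * L ^ (p - q) * c ^ q) * ∫⁻ x in ball (0 : E) R,
            (∫⁻ t, ‖x - t‖ₑ ^ (-β) ∂(absMeasure f)) ^ q := by
          refine lintegral_const_mul' _ _ (ENNReal.mul_ne_top (ENNReal.mul_ne_top
            ENNReal.coe_ne_top (ENNReal.rpow_ne_top_of_nonneg (by linarith) hL))
            (ENNReal.rpow_ne_top_of_nonneg (by linarith) ENNReal.coe_ne_top))
      _ ≤ _ := mul_le_mul_right hJ _
      _ = _ := by simp only [B]; ring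
  have h2 := (enorm_integral_le_lintegral_enorm _).trans hmain
  have h3 := ENNReal.toReal_mono (ENNReal.mul_ne_top hB
    (ENNReal.rpow_ne_top_of_nonneg (by linarith) hf.2.ne)) h2
  rw [toReal_enorm, ENNReal.toReal_mul, ← ENNReal.toReal_rpow,
    ← integral_norm_eq_lintegral_enorm hf.1] at h3
  exact h3

/-- One factor of each power sums to the total mass, and the remaining power p - 1 yields the gain
η^(p-1) that drives the iteration. -/
theorem rpow_add_rpow_le {p η m a b : ℝ} (hp : 1 ≤ p) (ha : 0 ≤ a) (hb : 0 ≤ b)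
    (hab : a + b = m) (ha' : a ≤ η * m) (hb' : b ≤ η * m) (hη : 0 ≤ η) :
    a ^ p + b ^ p ≤ η ^ (p - 1) * m ^ p := by
  have hm : 0 ≤ m := by linarith
  have h : ∀ {x : ℝ}, 0 ≤ x → x ^ p = x ^ (p - 1) * x := fun {x} hx => by
    rw [← Real.rpow_add_one' hx (by linarith), sub_add_cancel]
  rw [h ha, h hb, h hm, ← mul_assoc, ← Real.mul_rpow hη hm]
  calc _ ≤ (η * m) ^ (p - 1) * a + (η * m) ^ (p - 1) * b := by
        gcongr
    _ = _ := by rw [← mul_add, hab]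

/-- The bound over truncated half-spaces, under the cancellation conditions. -/
theorem exists_abs_integral_truncatedHalfSpace_le
    (hK : PosHomogeneous (-β) K) (hKL : LipschitzOnSphere K)
    (hβ : 0 < β) (hΦ : PosHomogeneous p Φ) (hΦL : LipschitzOnSphere Φ) (hp : 1 < p)
    (hpβ : p * β = Module.finrank ℝ E) {ξ : E} (hξ : ‖ξ‖ = 1)
    (h1 : ∫ ζ : sphere (0 : E) 1, Φ (K ζ) ∂(volume : Measure E).toSphere = 0)
    (h2 : ∫ ζ : sphere (0 : E) 1, Φ (-K ζ) ∂(volume : Measure E).toSphere = 0)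
    (h3 : ∫ ζ : sphere (0 : E) 1 in {ζ | 0 < ⟪(ζ : E), ξ⟫}, Φ (K ζ)
      ∂(volume : Measure E).toSphere = 0)
    (h4 : ∫ ζ : sphere (0 : E) 1 in {ζ | 0 < ⟪(ζ : E), ξ⟫}, Φ (-K ζ)
      ∂(volume : Measure E).toSphere = 0) :
    ∃ A : ℝ, ∀ (f : E → ℝ) (M : ℝ≥0) (R : ℝ), Integrable f → (∀ x, ‖f x‖ₑ ≤ M) → 0 < R →
      (∀ x, x ∉ closedBall (0 : E) (R / 2) → f x = 0) →
      |∫ x in truncatedHalfSpace ξ 0 0 R, Φ (smulConv K f x)| ≤ A * (∫ x, |f x|) ^ p := by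
  obtain ⟨C, hC⟩ := exists_radius_abs_integral_comp_smulConv_sub_sub_le hK hKL hβ hΦ hΦL hp hpβ hξ
    h1 h2 h3 h4
  obtain ⟨δ, hδ0, hδ1, hδ⟩ := exists_closedBall_measureReal_le E
  set η := 1 - δ
  have hη0 : 0 < η := by simp only [η]; linarith
  have hη1 : η < 1 := by simp only [η]; linarith
  have hηp : η ^ (p - 1) < 1 := Real.rpow_lt_one hη0.le hη1 (by linarith)
  -- The fixed point of A = C + A η^(p-1), the sum of the geometric series of cutting errors.
  set A : ℝ := C / (1 - η ^ (p - 1)) with hA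
  have hA0 : 0 ≤ A := div_nonneg C.coe_nonneg (by linarith)
  have hAC : C + A * η ^ (p - 1) = A := by
    rw [hA]
    have : 1 - η ^ (p - 1) ≠ 0 := by linarith
    field_simp
    ring
  refine ⟨A, fun f M R hf hM hR hsupp => ?_⟩
  set q := (1 + p) / 2 with hq
  have hq1 : 1 < q := by rw [hq]; linarith
  have hqp : q < p := by rw [hq]; linarith
  obtain ⟨B, hB⟩ := exists_abs_integral_comp_smulConv_le_rpow hK hKL hβ hΦ hΦL hq1.le hqp.le
    (by rw [← hpβ]; nlinarith) ξ M hR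
  set θ := η ^ (q - 1)
  have hθ0 : 0 ≤ θ := by positivity
  have hθ1 : θ < 1 := Real.rpow_lt_one hη0.le hη1 (by linarith)
  -- Here n is the depth of cutting. M and R pass to the pieces, so B is the same for all of them.
  -- The crude term gains θ < 1 at each cut because q > 1, and disappears in the limit.
  have key : ∀ (n : ℕ) (g : E → ℝ), Integrable g → (∀ x, ‖g x‖ₑ ≤ M) →
      (∀ x, x ∉ closedBall (0 : E) (R / 2) → g x = 0) →
      |∫ x in truncatedHalfSpace ξ 0 0 R, Φ (smulConv K g x)| ≤
        A * (∫ x, |g x|) ^ p + B * θ ^ n * (∫ x, |g x|) ^ q := by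
    intro n
    induction n with
    | zero =>
      intro g hg hgM hgs
      rw [pow_zero, mul_one]
      have := hB g hg hgM hgs
      have h0 : 0 ≤ A * (∫ x, |g x|) ^ p := by positivity
      linarith
    | succ n ih =>
      intro g hg hgM hgs
      rcases (integral_nonneg fun x => abs_nonneg (g x) : 0 ≤ ∫ x, |g x|).eq_or_lt with hm | hm
      · have := hB g hg hgM hgs
        rw [← hm, Real.zero_rpow (by linarith), mul_zero] at this
        refine this.trans ?_
        rw [← hm, Real.zero_rpow (by linarith), Real.zero_rpow (by linarith)]
        simp
      have hfin : IsFiniteMeasure (absMeasure g) :=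
        ⟨by rw [absMeasure_univ]; exact hg.2⟩
      have hu := absMeasure_real_univ hg
      obtain ⟨x₀, r, hx₀, hr, hlo, hhi⟩ := hδ (absMeasure g) (by rw [hu]; exact hm)
        (fun ε hε => exists_pos_forall_absMeasure_closedBall_lt hg hgM hε) R hR (by
          have := setLIntegral_absMeasure hg.1 (k := fun _ => 1) measurable_const
            (measurableSet_closedBall (x := (0 : E)) (ε := R / 2)).compl
          simp only [lintegral_const, Measure.restrict_apply, MeasurableSet.univ, univ_inter,
            one_mul, mul_one] at this
          rw [this, lintegral_eq_zero_iff']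
          · refine .of_forall fun x => ?_
            by_cases hx : x ∈ closedBall (0 : E) (R / 2)
            · simp [indicator_of_notMem (notMem_compl_iff.2 hx)]
            · simp [indicator_of_mem (mem_compl hx), hgs x hx]
          · exact (hg.1.indicator measurableSet_closedBall.compl).enorm)
      obtain ⟨ρ, hρ, hsplit⟩ := hC g M hg hgM hm x₀ r R hr hR hx₀
      rw [hu] at hlo hhi
      set g₁ := (closedBall x₀ ρ).indicator g
      set g₂ := (closedBall x₀ ρ)ᶜ.indicator g
      have hg₁ : Integrable g₁ := hg.indicator measurableSet_closedBall
      have hg₂ : Integrable g₂ := hg.indicator measurableSet_closedBall.compl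
      have i₁ := ih g₁ hg₁ (fun x => (enorm_indicator_le_enorm_self _ _).trans (hgM x))
        (fun x hx => by simp [g₁, indicator, hgs x hx])
      have i₂ := ih g₂ hg₂ (fun x => (enorm_indicator_le_enorm_self _ _).trans (hgM x))
        (fun x hx => by simp [g₂, indicator, hgs x hx])
      have m₁ : ∫ x, |g₁ x| = (absMeasure g).real (closedBall x₀ ρ) :=
        (absMeasure_real hg measurableSet_closedBall).symm
      have m₂ : ∫ x, |g₂ x| = (absMeasure g).real (closedBall x₀ ρ)ᶜ :=
        (absMeasure_real hg measurableSet_closedBall.compl).symm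
      have m₁₂ : (∫ x, |g₁ x|) + ∫ x, |g₂ x| = ∫ x, |g x| := by
        rw [m₁, m₂, measureReal_add_measureReal_compl measurableSet_closedBall, hu]
      have n₁ : ∫ x, |g₁ x| ≤ η * ∫ x, |g x| := by
        rw [m₁]
        exact (measureReal_mono (closedBall_subset_closedBall hρ.2)).trans hhi
      have n₂ : ∫ x, |g₂ x| ≤ η * ∫ x, |g x| := by
        have : (absMeasure g).real (closedBall x₀ r) ≤ ∫ x, |g₁ x| := by
          rw [m₁]
          exact measureReal_mono (closedBall_subset_closedBall hρ.1)
        have e : η * ∫ x, |g x| = (∫ x, |g x|) - δ * ∫ x, |g x| := by simp only [η]; ring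
        linarith
      have p₁ : 0 ≤ ∫ x, |g₁ x| := integral_nonneg fun x => abs_nonneg _
      have p₂ : 0 ≤ ∫ x, |g₂ x| := integral_nonneg fun x => abs_nonneg _
      have hpp := rpow_add_rpow_le hp.le p₁ p₂ m₁₂ n₁ n₂ hη0.le
      have hqq := rpow_add_rpow_le hq1.le p₁ p₂ m₁₂ n₁ n₂ hη0.le
      have hpp' := mul_le_mul_of_nonneg_left hpp hA0
      have hqq' := mul_le_mul_of_nonneg_left hqq (show 0 ≤ B * θ ^ n by positivity)
      have hABC : A * (∫ x, |g x|) ^ p =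
          C * (∫ x, |g x|) ^ p + A * (η ^ (p - 1) * (∫ x, |g x|) ^ p) := by
        nth_rewrite 1 [← hAC]; ring
      have e2 : B * θ ^ (n + 1) * (∫ x, |g x|) ^ q = B * θ ^ n * (θ * (∫ x, |g x|) ^ q) := by
        rw [pow_succ]; ring
      rw [hABC, e2]
      rw [abs_le] at hsplit i₁ i₂ ⊢
      constructor <;> linarith [hsplit.1, hsplit.2, i₁.1, i₁.2, i₂.1, i₂.2]
  have hlim : Filter.Tendsto (fun n : ℕ => A * (∫ x, |f x|) ^ p + B * θ ^ n * (∫ x, |f x|) ^ q)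
      Filter.atTop (nhds (A * (∫ x, |f x|) ^ p + B * 0 * (∫ x, |f x|) ^ q)) :=
    (((tendsto_pow_atTop_nhds_zero_of_lt_one hθ0 hθ1).const_mul _).mul_const _).const_add _
  rw [mul_zero, zero_mul, add_zero] at hlim
  exact ge_of_tendsto' hlim fun n => key n f hf hM hsupp

/-- The bound over half-spaces, under the cancellation conditions. -/
theorem exists_abs_setIntegral_halfSpace_le
    (hK : PosHomogeneous (-β) K) (hKL : LipschitzOnSphere K)
    (hβ : 0 < β) (hΦ : PosHomogeneous p Φ) (hΦL : LipschitzOnSphere Φ) (hp : 1 < p)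
    (hpβ : p * β = Module.finrank ℝ E) {ξ : E} (hξ : ‖ξ‖ = 1)
    (h1 : ∫ ζ : sphere (0 : E) 1, Φ (K ζ) ∂(volume : Measure E).toSphere = 0)
    (h2 : ∫ ζ : sphere (0 : E) 1, Φ (-K ζ) ∂(volume : Measure E).toSphere = 0)
    (h3 : ∫ ζ : sphere (0 : E) 1 in {ζ | 0 < ⟪(ζ : E), ξ⟫}, Φ (K ζ)
      ∂(volume : Measure E).toSphere = 0)
    (h4 : ∫ ζ : sphere (0 : E) 1 in {ζ | 0 < ⟪(ζ : E), ξ⟫}, Φ (-K ζ)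
      ∂(volume : Measure E).toSphere = 0) :
    ∃ A : ℝ, ∀ (f : E → ℝ) (M : ℝ≥0) (ρ : ℝ), Integrable f → (∀ x, ‖f x‖ₑ ≤ M) →
      (∀ x, x ∉ closedBall (0 : E) ρ → f x = 0) →
      IntegrableOn (fun x => Φ (smulConv K f x)) {x | 0 < ⟪x, ξ⟫} →
      |∫ x in {x | 0 < ⟪x, ξ⟫}, Φ (smulConv K f x)| ≤ A * (∫ x, |f x|) ^ p := by
  obtain ⟨A, hA⟩ := exists_abs_integral_truncatedHalfSpace_le hK hKL hβ hΦ hΦL hp hpβ hξ h1 h2 h3 h4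
  refine ⟨A, fun f M ρ hf hM hsupp hint => ?_⟩
  have hU : ⋃ n : ℕ, truncatedHalfSpace ξ 0 0 (n : ℝ) = {x : E | 0 < ⟪x, ξ⟫} := by
    rw [show (⋃ n : ℕ, truncatedHalfSpace ξ 0 0 (n : ℝ)) =
      {x : E | 0 < ⟪x, ξ⟫} ∩ ⋃ n : ℕ, ball 0 (n : ℝ) from (inter_iUnion _ _).symm,
      iUnion_ball_nat, inter_univ]
  -- The constant does not depend on the truncation radius, which can therefore be sent to infinity
  -- once Φ(K * f) itself is integrable on the half-space.
  have hlim := tendsto_setIntegral_of_monotone (μ := volume) (f := fun x => Φ (smulConv K f x))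
    (s := fun n : ℕ => truncatedHalfSpace ξ 0 0 (n : ℝ))
    (fun n => measurableSet_truncatedHalfSpace _ _ _ _)
    (fun i j hij => inter_subset_inter_right _ (ball_subset_ball (by exact_mod_cast hij)))
    (by rw [hU]; exact hint)
  rw [hU] at hlim
  refine le_of_tendsto hlim.abs ?_
  obtain ⟨n₀, hn₀⟩ := exists_nat_gt (max 0 (2 * ρ))
  filter_upwards [Filter.eventually_ge_atTop n₀] with n hn
  have hn' : max 0 (2 * ρ) < n := hn₀.trans_le (by exact_mod_cast hn)
  refine hA f M n hf hM ((le_max_left _ _).trans_lt hn') fun x hx => hsupp x fun hx' => hx ?_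
  exact closedBall_subset_closedBall (by linarith [le_max_right 0 (2 * ρ)]) hx'

end Sufficiency

/-! ### The remainder in L^p and integrability for mean zero -/

section Remainder

variable {E F : Type*} [NormedAddCommGroup E] [InnerProductSpace ℝ E] [Nontrivial E]
  [MeasurableSpace E] [BorelSpace E] [FiniteDimensional ℝ E]
  [NormedAddCommGroup F] [NormedSpace ℝ F] [CompleteSpace F] {K : E → F} {Φ : F → ℝ} {β p : ℝ}

theorem enorm_half_smul_rpow_neg (x : E) (hβ : 0 ≤ β) :
    ‖(1 / 2 : ℝ) • x‖ₑ ^ (-β) = ((2 : ℝ≥0) ^ β : ℝ≥0) * ‖x‖ₑ ^ (-β) := by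
  rw [enorm_smul, ENNReal.mul_rpow_of_ne_top (by simp) (by simp)]
  congr 1
  rw [← ofReal_norm, Real.norm_of_nonneg (by norm_num), ENNReal.ofReal_div_of_pos (by norm_num)]
  simp [ENNReal.rpow_neg, ENNReal.inv_rpow, ENNReal.coe_rpow_of_nonneg _ hβ]

theorem enorm_half_smul_le {x : E} {a : ℝ} (h : ‖x‖ ≤ 2 * a) :
    ‖(1 / 2 : ℝ) • x‖ₑ ≤ ENNReal.ofReal a := by
  rw [← ofReal_norm, norm_smul, Real.norm_of_nonneg (by norm_num)]
  exact ENNReal.ofReal_le_ofReal (by linarith)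

/-- Up to a constant, spreading a mass uniformly over a ball about the origin gives a potential no
larger than that of the same mass at the origin: for ‖x‖ ≤ 2ρ compare with ρ^(-β), and otherwise ‖x
- t‖ ≥ ‖x‖ / 2. -/
theorem setLIntegral_ball_enorm_sub_rpow_le (hβ : 0 ≤ β) (hβD : β < Module.finrank ℝ E) :
    ∃ C : ℝ≥0, ∀ (ρ : ℝ) (x : E), 0 < ρ →
      ∫⁻ t in ball (0 : E) ρ, ‖x - t‖ₑ ^ (-β) ≤
        C * (ENNReal.ofReal ρ ^ Module.finrank ℝ E * ‖x‖ₑ ^ (-β)) := by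
  obtain ⟨C₁, hC₁⟩ := setLIntegral_ball_rpow_sub_le (volume : Measure E) hβ hβD
  set v : ℝ≥0 := (volume (ball (0 : E) 1)).toNNReal
  have hv : (v : ℝ≥0∞) = volume (ball (0 : E) 1) := ENNReal.coe_toNNReal measure_ball_lt_top.ne
  refine ⟨(C₁ + v) * 2 ^ β, fun ρ x hρ => ?_⟩
  have hρ' : ENNReal.ofReal ρ ≠ 0 := by simpa using hρ
  rw [ENNReal.coe_mul]
  rcases le_total ‖x‖ (2 * ρ) with hx | hx
  · calc _ = ∫⁻ t in ball (0 : E) ρ, ‖t - x‖ₑ ^ (-β) := by simp_rw [enorm_sub_rev]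
      _ ≤ C₁ * ENNReal.ofReal ρ ^ (Module.finrank ℝ E - β) := hC₁ ρ hρ x
      _ = C₁ * (ENNReal.ofReal ρ ^ Module.finrank ℝ E * ENNReal.ofReal ρ ^ (-β)) := by
          rw [sub_eq_add_neg, ENNReal.rpow_add _ _ hρ' ENNReal.ofReal_ne_top,
            ENNReal.rpow_natCast]
      _ ≤ (C₁ + v : ℝ≥0) * (ENNReal.ofReal ρ ^ Module.finrank ℝ E *
            (((2 : ℝ≥0) ^ β : ℝ≥0) * ‖x‖ₑ ^ (-β))) := by
          refine mul_le_mul' (by simp) (mul_le_mul_right ?_ _)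
          rw [← enorm_half_smul_rpow_neg x hβ]
          exact ENNReal.rpow_neg_le_rpow_neg (enorm_half_smul_le hx) hβ
      _ = _ := by ring
  · calc _ ≤ ∫⁻ t in ball (0 : E) ρ, ((2 : ℝ≥0) ^ β : ℝ≥0) * ‖x‖ₑ ^ (-β) := by
          refine setLIntegral_mono' measurableSet_ball fun t ht => ?_
          rw [← enorm_half_smul_rpow_neg x hβ]
          refine ENNReal.rpow_neg_le_rpow_neg ?_ hβ
          rw [← ofReal_norm (x - t)]
          refine enorm_half_smul_le ?_
          have : ‖t‖ < ρ := by simpa using ht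
          linarith [norm_sub_norm_le x t]
      _ = ((2 : ℝ≥0) ^ β : ℝ≥0) * ‖x‖ₑ ^ (-β) * (ENNReal.ofReal ρ ^ Module.finrank ℝ E * v) := by
          rw [setLIntegral_const, Measure.addHaar_ball _ _ hρ.le, hv,
            ENNReal.ofReal_pow hρ.le]
      _ ≤ ((2 : ℝ≥0) ^ β : ℝ≥0) * ‖x‖ₑ ^ (-β) * (ENNReal.ofReal ρ ^ Module.finrank ℝ E *
            (C₁ + v : ℝ≥0)) := by
          refine mul_le_mul_right (mul_le_mul_right ?_ _) _
          simp
      _ = _ := by ring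

/-- Two concentric balls accommodate the tall narrow bump and the annulus of the test functions,
with a constant depending only on their masses. -/
theorem lintegral_absMeasure_enorm_sub_rpow_le_of_ball (hβ : 0 ≤ β)
    (hβD : β < Module.finrank ℝ E) :
    ∃ C : ℝ≥0, ∀ (f : E → ℝ) (M₁ M₂ : ℝ≥0) (ρ₁ ρ₂ : ℝ), AEStronglyMeasurable f → 0 < ρ₁ → 0 < ρ₂ →
      (∀ t, ‖f t‖ₑ ≤ (ball (0 : E) ρ₁).indicator (fun _ => (M₁ : ℝ≥0∞)) t +
        (ball (0 : E) ρ₂).indicator (fun _ => (M₂ : ℝ≥0∞)) t) → ∀ x : E,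
      ∫⁻ t, ‖x - t‖ₑ ^ (-β) ∂(absMeasure f) ≤
        C * ((M₁ * ENNReal.ofReal ρ₁ ^ Module.finrank ℝ E +
          M₂ * ENNReal.ofReal ρ₂ ^ Module.finrank ℝ E) * ‖x‖ₑ ^ (-β)) := by
  obtain ⟨C, hC⟩ := setLIntegral_ball_enorm_sub_rpow_le (E := E) hβ hβD
  refine ⟨C, fun f M₁ M₂ ρ₁ ρ₂ hf hρ₁ hρ₂ hM x => ?_⟩
  have hball : ∀ (M : ℝ≥0) (ρ : ℝ), 0 < ρ →
      ∫⁻ t, (ball (0 : E) ρ).indicator (fun _ => (M : ℝ≥0∞)) t * ‖x - t‖ₑ ^ (-β) ≤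
        C * (M * ENNReal.ofReal ρ ^ Module.finrank ℝ E * ‖x‖ₑ ^ (-β)) := by
    intro M ρ hρ
    calc _ = ∫⁻ t, (ball (0 : E) ρ).indicator (fun t => M * ‖x - t‖ₑ ^ (-β)) t := by
          refine lintegral_congr fun t => ?_
          by_cases ht : t ∈ ball (0 : E) ρ
          · rw [indicator_of_mem ht, indicator_of_mem ht]
          · rw [indicator_of_notMem ht, indicator_of_notMem ht, zero_mul]
      _ = M * ∫⁻ t in ball (0 : E) ρ, ‖x - t‖ₑ ^ (-β) := by
          rw [lintegral_indicator measurableSet_ball,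
            lintegral_const_mul' _ _ ENNReal.coe_ne_top]
      _ ≤ M * (C * (ENNReal.ofReal ρ ^ Module.finrank ℝ E * ‖x‖ₑ ^ (-β))) :=
          mul_le_mul_right (hC ρ x hρ) _
      _ = _ := by ring
  rw [lintegral_absMeasure hf (by fun_prop)]
  calc _ ≤ ∫⁻ t, ((ball (0 : E) ρ₁).indicator (fun _ => (M₁ : ℝ≥0∞)) t * ‖x - t‖ₑ ^ (-β) +
        (ball (0 : E) ρ₂).indicator (fun _ => (M₂ : ℝ≥0∞)) t * ‖x - t‖ₑ ^ (-β)) := by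
        refine lintegral_mono fun t => ?_
        rw [← add_mul]
        exact mul_le_mul' (hM t) le_rfl
    _ = _ := lintegral_add_left ((measurable_const.indicator measurableSet_ball).mul
        (by fun_prop)) _
    _ ≤ _ := add_le_add (hball M₁ ρ₁ hρ₁) (hball M₂ ρ₂ hρ₂)
    _ = _ := by ring

/-- The exponent p lies outside the range of the Schur test, as βp is the full dimension. Instead p
- 1 powers are bounded pointwise by ‖x‖^(-β), which produces the weight of the L^1 estimate for the
remaining power, since β(p-1) = D - β. -/
theorem lintegral_enorm_remainderConv_rpow_le (hK : PosHomogeneous (-β) K)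
    (hKL : LipschitzOnSphere K) (hβ : 0 < β) (hp : 1 < p) (hpβ : p * β = Module.finrank ℝ E) :
    ∃ C : ℝ≥0, ∀ (f : E → ℝ) (M L : ℝ≥0), Integrable f → (∀ x, ‖f x‖ₑ ≤ M) →
      (∀ x, ∫⁻ t, ‖x - t‖ₑ ^ (-β) ∂(absMeasure f) ≤ L * ‖x‖ₑ ^ (-β)) → ∫⁻ x, ‖f x‖ₑ ≤ L →
      ∫⁻ x, ‖remainderConv K f x‖ₑ ^ p ≤ C * (L : ℝ≥0∞) ^ p := by
  have hβD : β < Module.finrank ℝ E := by rw [← hpβ]; nlinarith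
  obtain ⟨c, hc⟩ := hK.exists_enorm_le hKL (by linarith)
  obtain ⟨C₁, hC₁⟩ := lintegral_enorm_kernelRemainder_le (volume : Measure E) hK hKL hβ le_rfl
    (by rwa [mul_one])
  have hp1 : 0 ≤ p - 1 := by linarith
  refine ⟨(2 * c) ^ (p - 1) * C₁, fun f M L hf hM hu hm => ?_⟩
  set A : ℝ≥0∞ := 2 * c * L
  have hA : A ≠ ∞ := ENNReal.mul_ne_top (ENNReal.mul_ne_top (by simp) ENNReal.coe_ne_top)
    ENNReal.coe_ne_top
  have hE : ∀ x, ‖remainderConv K f x‖ₑ ≤ A * ‖x‖ₑ ^ (-β) := fun x => by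
    rw [remainderConv]
    refine enorm_sub_le.trans ?_
    rw [enorm_smul]
    calc _ ≤ c * (L * ‖x‖ₑ ^ (-β)) + L * (c * ‖x‖ₑ ^ (-β)) :=
          add_le_add ((enorm_smulConv_le hc hf.1 x).trans (mul_le_mul_right (hu x) _))
            (mul_le_mul' ((enorm_radialMass_le f _).trans hm) (hc x))
      _ = _ := by simp only [A]; ring
  have hJ := lintegral_mul_rpow_lintegral_le (volume : Measure E) (absMeasure f) le_rfl
    (k := fun x t => ‖kernelRemainder K x t‖ₑ)
    (stronglyMeasurable_kernelRemainder (hK.stronglyMeasurable hKL hβ)).enorm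
    (w := fun x => ‖x‖ₑ ^ (-(Module.finrank ℝ E - β * 1))) (by fun_prop) (.of_forall hC₁)
  simp_rw [ENNReal.rpow_one, mul_one] at hJ
  rw [absMeasure_univ] at hJ
  have hexp : -β * (p - 1) = -((Module.finrank ℝ E : ℝ) - β) := by rw [← hpβ]; ring
  calc _ ≤ ∫⁻ x, A ^ (p - 1) * (‖x‖ₑ ^ (-((Module.finrank ℝ E : ℝ) - β)) *
        ∫⁻ t, ‖kernelRemainder K x t‖ₑ ∂(absMeasure f)) := by
        refine lintegral_mono fun x => ?_
        have h1 : ‖remainderConv K f x‖ₑ ^ p =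
            ‖remainderConv K f x‖ₑ ^ (p - 1) * ‖remainderConv K f x‖ₑ := by
          conv_lhs => rw [← sub_add_cancel p 1]
          rw [ENNReal.rpow_add_of_nonneg _ _ hp1 zero_le_one, ENNReal.rpow_one]
        rw [h1, ← mul_assoc, ← hexp, ENNReal.rpow_mul, ← ENNReal.mul_rpow_of_nonneg _ _ hp1]
        exact mul_le_mul' (ENNReal.rpow_le_rpow (hE x) hp1)
          (enorm_remainderConv_le hK hKL hβ hβD hf hM x)
    _ = A ^ (p - 1) * _ := lintegral_const_mul' _ _ (ENNReal.rpow_ne_top_of_nonneg hp1 hA)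
    _ ≤ A ^ (p - 1) * (L * C₁) := mul_le_mul_right (hJ.trans (mul_le_mul' hm le_rfl)) _
    _ = _ := by
        have h2 : (L : ℝ≥0∞) ^ p = (L : ℝ≥0∞) ^ (p - 1) * L := by
          conv_lhs => rw [← sub_add_cancel p 1]
          rw [ENNReal.rpow_add_of_nonneg _ _ hp1 zero_le_one, ENNReal.rpow_one]
        simp only [A]
        rw [h2, ENNReal.mul_rpow_of_nonneg _ _ hp1, ENNReal.coe_mul,
          ENNReal.coe_rpow_of_nonneg _ hp1, ENNReal.coe_mul, ENNReal.coe_ofNat]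
        ring

theorem radialMass_eq_integral {f : E → ℝ} {ρ s : ℝ} (hf : ∀ x, x ∉ closedBall (0 : E) ρ → f x = 0)
    (hs : ρ ≤ s) : radialMass f s = ∫ x, f x :=
  setIntegral_eq_integral_of_forall_compl_eq_zero fun x hx =>
    hf x fun h => hx (closedBall_subset_closedBall hs h)

/-- `Φ (K * f)` is integrable if `f` is bounded, compactly supported and has mean zero. -/
theorem integrable_comp_smulConv (hK : PosHomogeneous (-β) K) (hKL : LipschitzOnSphere K)
    (hβ : 0 < β) (hΦ : PosHomogeneous p Φ) (hΦL : LipschitzOnSphere Φ) (hp : 1 < p)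
    (hpβ : p * β = Module.finrank ℝ E) {f : E → ℝ} (hf : Integrable f) {M : ℝ≥0}
    (hM : ∀ x, ‖f x‖ₑ ≤ M) {ρ : ℝ} (hρ : ∀ x, x ∉ closedBall (0 : E) ρ → f x = 0)
    (hf0 : ∫ x, f x = 0) : Integrable fun x => Φ (smulConv K f x) := by
  have hβD : β < Module.finrank ℝ E := by rw [← hpβ]; nlinarith
  obtain ⟨c', hc'⟩ := hΦ.exists_enorm_le hΦL (by linarith)
  obtain ⟨C₁, hC₁⟩ := lintegral_absMeasure_enorm_sub_rpow_le_of_ball (E := E) hβ.le hβD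
  obtain ⟨C₂, hC₂⟩ := lintegral_enorm_remainderConv_rpow_le hK hKL hβ hp hpβ
  set r := max ρ 0 + 1
  have hr : 0 < r := by positivity
  have hrρ : ρ < r := by simp only [r]; linarith [le_max_left ρ 0]
  set L : ℝ≥0 := C₁ * (M * (Real.toNNReal r) ^ Module.finrank ℝ E +
    0 * (Real.toNNReal r) ^ Module.finrank ℝ E) + (∫⁻ x, ‖f x‖ₑ).toNNReal
  have hm : ((∫⁻ x, ‖f x‖ₑ).toNNReal : ℝ≥0∞) = ∫⁻ x, ‖f x‖ₑ := ENNReal.coe_toNNReal hf.2.ne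
  have hE := hC₂ f M L hf hM (fun x => by
    refine (hC₁ f M 0 r r hf.1 hr hr (fun t => ?_) x).trans ?_
    · by_cases ht : t ∈ closedBall (0 : E) ρ
      · rw [indicator_of_mem (closedBall_subset_ball hrρ ht)]
        exact (hM t).trans le_self_add
      · rw [hρ t ht]; simp
    · rw [← mul_assoc]
      refine mul_le_mul' ?_ le_rfl
      simp only [L]
      push_cast
      exact le_self_add) (by
    simp only [L]
    rw [ENNReal.coe_add, hm]
    exact le_add_self)
  refine (integrableOn_univ (μ := volume)).1 ?_
  rw [← union_compl_self (ball (0 : E) r), integrableOn_union]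
  refine ⟨integrableOn_comp_smulConv hK hKL hβ hβD hΦ hΦL hp.le hf hM measure_ball_lt_top,
    (aestronglyMeasurable_comp_smulConv hK hKL hβ hΦ hΦL hp.le hf.1).restrict, ?_⟩
  rw [hasFiniteIntegral_iff_enorm]
  calc _ ≤ ∫⁻ x in (ball (0 : E) r)ᶜ, c' * ‖remainderConv K f x‖ₑ ^ p := by
        refine setLIntegral_mono' measurableSet_ball.compl fun x hx => ?_
        have hx' : r ≤ ‖x‖ := by simpa using hx
        -- Outside the support the enclosed mass is the total mass, which is zero.
        have : smulConv K f x = remainderConv K f x := by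
          rw [remainderConv, radialMass_eq_integral hρ (hrρ.le.trans hx'), hf0, zero_smul, sub_zero]
        rw [this]
        exact hc' _
    _ ≤ ∫⁻ x, c' * ‖remainderConv K f x‖ₑ ^ p := setLIntegral_le_lintegral _ _
    _ = c' * ∫⁻ x, ‖remainderConv K f x‖ₑ ^ p := lintegral_const_mul' _ _ ENNReal.coe_ne_top
    _ ≤ c' * (C₂ * (L : ℝ≥0∞) ^ p) := mul_le_mul_right hE _
    _ < ∞ := by
        refine ENNReal.mul_lt_top ENNReal.coe_lt_top (ENNReal.mul_lt_top ENNReal.coe_lt_top ?_)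
        exact ENNReal.rpow_lt_top_of_nonneg (by linarith) ENNReal.coe_ne_top

/-- Comparison of `Φ (K * f)` with `Φ` of the kernel times the mass of `f` inside the sphere
through the given point, in `L^1`. -/
theorem lintegral_comp_smulConv_sub_le (hK : PosHomogeneous (-β) K) (hKL : LipschitzOnSphere K)
    (hβ : 0 < β) (hΦ : PosHomogeneous p Φ) (hΦL : LipschitzOnSphere Φ) (hp : 1 < p)
    (hpβ : p * β = Module.finrank ℝ E) (L : ℝ≥0) :
    ∃ C : ℝ≥0, ∀ (f : E → ℝ) (M : ℝ≥0), Integrable f → (∀ x, ‖f x‖ₑ ≤ M) →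
      (∀ x, ∫⁻ t, ‖x - t‖ₑ ^ (-β) ∂(absMeasure f) ≤ L * ‖x‖ₑ ^ (-β)) → ∫⁻ x, ‖f x‖ₑ ≤ 1 →
      ∫⁻ x, ‖Φ (smulConv K f x) - Φ (radialMass f ‖x‖ • K x)‖ₑ ≤ C := by
  obtain ⟨c', hc'⟩ := hΦ.exists_enorm_le hΦL (by linarith)
  obtain ⟨C₂, hC₂⟩ := lintegral_enorm_remainderConv_rpow_le hK hKL hβ hp hpβ
  obtain ⟨C₅, hC₅⟩ := lintegral_comp_smulConv_sub_sub_le hK hKL hβ hΦ hΦL hp hpβ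
  have hp0 : 0 ≤ p := by linarith
  refine ⟨C₅ + c' * (C₂ * (L + 1) ^ p), fun f M hf hM hu hm => ?_⟩
  have hKm := hK.stronglyMeasurable hKL hβ
  have hΦc := hΦ.continuous hΦL hp.le
  have hE := hC₂ f M (L + 1) hf hM
    (fun x => (hu x).trans (mul_le_mul' (by simp) le_rfl)) (hm.trans (by simp))
  calc _ ≤ ∫⁻ x, (‖Φ (smulConv K f x) - Φ (radialMass f ‖x‖ • K x) -
          Φ (remainderConv K f x)‖ₑ + c' * ‖remainderConv K f x‖ₑ ^ p) := by
        refine lintegral_mono fun x => ?_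
        have h1 : Φ (smulConv K f x) - Φ (radialMass f ‖x‖ • K x) =
            (Φ (smulConv K f x) - Φ (radialMass f ‖x‖ • K x) - Φ (remainderConv K f x)) +
              Φ (remainderConv K f x) := by ring
        calc _ ≤ _ := (congrArg _ h1).trans_le (enorm_add_le _ _)
          _ ≤ _ := add_le_add le_rfl (hc' _)
    _ = _ := lintegral_add_left' (((hΦc.comp_aestronglyMeasurable
        (aestronglyMeasurable_smulConv hKm hf.1)).sub (hΦc.comp_aestronglyMeasurable
        (aestronglyMeasurable_radialMass_smul hKm hf.1))).sub (hΦc.comp_aestronglyMeasurable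
        (aestronglyMeasurable_remainderConv hKm hf.1))).enorm _
    _ ≤ C₅ + c' * (C₂ * ((L + 1 : ℝ≥0) : ℝ≥0∞) ^ p) := by
        rw [lintegral_const_mul' _ _ ENNReal.coe_ne_top]
        exact add_le_add (hC₅ f M hf hM hm) (mul_le_mul_right hE _)
    _ = _ := by
        rw [← ENNReal.coe_rpow_of_nonneg _ hp0]
        push_cast
        rfl

end Remainder

/-! ### Test functions with an enclosed mass constant over many scales -/

section TestFunction

variable {E : Type*} [NormedAddCommGroup E] [InnerProductSpace ℝ E] [Nontrivial E]
  [MeasurableSpace E] [BorelSpace E] [FiniteDimensional ℝ E]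

/-- The indicator function of a set, divided by the volume of the set. -/
noncomputable def uniformDensity (S : Set E) : E → ℝ := S.indicator fun _ => (volume.real S)⁻¹

/-- The annulus `{x | 2 < ‖x‖ < 3}`. -/
def annulus (E : Type*) [NormedAddCommGroup E] : Set E := ball 0 3 \ closedBall 0 2

/-- Half the difference of the uniform densities of a ball about the origin and of an annulus. -/
noncomputable def testFunction (E : Type*) [NormedAddCommGroup E] [InnerProductSpace ℝ E]
    [MeasurableSpace E] [BorelSpace E] [FiniteDimensional ℝ E] (ε : ℝ) : E → ℝ :=
  fun x => (uniformDensity (ball 0 ε) x - uniformDensity (annulus E) x) / 2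

theorem measurableSet_annulus : MeasurableSet (annulus E) :=
  measurableSet_ball.diff measurableSet_closedBall

theorem volume_annulus_ne_top : volume (annulus E) ≠ ∞ :=
  measure_ne_top_of_subset sdiff_subset measure_ball_lt_top.ne

theorem volume_real_annulus_pos : 0 < volume.real (annulus E) := by
  refine ENNReal.toReal_pos (ne_of_gt ?_) volume_annulus_ne_top
  refine ((isOpen_ball.sdiff isClosed_closedBall).measure_pos volume ?_)
  obtain ⟨x, hx⟩ := exists_norm_eq E (by norm_num : (0 : ℝ) ≤ 5 / 2)
  exact ⟨x, by simp [hx]; norm_num, by simp [hx]; norm_num⟩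

theorem volume_real_ball_pos {ε : ℝ} (hε : 0 < ε) : 0 < volume.real (ball (0 : E) ε) :=
  ENNReal.toReal_pos (measure_ball_pos _ _ hε).ne' measure_ball_lt_top.ne

theorem uniformDensity_nonneg (S : Set E) (x : E) : 0 ≤ uniformDensity S x :=
  indicator_nonneg (fun _ _ => inv_nonneg.2 measureReal_nonneg) _

theorem integrable_uniformDensity {S : Set E} (hS : MeasurableSet S) (hS' : volume S ≠ ∞) :
    Integrable (uniformDensity S) :=
  (integrable_indicator_iff hS).2 (integrableOn_const hS')

theorem setIntegral_uniformDensity {S : Set E} (hS : MeasurableSet S) (T : Set E) :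
    ∫ x in T, uniformDensity S x = volume.real (T ∩ S) / volume.real S := by
  rw [uniformDensity, setIntegral_indicator hS, setIntegral_const, smul_eq_mul, div_eq_mul_inv]

theorem integral_uniformDensity {S : Set E} (hS : MeasurableSet S) (hS' : 0 < volume.real S) :
    ∫ x, uniformDensity S x = 1 := by
  rw [← setIntegral_univ, setIntegral_uniformDensity hS, univ_inter, div_self hS'.ne']

theorem integrable_testFunction (ε : ℝ) : Integrable (testFunction E ε) :=
  ((integrable_uniformDensity measurableSet_ball measure_ball_lt_top.ne).sub
    (integrable_uniformDensity measurableSet_annulus volume_annulus_ne_top)).div_const _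

theorem integral_testFunction {ε : ℝ} (hε : 0 < ε) : ∫ x, testFunction E ε x = 0 := by
  simp only [testFunction]
  rw [integral_div, integral_sub
    (integrable_uniformDensity measurableSet_ball measure_ball_lt_top.ne)
    (integrable_uniformDensity measurableSet_annulus volume_annulus_ne_top),
    integral_uniformDensity measurableSet_ball (volume_real_ball_pos hε),
    integral_uniformDensity measurableSet_annulus volume_real_annulus_pos]
  norm_num

theorem abs_testFunction_le (ε : ℝ) (x : E) : |testFunction E ε x| ≤
    (uniformDensity (ball 0 ε) x + uniformDensity (annulus E) x) / 2 := by
  have h1 := uniformDensity_nonneg (ball 0 ε) x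
  have h2 := uniformDensity_nonneg (annulus E) x
  rw [testFunction, abs_le]
  constructor <;> linarith

theorem integral_abs_testFunction_le {ε : ℝ} (hε : 0 < ε) : ∫ x, |testFunction E ε x| ≤ 1 := by
  have i1 := integrable_uniformDensity (E := E) (S := ball 0 ε) measurableSet_ball
    measure_ball_lt_top.ne
  have i2 := integrable_uniformDensity (E := E) measurableSet_annulus volume_annulus_ne_top
  refine (integral_mono (integrable_testFunction ε).abs ((i1.add i2).div_const 2)
    (abs_testFunction_le ε)).trans_eq ?_
  have h : ∫ x, (uniformDensity (ball 0 ε) x + uniformDensity (annulus E) x) / 2 =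
      ((∫ x, uniformDensity (ball (0 : E) ε) x) + ∫ x, uniformDensity (annulus E) x) / 2 := by
    rw [integral_div, integral_add i1 i2]
  refine h.trans ?_
  rw [integral_uniformDensity measurableSet_ball (volume_real_ball_pos hε),
    integral_uniformDensity measurableSet_annulus volume_real_annulus_pos]
  norm_num

theorem lintegral_enorm_testFunction_le {ε : ℝ} (hε : 0 < ε) :
    ∫⁻ x, ‖testFunction E ε x‖ₑ ≤ 1 := by
  rw [← ofReal_integral_norm_eq_lintegral_enorm (integrable_testFunction ε), ENNReal.ofReal_le_one]
  exact integral_abs_testFunction_le hε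

theorem enorm_uniformDensity_le {S : Set E} {ρ : ℝ} (hS : S ⊆ ball 0 ρ) (x : E) :
    ‖uniformDensity S x‖ₑ ≤
      (ball (0 : E) ρ).indicator (fun _ => ((Real.toNNReal (volume.real S)⁻¹ : ℝ≥0) : ℝ≥0∞)) x := by
  rw [uniformDensity, enorm_indicator_eq_indicator_enorm]
  by_cases hx : x ∈ S
  · rw [indicator_of_mem hx, indicator_of_mem (hS hx), Real.enorm_of_nonneg (by positivity)]
    rfl
  · rw [indicator_of_notMem hx]; exact zero_le

theorem enorm_testFunction_le (ε : ℝ) (x : E) : ‖testFunction E ε x‖ₑ ≤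
    (ball (0 : E) ε).indicator
        (fun _ => ((Real.toNNReal (volume.real (ball (0 : E) ε))⁻¹ : ℝ≥0) : ℝ≥0∞)) x +
      (ball (0 : E) 3).indicator
        (fun _ => ((Real.toNNReal (volume.real (annulus E))⁻¹ : ℝ≥0) : ℝ≥0∞)) x := by
  refine le_trans ?_ (add_le_add (enorm_uniformDensity_le subset_rfl x)
    (enorm_uniformDensity_le (E := E) (S := annulus E) sdiff_subset x))
  refine (?_ : _ ≤ ‖uniformDensity (ball 0 ε) x - uniformDensity (annulus E) x‖ₑ).trans enorm_sub_le
  refine enorm_le_enorm_of_norm_le ?_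
  rw [testFunction, norm_div, Real.norm_ofNat]
  exact half_le_self (norm_nonneg _)

theorem exists_forall_enorm_testFunction_le (ε : ℝ) :
    ∃ M : ℝ≥0, ∀ x : E, ‖testFunction E ε x‖ₑ ≤ M := by
  refine ⟨Real.toNNReal (volume.real (ball (0 : E) ε))⁻¹ +
    Real.toNNReal (volume.real (annulus E))⁻¹, fun x => (enorm_testFunction_le ε x).trans ?_⟩
  rw [ENNReal.coe_add]
  exact add_le_add (indicator_le_self _ _ _) (indicator_le_self _ _ _)

theorem testFunction_eq_zero {ε : ℝ} (hε : ε ≤ 3) {x : E} (hx : x ∉ ball (0 : E) 3) :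
    testFunction E ε x = 0 := by
  have h1 : x ∉ ball (0 : E) ε := fun h => hx (ball_subset_ball hε h)
  have h2 : x ∉ annulus E := fun h => hx h.1
  simp [testFunction, uniformDensity, h1, h2]

theorem radialMass_testFunction (ε s : ℝ) : radialMass (testFunction E ε) s =
    (volume.real (closedBall (0 : E) s ∩ ball 0 ε) / volume.real (ball (0 : E) ε) -
      volume.real (closedBall 0 s ∩ annulus E) / volume.real (annulus E)) / 2 := by
  simp only [radialMass, testFunction]
  rw [integral_div, integral_sub
    (integrable_uniformDensity measurableSet_ball measure_ball_lt_top.ne).integrableOn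
    (integrable_uniformDensity measurableSet_annulus volume_annulus_ne_top).integrableOn,
    setIntegral_uniformDensity measurableSet_ball, setIntegral_uniformDensity measurableSet_annulus]

theorem radialMass_testFunction_of_le_two {ε s : ℝ} (hs : s ≤ 2) :
    radialMass (testFunction E ε) s =
    (volume.real (closedBall (0 : E) s ∩ ball 0 ε) / volume.real (ball (0 : E) ε)) / 2 := by
  have h : closedBall 0 s ∩ annulus E = ∅ := by
    ext x
    simp only [annulus, mem_inter_iff, mem_sdiff, mem_closedBall_zero_iff, mem_empty_iff_false,
      iff_false, not_and]
    intro h1 h2 h3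
    linarith
  rw [radialMass_testFunction, h]
  simp

theorem radialMass_testFunction_of_le {ε s : ℝ} (hε : 0 < ε) (hs : ε ≤ s) :
    radialMass (testFunction E ε) s =
    (1 - volume.real (closedBall 0 s ∩ annulus E) / volume.real (annulus E)) / 2 := by
  rw [radialMass_testFunction, inter_eq_right.2
    ((ball_subset_ball hs).trans ball_subset_closedBall), div_self (volume_real_ball_pos hε).ne']

theorem radialMass_testFunction_eq_half {ε s : ℝ} (hε : 0 < ε) (hs : ε ≤ s) (hs2 : s ≤ 2) :
    radialMass (testFunction E ε) s = 1 / 2 := by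
  rw [radialMass_testFunction_of_le_two hs2, inter_eq_right.2
    ((ball_subset_ball hs).trans ball_subset_closedBall), div_self (volume_real_ball_pos hε).ne']

theorem radialMass_testFunction_eq_zero {ε s : ℝ} (hε : 0 < ε) (hε3 : ε ≤ 3) (hs : 3 ≤ s) :
    radialMass (testFunction E ε) s = 0 := by
  rw [radialMass_eq_integral (ρ := 3) (fun x hx => testFunction_eq_zero hε3 fun h =>
    hx (ball_subset_closedBall h)) hs, integral_testFunction hε]

theorem radialMass_testFunction_nonneg {ε : ℝ} (hε : 0 < ε) (hε2 : ε ≤ 2) (s : ℝ) :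
    0 ≤ radialMass (testFunction E ε) s := by
  rcases le_total s 2 with h | h
  · rw [radialMass_testFunction_of_le_two h]; positivity
  · rw [radialMass_testFunction_of_le hε (hε2.trans h)]
    have : volume.real (closedBall 0 s ∩ annulus E) / volume.real (annulus E) ≤ 1 :=
      div_le_one_of_le₀ (measureReal_mono inter_subset_right volume_annulus_ne_top)
        measureReal_nonneg
    linarith

theorem abs_radialMass_le_one {f : E → ℝ} (hf : ∫⁻ x, ‖f x‖ₑ ≤ 1) (s : ℝ) :
    |radialMass f s| ≤ 1 := by
  have := (enorm_radialMass_le f s).trans hf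
  rwa [← ofReal_norm, ENNReal.ofReal_le_one] at this

/-- The linear decay at 0 makes s⁻¹ times a power p > 1 of the mass integrable there. -/
theorem exists_abs_radialMass_le {f : E → ℝ} {M : ℝ≥0} (hM : ∀ x, ‖f x‖ₑ ≤ M) {S : ℝ} :
    ∃ C : ℝ, ∀ s, 0 < s → s ≤ S → |radialMass f s| ≤ C * s := by
  have hD : 1 ≤ Module.finrank ℝ E := Module.finrank_pos
  refine ⟨M * (S ^ (Module.finrank ℝ E - 1) * volume.real (ball (0 : E) 1)), fun s hs hsS => ?_⟩
  have h1 : ‖radialMass f s‖ ≤ M * volume.real (closedBall (0 : E) s) := by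
    refine norm_setIntegral_le_of_norm_le_const measure_closedBall_lt_top fun x _ => ?_
    exact NNReal.coe_le_coe.2 (enorm_le_coe.1 (hM x))
  rw [Measure.addHaar_real_closedBall _ _ hs.le, Real.norm_eq_abs] at h1
  refine h1.trans ?_
  rw [mul_assoc]
  refine mul_le_mul_of_nonneg_left ?_ M.coe_nonneg
  have h2 : s ^ Module.finrank ℝ E = s ^ (Module.finrank ℝ E - 1) * s := by
    rw [← pow_succ, Nat.sub_add_cancel hD]
  rw [h2, mul_right_comm]
  gcongr

theorem integrableOn_inv_mul_radialMass_rpow {f : E → ℝ} (hf : AEStronglyMeasurable f) {M : ℝ≥0}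
    (hM : ∀ x, ‖f x‖ₑ ≤ M) (hf1 : ∫⁻ x, ‖f x‖ₑ ≤ 1) (h0 : ∀ s, 0 ≤ radialMass f s) {S : ℝ}
    (hS : ∀ s, S ≤ s → radialMass f s = 0) {p : ℝ} (hp : 1 < p) :
    IntegrableOn (fun s => s⁻¹ * radialMass f s ^ p) (Ioi 0) := by
  obtain ⟨C, hC⟩ := exists_abs_radialMass_le hM (S := S)
  have hmeas : Measurable fun s => s⁻¹ * radialMass f s ^ p :=
    measurable_inv.mul ((measurable_radialMass hf).pow_const p)
  have h1 : IntegrableOn (fun s => s⁻¹ * radialMass f s ^ p) (Ioc 0 S) := by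
    refine Measure.integrableOn_of_bounded (M := C) (by simp) hmeas.aestronglyMeasurable ?_
    refine (ae_restrict_iff' measurableSet_Ioc).2 (.of_forall fun s hs => ?_)
    have h2 : radialMass f s ^ p ≤ radialMass f s := by
      have h3 := (le_abs_self _).trans (abs_radialMass_le_one hf1 s)
      have := Real.rpow_le_rpow_of_exponent_ge' (h0 s) h3 zero_le_one hp.le
      rwa [Real.rpow_one] at this
    rw [Real.norm_of_nonneg (mul_nonneg (inv_nonneg.2 hs.1.le) (Real.rpow_nonneg (h0 s) _)),
      inv_mul_le_iff₀ hs.1]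
    have := (le_abs_self _).trans (hC s hs.1 hs.2)
    linarith
  have h2 : IntegrableOn (fun s => s⁻¹ * radialMass f s ^ p) (Ioi S) := by
    refine integrableOn_zero.congr_fun (fun s hs => ?_) measurableSet_Ioi
    rw [hS s (le_of_lt hs), Real.zero_rpow (by linarith), mul_zero]
  refine (h1.union h2).mono_set fun s hs => ?_
  rcases le_or_gt s S with h | h
  · exact Or.inl ⟨hs, h⟩
  · exact Or.inr h

/-- The enclosed mass is 1/2 for ε ≤ s ≤ 2, and the integral of 1/s over [ε, 1] is the logarithm. -/
theorem log_le_integral_inv_mul_radialMass_testFunction {p ε : ℝ} (hp : 1 < p) (hε : 0 < ε)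
    (hε1 : ε ≤ 1) :
    (1 / 2) ^ p * Real.log ε⁻¹ ≤
      ∫ s in Ioi 0, s⁻¹ * radialMass (testFunction E ε) s ^ p := by
  obtain ⟨M, hM⟩ := exists_forall_enorm_testFunction_le (E := E) ε
  have h0 := radialMass_testFunction_nonneg (E := E) hε (by linarith)
  have hint := integrableOn_inv_mul_radialMass_rpow (integrable_testFunction (E := E) ε).1 hM
    (lintegral_enorm_testFunction_le hε) h0
    (fun s hs => radialMass_testFunction_eq_zero hε (by linarith) hs) hp
  calc (1 / 2) ^ p * Real.log ε⁻¹ = ∫ s in ε..1, s⁻¹ * (1 / 2) ^ p := by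
        rw [intervalIntegral.integral_mul_const, integral_inv_of_pos hε one_pos, one_div ε,
          mul_comm]
    _ = ∫ s in Ioc ε 1, s⁻¹ * radialMass (testFunction E ε) s ^ p := by
        rw [intervalIntegral.integral_of_le hε1]
        refine setIntegral_congr_fun measurableSet_Ioc fun s hs => ?_
        rw [radialMass_testFunction_eq_half hε hs.1.le (by linarith [hs.2])]
    _ ≤ _ := by
        refine setIntegral_mono_set hint ?_ (.of_forall fun s hs => hε.trans hs.1)
        refine (ae_restrict_iff' measurableSet_Ioi).2 (.of_forall fun s hs => ?_)
        exact mul_nonneg (inv_nonneg.2 (le_of_lt hs)) (Real.rpow_nonneg (h0 s) _)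

end TestFunction

/-! ### Necessity: logarithmic growth unless the sphere integral vanishes -/

section Necessity

variable {E F : Type*} [NormedAddCommGroup E] [InnerProductSpace ℝ E] [Nontrivial E]
  [MeasurableSpace E] [BorelSpace E] [FiniteDimensional ℝ E]
  [NormedAddCommGroup F] [NormedSpace ℝ F] [CompleteSpace F] {K : E → F} {Φ : F → ℝ} {β p : ℝ}

/-- The degree -D against s^(D-1) leaves ds/s. The set S has to be conical only up to radius R,
because M vanishes beyond it. -/
theorem setIntegral_comp_radial_smul (hK : PosHomogeneous (-β) K)
    (hΦ : PosHomogeneous p Φ) (hp : 1 < p)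
    (hpβ : p * β = Module.finrank ℝ E) {M : ℝ → ℝ} (hM0 : ∀ s, 0 ≤ M s) {R : ℝ}
    (hMR : ∀ s, R ≤ s → M s = 0) {S : Set E} (hS : MeasurableSet S) {T : Set (sphere (0 : E) 1)}
    (hT : MeasurableSet T) (hST : ∀ (ζ : sphere (0 : E) 1) (s : ℝ), 0 < s → s < R →
      (s • (ζ : E) ∈ S ↔ ζ ∈ T))
    (hint : Integrable fun x : E => Φ (M ‖x‖ • K x)) :
    ∫ x in S, Φ (M ‖x‖ • K x) =
      (∫ s in Ioi 0, s⁻¹ * M s ^ p) * ∫ ζ in T, Φ (K ζ) ∂(volume : Measure E).toSphere := by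
  have hD : 1 ≤ Module.finrank ℝ E := Module.finrank_pos
  rw [← integral_indicator hS, integral_polar volume (hint.indicator hS), ← integral_mul_const]
  refine setIntegral_congr_fun measurableSet_Ioi fun s hs => ?_
  have hs : 0 < s := hs
  have hnorm : ∀ ζ : sphere (0 : E) 1, ‖s • (ζ : E)‖ = s := fun ζ => by
    rw [norm_smul, Real.norm_of_nonneg hs.le, norm_eq_of_mem_sphere, mul_one]
  have hzero : Φ 0 = 0 := hΦ.map_zero (by linarith)
  have hpt : ∀ ζ : sphere (0 : E) 1, S.indicator (fun x => Φ (M ‖x‖ • K x)) (s • (ζ : E)) =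
      (M s ^ p * s ^ (-(Module.finrank ℝ E : ℝ))) * T.indicator (fun ζ => Φ (K ζ)) ζ := by
    intro ζ
    rcases (hM0 s).eq_or_lt with h | h
    · have h1 : Φ (M ‖s • (ζ : E)‖ • K (s • (ζ : E))) = 0 := by
        rw [hnorm, ← h, zero_smul, hzero]
      rw [← h, Real.zero_rpow (by linarith), zero_mul, zero_mul]
      by_cases h2 : s • (ζ : E) ∈ S <;> simp [indicator, h2, h1]
    · have hsR : s < R := by
        by_contra h2
        exact h.ne' (hMR s (not_lt.1 h2))
      by_cases h2 : ζ ∈ T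
      · rw [indicator_of_mem h2, indicator_of_mem ((hST ζ s hs hsR).2 h2), hnorm, hK _ _ hs,
          smul_smul, hΦ _ _ (by positivity), smul_eq_mul, Real.mul_rpow h.le (by positivity),
          ← Real.rpow_mul hs.le]
        congr 3
        rw [← hpβ]
        ring
      · rw [indicator_of_notMem h2, indicator_of_notMem fun h3 => h2 ((hST ζ s hs hsR).1 h3),
          mul_zero]
  rw [integral_congr_ae (.of_forall hpt), integral_const_mul, integral_indicator hT, ← mul_assoc]
  congr 1
  rw [mul_left_comm, mul_comm]
  congr 1
  rw [← Real.rpow_natCast, ← Real.rpow_add hs, Nat.cast_sub hD, ← Real.rpow_neg_one]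
  congr 1
  push_cast
  ring

/-- Uniform in ε because the height of the bump times ε^D is constant. -/
theorem lintegral_absMeasure_testFunction_le (hβ : 0 ≤ β) (hβD : β < Module.finrank ℝ E) :
    ∃ L : ℝ≥0, ∀ ε, 0 < ε → ∀ x : E,
      ∫⁻ t, ‖x - t‖ₑ ^ (-β) ∂(absMeasure (testFunction E ε)) ≤ L * ‖x‖ₑ ^ (-β) := by
  obtain ⟨C, hC⟩ := lintegral_absMeasure_enorm_sub_rpow_le_of_ball (E := E) hβ hβD
  set v := volume.real (ball (0 : E) 1)
  refine ⟨C * (Real.toNNReal v⁻¹ + Real.toNNReal (volume.real (annulus E))⁻¹ *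
    (Real.toNNReal 3) ^ Module.finrank ℝ E), fun ε hε x => ?_⟩
  refine (hC _ _ _ ε 3 (integrable_testFunction ε).1 hε (by norm_num)
    (enorm_testFunction_le ε) x).trans_eq ?_
  have h1 : ((Real.toNNReal (volume.real (ball (0 : E) ε))⁻¹ : ℝ≥0) : ℝ≥0∞) *
      ENNReal.ofReal ε ^ Module.finrank ℝ E = (Real.toNNReal v⁻¹ : ℝ≥0) := by
    change ENNReal.ofReal _ * _ = ENNReal.ofReal _
    rw [← ENNReal.ofReal_pow hε.le, ← ENNReal.ofReal_mul (by positivity),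
      measureReal_def, Measure.addHaar_ball _ _ hε.le, ENNReal.toReal_mul,
      ENNReal.toReal_ofReal (by positivity), ← measureReal_def]
    congr 1
    have : ε ^ Module.finrank ℝ E ≠ 0 := by positivity
    rw [mul_inv, mul_right_comm, inv_mul_cancel₀ this, one_mul]
  rw [h1, ← mul_assoc]
  push_cast
  rfl

/-- Boundedness of the functional on the test functions forces cancellation. -/
theorem setIntegral_sphere_eq_zero (hK : PosHomogeneous (-β) K) (hKL : LipschitzOnSphere K)
    (hβ : 0 < β) (hΦ : PosHomogeneous p Φ) (hΦL : LipschitzOnSphere Φ) (hp : 1 < p)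
    (hpβ : p * β = Module.finrank ℝ E) {S : Set E} (hS : MeasurableSet S)
    {T : Set (sphere (0 : E) 1)} (hT : MeasurableSet T)
    (hST : ∀ (ζ : sphere (0 : E) 1) (s : ℝ), 0 < s → s < 3 → (s • (ζ : E) ∈ S ↔ ζ ∈ T))
    {B : ℝ} (hB : ∀ ε, 0 < ε → ε ≤ 1 → |∫ x in S, Φ (smulConv K (testFunction E ε) x)| ≤ B) :
    ∫ ζ in T, Φ (K ζ) ∂(volume : Measure E).toSphere = 0 := by
  have hβD : β < Module.finrank ℝ E := by rw [← hpβ]; nlinarith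
  obtain ⟨L, hL⟩ := lintegral_absMeasure_testFunction_le (E := E) hβ.le hβD
  obtain ⟨C, hC⟩ := lintegral_comp_smulConv_sub_le hK hKL hβ hΦ hΦL hp hpβ L
  set I := ∫ ζ in T, Φ (K ζ) ∂(volume : Measure E).toSphere
  have key : ∀ ε, 0 < ε → ε ≤ 1 → (1 / 2) ^ p * Real.log ε⁻¹ * |I| ≤ B + C := by
    intro ε hε hε1
    set f := testFunction E ε
    have hf := integrable_testFunction (E := E) ε
    obtain ⟨M, hM⟩ := exists_forall_enorm_testFunction_le (E := E) ε
    have hdiff := hC f M hf hM (hL ε hε) (lintegral_enorm_testFunction_le hε)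
    have hu := integrable_comp_smulConv hK hKL hβ hΦ hΦL hp hpβ hf hM (ρ := 3)
      (fun x hx => testFunction_eq_zero (by linarith) fun h => hx (ball_subset_closedBall h))
      (integral_testFunction hε)
    have hmeas : AEStronglyMeasurable fun x : E => Φ (radialMass f ‖x‖ • K x) :=
      (stronglyMeasurable_comp_radial_smul hK hKL hβ hΦ hΦL hp.le
        (measurable_radialMass hf.1)).aestronglyMeasurable
    have hdint : Integrable fun x : E => Φ (smulConv K f x) - Φ (radialMass f ‖x‖ • K x) :=
      ⟨hu.1.sub hmeas, by
        rw [hasFiniteIntegral_iff_enorm]; exact hdiff.trans_lt ENNReal.coe_lt_top⟩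
    have hmain : Integrable fun x : E => Φ (radialMass f ‖x‖ • K x) := by
      refine (hu.sub hdint).congr (.of_forall fun x => ?_)
      exact sub_sub_cancel _ _
    have hpolar := setIntegral_comp_radial_smul hK hΦ hp hpβ
      (radialMass_testFunction_nonneg (E := E) hε (by linarith)) (R := 3)
      (fun s hs => radialMass_testFunction_eq_zero hε (by linarith) hs) hS hT hST hmain
    have hsub : |(∫ x in S, Φ (smulConv K f x)) - ∫ x in S, Φ (radialMass f ‖x‖ • K x)| ≤ C := by
      rw [← integral_sub hu.integrableOn hmain.integrableOn]
      exact NNReal.coe_le_coe.2 (enorm_le_coe.1 ((enorm_integral_le_lintegral_enorm _).trans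
        ((setLIntegral_le_lintegral S _).trans hdiff)))
    rw [hpolar] at hsub
    have hlog := log_le_integral_inv_mul_radialMass_testFunction (E := E) hp hε hε1
    have hlog0 : 0 ≤ (1 / 2 : ℝ) ^ p * Real.log ε⁻¹ :=
      mul_nonneg (by positivity) (Real.log_nonneg ((one_le_inv₀ hε).2 hε1))
    calc _ ≤ |(∫ s in Ioi 0, s⁻¹ * radialMass f s ^ p) * I| := by
          rw [abs_mul]
          refine mul_le_mul_of_nonneg_right (hlog.trans (le_abs_self _)) (abs_nonneg _)
      _ ≤ B + C := by
          have h1 := abs_le.1 hsub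
          have h2 := abs_le.1 (hB ε hε hε1)
          rw [abs_le]
          constructor <;> linarith [h1.1, h1.2, h2.1, h2.2]
  by_contra hI
  have hI0 : 0 < |I| := abs_pos.2 hI
  have hc : 0 < (1 / 2 : ℝ) ^ p * |I| := by positivity
  have hBC : 0 ≤ B + C := by
    have := key 1 one_pos le_rfl
    simpa using this
  set X := (B + C + 1) / ((1 / 2 : ℝ) ^ p * |I|)
  have hX : 0 < X := by positivity
  -- With ε = exp(-X) the logarithm is X, chosen so that `key` reads B + C + 1 ≤ B + C.
  have h := key (Real.exp (-X)) (Real.exp_pos _) (Real.exp_le_one_iff.2 (by linarith))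
  rw [Real.exp_neg, inv_inv, Real.log_exp, mul_right_comm, mul_div_cancel₀ _ hc.ne'] at h
  linarith

end Necessity

/-! ### Both cancellation conditions from one half-space -/

section Final

variable {E F : Type*} [NormedAddCommGroup E] [InnerProductSpace ℝ E] [Nontrivial E]
  [MeasurableSpace E] [BorelSpace E] [FiniteDimensional ℝ E]
  [NormedAddCommGroup F] [NormedSpace ℝ F] [CompleteSpace F] {K : E → F} {Φ : F → ℝ} {β p : ℝ}

theorem smulConv_comp_sub_right (K : E → F) (f : E → ℝ) (a x : E) :
    smulConv K (fun t => f (t - a)) x = smulConv K f (x - a) := by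
  rw [smulConv, smulConv, ← integral_sub_right_eq_self (fun t => f t • K (x - a - t)) a]
  simp_rw [sub_sub_sub_cancel_right]

theorem smulConv_neg (K : E → F) (f : E → ℝ) (x : E) :
    smulConv K (fun t => -f t) x = -smulConv K f x := by
  simp_rw [smulConv, neg_smul]
  exact integral_neg _

theorem PosHomogeneous.comp_neg (hΦ : PosHomogeneous p Φ) : PosHomogeneous p fun y => Φ (-y) :=
  fun y c hc => by simp only; rw [← smul_neg, hΦ _ _ hc]

theorem LipschitzOnSphere.comp_neg (hΦ : LipschitzOnSphere Φ) :
    LipschitzOnSphere fun y => Φ (-y) := by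
  obtain ⟨L, hL⟩ := hΦ
  refine ⟨L, fun x hx y hy => ?_⟩
  have := hL (x := -x) (by simpa using hx) (y := -y) (by simpa using hy)
  rwa [edist_neg_neg] at this

/-- Boundedness of the functional over a half-space on translates of the test functions forces
cancellation on the half-sphere and on the sphere. -/
theorem integral_sphere_eq_zero_of_forall_abs_le (hK : PosHomogeneous (-β) K)
    (hKL : LipschitzOnSphere K) (hβ : 0 < β) (hΦ : PosHomogeneous p Φ) (hΦL : LipschitzOnSphere Φ)
    (hp : 1 < p) (hpβ : p * β = Module.finrank ℝ E) {ξ : E} (hξ : ‖ξ‖ = 1) {B : ℝ}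
    (hB : ∀ (ε : ℝ) (a : E), 0 < ε → ε ≤ 1 →
      |∫ x in {x | 0 < ⟪x, ξ⟫}, Φ (smulConv K (fun t => testFunction E ε (t - a)) x)| ≤ B) :
    ∫ ζ : sphere (0 : E) 1, Φ (K ζ) ∂(volume : Measure E).toSphere = 0 ∧
    ∫ ζ : sphere (0 : E) 1 in {ζ | 0 < ⟪(ζ : E), ξ⟫}, Φ (K ζ)
      ∂(volume : Measure E).toSphere = 0 := by
  have hmeas : ∀ c : ℝ, MeasurableSet {x : E | c < ⟪x, ξ⟫} := fun c =>
    measurableSet_lt measurable_const (by fun_prop)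
  constructor
  -- Translating by 4ξ turns the domain into the half-space above height -4, which contains the ball
  -- of radius 3, so every direction is seen.
  · have h := setIntegral_sphere_eq_zero hK hKL hβ hΦ hΦL hp hpβ (hmeas (-4)) (B := B)
      MeasurableSet.univ (fun ζ s hs hs3 => by
        simp only [mem_ofPred_eq, mem_univ, iff_true, inner_smul_left, conj_trivial]
        have h1 := abs_real_inner_le_norm (ζ : E) ξ
        rw [hξ, norm_eq_of_mem_sphere, one_mul] at h1
        nlinarith [(abs_le.1 h1).1]) (fun ε hε hε1 => by
        refine le_of_eq_of_le ?_ (hB ε ((4 : ℝ) • ξ) hε hε1)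
        congr 1
        simp_rw [smulConv_comp_sub_right]
        rw [← integral_indicator (hmeas _), ← integral_indicator (hmeas _),
          ← integral_sub_right_eq_self _ ((4 : ℝ) • ξ)]
        refine integral_congr_ae (.of_forall fun x => ?_)
        have h1 : x - (4 : ℝ) • ξ ∈ {x : E | -4 < ⟪x, ξ⟫} ↔ x ∈ {x : E | 0 < ⟪x, ξ⟫} := by
          simp only [mem_ofPred_eq, inner_sub_left, inner_smul_left, conj_trivial,
            real_inner_self_eq_norm_sq, hξ]
          constructor <;> intro h <;> linarith
        by_cases h2 : x ∈ {x : E | 0 < ⟪x, ξ⟫}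
        · refine (indicator_of_mem (h1.2 h2) _).trans ?_
          rw [indicator_of_mem h2]
        · refine (indicator_of_notMem (fun h => h2 (h1.1 h)) _).trans ?_
          rw [indicator_of_notMem h2])
    rwa [Measure.restrict_univ] at h
  · refine setIntegral_sphere_eq_zero hK hKL hβ hΦ hΦL hp hpβ (hmeas 0) (B := B)
      (measurableSet_lt measurable_const (by fun_prop)) (fun ζ s hs hs3 => ?_) fun ε hε hε1 => ?_
    · simp only [mem_ofPred_eq, inner_smul_left, conj_trivial]
      exact mul_pos_iff_of_pos_left hs
    · have := hB ε 0 hε hε1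
      simpa only [sub_zero] using this

end Final

/-! ### Admissible functions and the theorem -/

theorem BoundedCompactZeroMean.integrable {d : ℕ} {f : EuclideanSpace ℝ (Fin d) → ℝ}
    (hf : BoundedCompactZeroMean f) : Integrable f := by
  obtain ⟨M, hM⟩ := hf.bounded
  refine (integrableOn_iff_integrable_of_support_subset (subset_tsupport f)).1 ?_
  exact Measure.integrableOn_of_bounded (M := M) hf.hasCompactSupport.isCompact.measure_lt_top.ne
    hf.aestronglyMeasurable (.of_forall hM)

theorem BoundedCompactZeroMean.exists_enorm_le {d : ℕ} {f : EuclideanSpace ℝ (Fin d) → ℝ}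
    (hf : BoundedCompactZeroMean f) : ∃ M : ℝ≥0, ∀ x, ‖f x‖ₑ ≤ M := by
  obtain ⟨M, hM⟩ := hf.bounded
  exact ⟨M.toNNReal, fun x => enorm_le_coe.2 ((NNReal.le_toNNReal_of_coe_le (hM x)))⟩

theorem BoundedCompactZeroMean.exists_eq_zero {d : ℕ} {f : EuclideanSpace ℝ (Fin d) → ℝ}
    (hf : BoundedCompactZeroMean f) :
    ∃ ρ : ℝ, ∀ x, x ∉ closedBall (0 : EuclideanSpace ℝ (Fin d)) ρ → f x = 0 := by
  obtain ⟨ρ, hρ⟩ := hf.hasCompactSupport.isCompact.isBounded.subset_closedBall 0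
  exact ⟨ρ, fun x hx => image_eq_zero_of_notMem_tsupport fun h => hx (hρ h)⟩

theorem BoundedCompactZeroMean.neg {d : ℕ} {f : EuclideanSpace ℝ (Fin d) → ℝ}
    (hf : BoundedCompactZeroMean f) : BoundedCompactZeroMean fun x => -f x where
  aestronglyMeasurable := hf.aestronglyMeasurable.neg
  bounded := by simpa only [abs_neg] using hf.bounded
  hasCompactSupport := hf.hasCompactSupport.neg
  integral_eq_zero := by rw [integral_neg, hf.integral_eq_zero, neg_zero]

theorem boundedCompactZeroMean_testFunction {d : ℕ} [Nontrivial (EuclideanSpace ℝ (Fin d))]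
    {ε : ℝ} (hε : 0 < ε) (hε1 : ε ≤ 1) (a : EuclideanSpace ℝ (Fin d)) :
    BoundedCompactZeroMean fun x => testFunction (EuclideanSpace ℝ (Fin d)) ε (x - a) where
  aestronglyMeasurable := ((integrable_testFunction ε).comp_sub_right a).1
  bounded := by
    obtain ⟨M, hM⟩ := exists_forall_enorm_testFunction_le (E := EuclideanSpace ℝ (Fin d)) ε
    exact ⟨M, fun x => NNReal.coe_le_coe.2 (enorm_le_coe.1 (hM (x - a)))⟩
  hasCompactSupport := by
    refine HasCompactSupport.intro (isCompact_closedBall a 3) fun x hx => ?_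
    refine testFunction_eq_zero (by linarith) fun h => hx ?_
    rw [mem_closedBall, dist_eq_norm]
    exact (mem_ball_zero_iff.1 h).le
  integral_eq_zero := by
    rw [integral_sub_right_eq_self (testFunction (EuclideanSpace ℝ (Fin d)) ε) a,
      integral_testFunction hε]

theorem mainTheorem2 (d l : ℕ) (α p : ℝ) (hα : 0 < α) (hαd : α < d) (hp : p = d / (d - α))
    (K : EuclideanSpace ℝ (Fin d) → EuclideanSpace ℝ (Fin l))
    (hK : PosHomogeneous (α - d) K) (hKL : LipschitzOnSphere K)
    (Φ : EuclideanSpace ℝ (Fin l) → ℝ)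
    (hΦ : PosHomogeneous p Φ) (hΦL : LipschitzOnSphere Φ)
    (ξ : EuclideanSpace ℝ (Fin d)) (hξ : ‖ξ‖ = 1) :
    -- both integrals in the inequality below converge absolutely
    (∀ f : EuclideanSpace ℝ (Fin d) → ℝ, BoundedCompactZeroMean f →
      ConvolutionExists f K (ContinuousLinearMap.lsmul ℝ ℝ) volume ∧
      IntegrableOn (fun x => Φ (kernelConv K f x)) (halfSpace ξ) volume) ∧
    ((∃ C : ℝ, ∀ f : EuclideanSpace ℝ (Fin d) → ℝ, BoundedCompactZeroMean f →
        |∫ x in halfSpace ξ, Φ (kernelConv K f x)| ≤ C * (∫ x, |f x|) ^ p) ↔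
      SphereCancellation K Φ ∧ HalfSphereCancellation K Φ ξ) := by
  have hβ : 0 < (d : ℝ) - α := by linarith
  have hK' : PosHomogeneous (-((d : ℝ) - α)) K := by rwa [neg_sub]
  have hD : (Module.finrank ℝ (EuclideanSpace ℝ (Fin d)) : ℝ) = d := by
    rw [finrank_euclideanSpace_fin]
  have hpβ : p * (d - α) = Module.finrank ℝ (EuclideanSpace ℝ (Fin d)) := by
    rw [hD, hp, div_mul_cancel₀ _ hβ.ne']
  have hp1 : 1 < p := by rw [hp, one_lt_div hβ]; linarith
  have hβD : (d : ℝ) - α < Module.finrank ℝ (EuclideanSpace ℝ (Fin d)) := by rw [hD]; linarith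
  have : Nontrivial (EuclideanSpace ℝ (Fin d)) :=
    Module.nontrivial_of_finrank_pos (R := ℝ) (by exact_mod_cast hβ.trans hβD)
  have hint : ∀ f : EuclideanSpace ℝ (Fin d) → ℝ, BoundedCompactZeroMean f →
      Integrable fun x => Φ (smulConv K f x) := fun f hf => by
    obtain ⟨M, hM⟩ := hf.exists_enorm_le
    obtain ⟨ρ, hρ⟩ := hf.exists_eq_zero
    exact integrable_comp_smulConv hK' hKL hβ hΦ hΦL hp1 hpβ hf.integrable hM hρ
      hf.integral_eq_zero
  refine ⟨fun f hf => ⟨fun x => ?_, (hint f hf).integrableOn⟩, ?_, ?_⟩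
  · obtain ⟨M, hM⟩ := hf.exists_enorm_le
    exact integrable_smul_kernel hK' hKL hβ hβD hf.integrable hM x
  · rintro ⟨C, hC⟩
    have hbound : ∀ f : EuclideanSpace ℝ (Fin d) → ℝ, BoundedCompactZeroMean f →
        ∫ x, |f x| ≤ 1 → |∫ x in {x | 0 < ⟪x, ξ⟫}, Φ (smulConv K f x)| ≤ |C| := by
      intro f hf hf1
      have h0 : 0 ≤ ∫ x, |f x| := integral_nonneg fun x => abs_nonneg _
      calc _ ≤ C * (∫ x, |f x|) ^ p := hC f hf
        _ ≤ |C| * (∫ x, |f x|) ^ p := by gcongr; exact le_abs_self C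
        _ ≤ |C| * 1 := by gcongr; exact Real.rpow_le_one h0 hf1 (by linarith)
        _ = |C| := mul_one _
    have htest : ∀ ε, 0 < ε → ∀ a,
        ∫ x, |testFunction (EuclideanSpace ℝ (Fin d)) ε (x - a)| ≤ 1 := fun ε hε a => by
      rw [integral_sub_right_eq_self (fun x => |testFunction (EuclideanSpace ℝ (Fin d)) ε x|) a]
      exact integral_abs_testFunction_le hε
    obtain ⟨h1, h3⟩ := integral_sphere_eq_zero_of_forall_abs_le hK' hKL hβ hΦ hΦL hp1 hpβ hξ
      fun ε a hε hε1 =>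
        hbound _ (boundedCompactZeroMean_testFunction hε hε1 a) (htest ε hε a)
    -- The conditions for -K come from the same argument for y ↦ Φ(-y), that is, from the negatives
    -- of the test functions.
    obtain ⟨h2, h4⟩ := integral_sphere_eq_zero_of_forall_abs_le hK' hKL hβ hΦ.comp_neg
      hΦL.comp_neg hp1 hpβ hξ (B := |C|) fun ε a hε hε1 => by
        have h := hbound _ (boundedCompactZeroMean_testFunction hε hε1 a).neg (by
          simpa only [abs_neg] using htest ε hε a)
        simpa only [smulConv_neg] using h
    exact ⟨⟨h1, h2⟩, h3, h4⟩
  · rintro ⟨⟨h1, h2⟩, h3, h4⟩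
    obtain ⟨A, hA⟩ := exists_abs_setIntegral_halfSpace_le hK' hKL hβ hΦ hΦL hp1 hpβ hξ h1 h2 h3 h4
    refine ⟨A, fun f hf => ?_⟩
    obtain ⟨M, hM⟩ := hf.exists_enorm_le
    obtain ⟨ρ, hρ⟩ := hf.exists_eq_zero
    exact hA f M ρ hf.integrable hM hρ (hint f hf).integrableOn
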